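/- Fix a field $\kappa$ and an integer $r\ge 0$; homology is singular homology with coefficients in $\kappa$. For a map $f:X\to\mathbb R$ write $X_t=f^{-1}(t)$ and $X_{[t,t']}=f^{-1}([t,t'])$ for $t\le t'$. A continuous map $f:X\to\mathbb R$ is called tame, with critical values $\min f=t_0<t_1<\dots<t_N=\max f$, if $X$ is a compact (metrizable) ANR and: (i) every $t\notin\{t_0,\dots,t_N\}$ has an $\epsilon>0$ such that $f:f^{-1}(t-\epsilon,t+\epsilon)\to(t-\epsilon,t+\epsilon)$ and the projection $X_t\times(t-\epsilon,t+\epsilon)\to(t-\epsilon,t+\epsilon)$ are fibrewise homotopy equivalent; (ii) every $t_i$ has an $\epsilon>0$ such that $X_{[t_i,t_i+\epsilon]}$ and $X_{[t_i-\epsilon,t_i]}$ deformation retract onto $X_{t_i}$ (through homotopies constant on $X_{t_i}$). For $t''\le t\le t'$ let $L_r^+(t;t')=\ker(H_r(X_t)\to H_r(X_{[t,t']}))$, $L_r^-(t;t'')=\ker(H_r(X_t)\to H_r(X_{[t'',t]}))$, and let $I_r(t,t')\subseteq H_r(X_{[t,t']})$ be the intersection of the images of $H_r(X_t)$ and $H_r(X_{t'})$.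 Put $l_r(t)=\dim H_r(X_t)$, $l_r^+(t;t')=\dim L_r^+(t;t')$, $l_r^-(t;t'')=\dim L_r^-(t;t'')$, $e_r(t;t',t'')=\dim(L_r^+(t;t')\cap L_r^-(t;t''))$, $i_r(t,t')=\dim I_r(t,t')$. A level bar code of $f$ in degree $r$ is a finite family of bars, that is, of intervals $[t_i,t_j]$ ($i\le j$), $(t_i,t_j)$, $(t_i,t_j]$, $[t_i,t_j)$ ($i<j$), together with a basis of each $H_r(X_t)$ indexed by the bars containing $t$, such that for all $t\le t'$ the following holds in $H_r(X_{[t,t']})$. The basis elements of $H_r(X_t)$ and $H_r(X_{t'})$ belonging to a bar through both $t$ and $t'$ have the same image. The element of $H_r(X_t)$ belonging to a bar through $t$ but not $t'$ whose right end is open maps to $0$, and so does the element of $H_r(X_{t'})$ belonging to a bar through $t'$ but not $t$ whose left end is open. The images belonging to all remaining bars through $t$ or $t'$ (one image for each bar) are linearly independent. For a level bar code, $N_r(t_k,t_j)$, $N_r(t_k,t_j]$, $N_r[t_k,t_j)$, $N_r[t_k,t_j]$ denote the numbers of bars equal to the indicated interval. **Theorem.** Let $f:X\to\mathbb R$ be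 tame with critical values $t_0<\dots<t_N$; put $t_{-1}=-\infty$ and $t_{N+1}=+\infty$. Then all $H_r(X_t)$ are finite-dimensional, $f$ has a level bar code in degree $r$, and the numbers $i_r(t,t')$ determine $l_r(t)$, $l_r^+(t;t')$, $l_r^-(t;t'')$ and $e_r(t;t',t'')$: if $g:Y\to\mathbb R$ is another tame map and $i_r(t,t')$ has the same value for $f$ and for $g$ for all $t\le t'$, then each of $l_r(t)$, $l_r^+(t;t')$, $l_r^-(t;t'')$, $e_r(t;t',t'')$ has the same value for $f$ and for $g$, for all $t''\le t\le t'$. Explicitly, $l_r(t)=i_r(t,t)$ for all $t$, and every level bar code of $f$ in degree $r$ satisfies 1. $N_r(t_k,t_j)=i_r(t'',t')-i_r(t_k,t')-i_r(t'',t_j)+i_r(t_k,t_j)$ for $k<j$ and any $t''\le t'$ with $t_k<t''<t_{k+1}$, $t_{j-1}<t'<t_j$; 2. $N_r[t_k,t_j]=i_r(t_k,t_j)-i_r(t'',t_j)-i_r(t_k,t')+i_r(t'',t')$ for $k\le j$ and any $t_{k-1}<t''<t_k$, $t_j<t'<t_{j+1}$; 3. $N_r(t_k,t_j]=i_r(t'',t_j)-i_r(t_k,t_j)-i_r(t'',t')+i_r(t_k,t')$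 for $k<j$ and any $t_k<t''<t_{k+1}$, $t_j<t'<t_{j+1}$; 4. $N_r[t_k,t_j)=i_r(t_k,t')-i_r(t_k,t_j)-i_r(t'',t')+i_r(t'',t_j)$ for $k<j$ and any $t_{k-1}<t''<t_k$, $t_{j-1}<t'<t_j$; and, for all $t''\le t\le t'$, $$l_r^+(t;t')=\sum_{t_i\le t<t_j\le t'}N_r[t_i,t_j)+\sum_{t_i<t<t_j\le t'}N_r(t_i,t_j),$$ $$l_r^-(t;t'')=\sum_{t''\le t_i<t\le t_j}N_r(t_i,t_j]+\sum_{t''\le t_i<t<t_j}N_r(t_i,t_j),$$ $$e_r(t;t',t'')=\sum_{t''\le t_i<t<t_j\le t'}N_r(t_i,t_j).$$ -/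

import Mathlib

universe u v w

open CategoryTheory

namespace LevelPersistence

/-! ### Tame maps -/

/-- Compact absolute neighbourhood retract: a compact metrizable space which, whenever it is
embedded as a closed subset of a metrizable space `Y`, is a retract of an open neighbourhood of
itself in `Y`. -/
structure IsCompactANR (X : Type u) [TopologicalSpace X] : Prop where
  compact : CompactSpace X
  metrizable : TopologicalSpace.MetrizableSpace X
  retract : ∀ (Y : Type u) [TopologicalSpace Y] [TopologicalSpace.MetrizableSpace Y] (e : X → Y),
    Topology.IsClosedEmbedding e →
      ∃ U : Set Y, IsOpen U ∧ Set.range e ⊆ U ∧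
        ∃ ρ : C(U, X), ∀ (x : X) (hx : e x ∈ U), ρ ⟨e x, hx⟩ = x

/-- Two spaces `p : E → B` and `q : E' → B` over `B` are fibrewise homotopy equivalent. -/
def FiberwiseHomotopyEquivalent {E : Type u} {E' : Type v} {B : Type w} [TopologicalSpace E]
    [TopologicalSpace E'] (p : E → B) (q : E' → B) : Prop :=
  ∃ (φ : C(E, E')) (ψ : C(E', E)), (∀ e, q (φ e) = p e) ∧ (∀ e', p (ψ e') = q e') ∧
    (∃ H : (ψ.comp φ).Homotopy (ContinuousMap.id E), ∀ s e, p (H (s, e)) = p e) ∧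
    (∃ H : (φ.comp ψ).Homotopy (ContinuousMap.id E'), ∀ s e', q (H (s, e')) = q e')

/-- `A ⊆ S` and there is a deformation retraction of `S` onto `A`, i.e. a homotopy of self-maps
of `S`, constant on `A`, from the identity to a map with values in `A`. -/
def IsDeformationRetract {X : Type u} [TopologicalSpace X] (A S : Set X) : Prop :=
  A ⊆ S ∧ ∃ H : C(unitInterval × S, S), (∀ x, H (0, x) = x) ∧ (∀ x, (H (1, x) : X) ∈ A) ∧
    ∀ s (x : S), (x : X) ∈ A → H (s, x) = x

/-- `f : X → ℝ` is a tame map with critical values `c 0 < c 1 < ⋯ < c N`. -/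
structure IsTame {X : Type u} [TopologicalSpace X] (f : X → ℝ) {N : ℕ} (c : Fin (N + 1) → ℝ) :
    Prop where
  continuous : Continuous f
  compactANR : IsCompactANR X
  strictMono : StrictMono c
  isLeast : IsLeast (Set.range f) (c 0)
  isGreatest : IsGreatest (Set.range f) (c (Fin.last N))
  /-- Near a regular value the map is fibrewise homotopy equivalent to a product projection. -/
  regular : ∀ t, t ∉ Set.range c → ∃ ε > 0, FiberwiseHomotopyEquivalent
    (fun x : f ⁻¹' Set.Ioo (t - ε) (t + ε) => f x)
    (fun y : (f ⁻¹' {t}) × (Set.Ioo (t - ε) (t + ε)) => (y.2 : ℝ))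
  critical : ∀ i, ∃ ε > 0,
    IsDeformationRetract (f ⁻¹' {c i}) (f ⁻¹' Set.Icc (c i) (c i + ε)) ∧
    IsDeformationRetract (f ⁻¹' {c i}) (f ⁻¹' Set.Icc (c i - ε) (c i))

/-! ### Level persistence and the relevant level persistence numbers

Here `X_t = f ⁻¹' {t}` and `X_{[t,t']} = f ⁻¹' [t, t']`. The closed interval with end points
`t, t'` is written `Set.uIcc t t'`; it is `Set.Icc t t'` when `t ≤ t'`, and it contains both `t`
and `t'` in any case. -/

noncomputable section

variable (κ : Type v) [Field κ] (r : ℕ) {X : Type u} [TopologicalSpace X] (f : X → ℝ)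

/-- The singular homology `H_r(f ⁻¹ S; κ)`. -/
abbrev preimageHomology (S : Set ℝ) : ModuleCat.{max u v} κ :=
  ((AlgebraicTopology.singularHomologyFunctor (ModuleCat.{max u v} κ) r).obj
    (ModuleCat.of κ (ULift.{u} κ))).obj (TopCat.of (f ⁻¹' S))

/-- The map `H_r(f ⁻¹ S) → H_r(f ⁻¹ T)` induced by the inclusion, for `S ⊆ T`. -/
def inclusionMap {S T : Set ℝ} (h : S ⊆ T) :
    preimageHomology κ r f S →ₗ[κ] preimageHomology κ r f T :=
  (((AlgebraicTopology.singularHomologyFunctor (ModuleCat.{max u v} κ) r).obj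
    (ModuleCat.of κ (ULift.{u} κ))).map
      (TopCat.ofHom ⟨Set.inclusion (Set.preimage_mono (f := f) h), by fun_prop⟩)).hom

/-- `H_r(X_t)`. -/
abbrev levelHomology (t : ℝ) : ModuleCat.{max u v} κ := preimageHomology κ r f {t}

/-- `H_r(X_t) → H_r(X_{[t,t']})`. -/
def fromLeft (t t' : ℝ) :
    levelHomology κ r f t →ₗ[κ] preimageHomology κ r f (Set.uIcc t t') :=
  inclusionMap κ r f (Set.singleton_subset_iff.2 Set.left_mem_uIcc)

/-- `H_r(X_{t'}) → H_r(X_{[t,t']})`. -/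
def fromRight (t t' : ℝ) :
    levelHomology κ r f t' →ₗ[κ] preimageHomology κ r f (Set.uIcc t t') :=
  inclusionMap κ r f (Set.singleton_subset_iff.2 Set.right_mem_uIcc)

/-- `L_r^+(t; t')`, for `t ≤ t'`. -/
def LPlus (t t' : ℝ) : Submodule κ (levelHomology κ r f t) := LinearMap.ker (fromLeft κ r f t t')

/-- `L_r^-(t; t'')`, for `t'' ≤ t`. -/
def LMinus (t t'' : ℝ) : Submodule κ (levelHomology κ r f t) :=
  LinearMap.ker (fromRight κ r f t'' t)

/-- `I_r(t, t')`, for `t ≤ t'`. -/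
def IInter (t t' : ℝ) : Submodule κ (preimageHomology κ r f (Set.uIcc t t')) :=
  LinearMap.range (fromLeft κ r f t t') ⊓ LinearMap.range (fromRight κ r f t t')

/-- `l_r(t)`. -/
def lNum (t : ℝ) : ℕ := Module.finrank κ (levelHomology κ r f t)

/-- `l_r^+(t; t')`. -/
def lPlusNum (t t' : ℝ) : ℕ := Module.finrank κ (LPlus κ r f t t')

/-- `l_r^-(t; t'')`. -/
def lMinusNum (t t'' : ℝ) : ℕ := Module.finrank κ (LMinus κ r f t t'')

/-- `e_r(t; t', t'')`. -/
def eNum (t t' t'' : ℝ) : ℕ :=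
  Module.finrank κ (LPlus κ r f t t' ⊓ LMinus κ r f t t'' :
    Submodule κ (levelHomology κ r f t))

/-- `i_r(t, t')`. -/
def iNum (t t' : ℝ) : ℕ := Module.finrank κ (IInter κ r f t t')

/-! ### Bar codes -/

/-- An interval with end points among `N + 1` critical values, each end being closed or open. Only
a closed interval may be a single point. -/
structure Bar (N : ℕ) where
  left : Fin (N + 1)
  right : Fin (N + 1)
  leftClosed : Bool
  rightClosed : Bool
  valid : left < right ∨ (left = right ∧ leftClosed = true ∧ rightClosed = true)

/-- The interval of the real line that a bar stands for. -/
def Bar.toSet {N : ℕ} (c : Fin (N + 1) → ℝ) (b : Bar N) : Set ℝ :=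
  {x | (c b.left < x ∨ (b.leftClosed = true ∧ c b.left = x)) ∧
    (x < c b.right ∨ (b.rightClosed = true ∧ c b.right = x))}

/-- A level bar code of `f` in degree `r`: a decomposition of the level persistence
`H_r(X_t) → H_r(X_{[t,t']}) ← H_r(X_{t'})`, `t ≤ t'`, into intervals. It is a finite family of
bars together with, for each `t`, a basis of `H_r(X_t)` indexed by the bars that contain `t`. The
class of a bar is detected along the bar, it dies at an open end, and it is not detected beyond a
closed end. -/
structure LevelBarcode {N : ℕ} (c : Fin (N + 1) → ℝ) where
  size : ℕ
  bar : Fin size → Bar N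
  basis : ∀ t, Module.Basis {b : Fin size // t ∈ (bar b).toSet c} κ (levelHomology κ r f t)
  /-- The classes of a bar at two of its levels agree in between. -/
  detect : ∀ t t', t ≤ t' → ∀ b (h : t ∈ (bar b).toSet c) (h' : t' ∈ (bar b).toSet c),
    fromLeft κ r f t t' (basis t ⟨b, h⟩) = fromRight κ r f t t' (basis t' ⟨b, h'⟩)
  /-- The class of a bar dies upward at an open right end. -/
  dieUp : ∀ t t', t ≤ t' → ∀ b (h : t ∈ (bar b).toSet c), t' ∉ (bar b).toSet c →
    (bar b).rightClosed = false → fromLeft κ r f t t' (basis t ⟨b, h⟩) = 0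
  /-- The class of a bar dies downward at an open left end. -/
  dieDown : ∀ t t', t ≤ t' → ∀ b (h' : t' ∈ (bar b).toSet c), t ∉ (bar b).toSet c →
    (bar b).leftClosed = false → fromRight κ r f t t' (basis t' ⟨b, h'⟩) = 0
  /-- The images in `H_r(X_{[t,t']})` of the classes that do not die (those of the bars through
  both `t` and `t'`, of the bars through `t` with a closed right end before `t'`, and of the bars
  through `t'` with a closed left end after `t`) are linearly independent. In particular no
  class is detected beyond a closed end. -/
  independent : ∀ t t', t ≤ t' → LinearIndependent κ (Sum.elim
    (fun b : {b : Fin size // t ∈ (bar b).toSet c ∧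
        (t' ∈ (bar b).toSet c ∨ (bar b).rightClosed = true)} =>
      fromLeft κ r f t t' (basis t ⟨b.1, b.2.1⟩))
    (fun b : {b : Fin size // t' ∈ (bar b).toSet c ∧
        t ∉ (bar b).toSet c ∧ (bar b).leftClosed = true} =>
      fromRight κ r f t t' (basis t' ⟨b.1, b.2.1⟩)))

namespace LevelBarcode

variable {κ r f} {N : ℕ} {c : Fin (N + 1) → ℝ} (B : LevelBarcode κ r f c)

/-- The number of bars with end points `c k`, `c j` and ends of the given kinds. -/
def count (leftClosed rightClosed : Bool) (k j : Fin (N + 1)) : ℕ :=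
  Nat.card {b : Fin B.size // (B.bar b).left = k ∧ (B.bar b).right = j ∧
    (B.bar b).leftClosed = leftClosed ∧ (B.bar b).rightClosed = rightClosed}

/-- The number of bars `(c k, c j)`. -/
def openOpen (k j : Fin (N + 1)) : ℕ := B.count false false k j

/-- The number of bars `(c k, c j]`. -/
def openClosed (k j : Fin (N + 1)) : ℕ := B.count false true k j

/-- The number of bars `[c k, c j)`. -/
def closedOpen (k j : Fin (N + 1)) : ℕ := B.count true false k j

/-- The number of bars `[c k, c j]`. -/
def closedClosed (k j : Fin (N + 1)) : ℕ := B.count true true k j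

end LevelBarcode

end

/-- `s` lies strictly between `c k` and the next critical value, if there is one. -/
def JustAbove {N : ℕ} (c : Fin (N + 1) → ℝ) (k : Fin (N + 1)) (s : ℝ) : Prop :=
  c k < s ∧ ∀ m, k < m → s < c m

/-- `s` lies strictly between the previous critical value, if there is one, and `c k`. -/
def JustBelow {N : ℕ} (c : Fin (N + 1) → ℝ) (k : Fin (N + 1)) (s : ℝ) : Prop :=
  s < c k ∧ ∀ m, m < k → c m < s

end LevelPersistence

open LevelPersistence

/-!
The homology of neighbouring levels is compared by linear relations: a class at `t` and a class at
`t'` are related if they agree in the homology of `f ⁻¹ [t, t']` (`levelRel`). A level bar code is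
a decomposition of these relations into intervals, and all the numbers in question count intervals.

*Relations compose.* If `t ≤ s ≤ t'`, then the relation from `t` to `t'` is the composite of the
relations from `t` to `s` and from `s` to `t'` (`LocallyTame.mem_levelRel_comp`). This is the
exactness of a Mayer–Vietoris sequence in its middle term (`LocallyTame.exact_at`). Exactness is
proved for relatively open covers by iterated barycentric subdivision of singular chains
(`mayerVietoris_exact`). It applies to closed intervals because tameness makes the inclusion of an
interval into a slightly larger one an isomorphism in homology. To see this, the space is pushed
along the levels (`LocallyTame.pushDown`): between critical values by the local product structure up
to fibrewise homotopy, next to a critical value by the given deformation retraction. The latter need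
not respect the levels, but by compactness it moves points near the critical level only a little.

*Levels have finite-dimensional homology.* In a compact absolute neighbourhood retract, the
inclusion of a closed set into an open neighbourhood has finite rank in homology
(`finite_range_setMap`): after an embedding into a Banach space it factors through a finite union of
balls, whose homology is finite-dimensional by the Mayer–Vietoris argument `mayerVietoris_finite`.
The homology of a level injects into that of a thin open slab around it.

*Existence.* Choose a level in each critical value, between any two neighbouring ones, and outside
of all of them. The resulting chain of relations between finite-dimensional spaces decomposes into
intervals (`ChainDecomposition.nonempty`). The induction along the chain carries a basis of the last
space which may be changed by any unitriangular matrix for a suitable order (`IsFlexible`), so that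
it can be adapted to the kernel and the domain of the next relation. A bar can start
or end in two ways, by being related to zero or by not being in the range or the domain of the
relation. Between a critical level and a neighbouring noncritical one the relation is the graph of a
map out of the noncritical level, so the kind of an end is decided by whether it is located at a
critical value: this gives the closed and open ends. Two levels between the same neighbouring
critical values are related by an isomorphism, which transports the decomposition to all levels
(`IsTame.exists_levelDecomposition`, `IsTame.exists_levelBarcode`).

*Counting.* For an arbitrary level bar code, kernels and intersections of images are spanned by
parts of linearly independent families, so that `l_r`, `l_r^±`, `e_r` and `i_r` are numbers of bars
(`LevelBarcode.iNum_eq_card` and its companions). In particular `i_r(t, t')` is the number of bars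
which have started at `t` and reach `t'`. Differences in `t` and `t'` across a critical value
isolate the bars with an end there, which gives the formulas for the numbers of bars by inclusion
and exclusion, and expresses the other numbers through the numbers `i_r`
(`LevelBarcode.eq_of_iNum_eq`).
-/

open CategoryTheory AlgebraicTopology

namespace LevelPersistence

noncomputable section

/-! ### Singular chains as finitely supported functions -/

section Chains

open Simplicial

variable (κ : Type v) [Field κ]

/-- The singular `n`-chains of `X`, as finitely supported functions on the singular simplices. -/
abbrev SingularChain (n : ℕ) (X : Type u) [TopologicalSpace X] : Type (max u v) :=
  C(stdSimplex ℝ (Fin (n + 1)), X) →₀ κ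

/-- The field `κ` as a coefficient object, lifted to the universe of the chain modules. -/
abbrev coeffs : ModuleCat.{max u v} κ := ModuleCat.of κ (ULift.{u} κ)

/-- Mathlib's singular chain complex with coefficients `κ`. -/
abbrev chainCx (Y : TopCat.{u}) : ChainComplex (ModuleCat.{max u v} κ) ℕ :=
  ((singularChainComplexFunctor (ModuleCat.{max u v} κ)).obj (coeffs.{u} κ)).obj Y

/-- The chain map induced by a continuous map. -/
abbrev chainCxMap {Y Z : TopCat.{u}} (g : Y ⟶ Z) : chainCx κ Y ⟶ chainCx κ Z :=
  ((singularChainComplexFunctor (ModuleCat.{max u v} κ)).obj (coeffs.{u} κ)).map g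

/-- The simplices of the singular simplicial set are the continuous maps from standard simplices. -/
abbrev simplexEquiv (Y : TopCat.{u}) (n : ℕ) :
    (TopCat.toSSet.obj Y) _⦋n⦌ ≃ C(stdSimplex ℝ (Fin (n + 1)), Y) :=
  TopCat.toSSetObjEquiv Y (.op ⦋n⦌)

/-- The generator of Mathlib's chain module given by a singular simplex. -/
def gen (Y : TopCat.{u}) (n : ℕ) (x : (TopCat.toSSet.obj Y) _⦋n⦌) : (chainCx κ Y).X n :=
  (SSet.ιChainComplex (TopCat.toSSet.obj Y) (R := coeffs.{u} κ) x).hom (ULift.up 1)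

/-- Mathlib's chains expressed as finitely supported functions. -/
def toChain (Y : TopCat.{u}) (n : ℕ) : ((chainCx κ Y).X n) →ₗ[κ] SingularChain κ n Y :=
  (Limits.Cofan.IsColimit.desc
    (SSet.isColimitChainComplexXCofan (TopCat.toSSet.obj Y) (coeffs.{u} κ) n)
    (fun x => ModuleCat.ofHom (Y := ModuleCat.of κ (SingularChain κ n Y))
      (Finsupp.lsingle (simplexEquiv Y n x) ∘ₗ ULift.moduleEquiv.toLinearMap))).hom

lemma toChain_gen (Y : TopCat.{u}) (n : ℕ) (x) :
    toChain κ Y n (gen κ Y n x) = Finsupp.single (simplexEquiv Y n x) 1 := by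
  have := Limits.Cofan.IsColimit.fac
    (SSet.isColimitChainComplexXCofan (TopCat.toSSet.obj Y) (coeffs.{u} κ) n)
    (fun x => ModuleCat.ofHom (Y := ModuleCat.of κ (SingularChain κ n Y))
      (Finsupp.lsingle (simplexEquiv Y n x) ∘ₗ ULift.moduleEquiv.toLinearMap)) x
  exact congrArg (fun g => g.hom (ULift.up 1)) this

/-- The inverse of `toChain`. -/
def ofChain (Y : TopCat.{u}) (n : ℕ) : SingularChain κ n Y →ₗ[κ] ((chainCx κ Y).X n) :=
  Finsupp.linearCombination κ (fun σ => gen κ Y n ((simplexEquiv Y n).symm σ))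

lemma toChain_ofChain (Y : TopCat.{u}) (n : ℕ) (c) :
    toChain κ Y n (ofChain κ Y n c) = c := by
  suffices h : toChain κ Y n ∘ₗ ofChain κ Y n = LinearMap.id from congrArg (fun g => g c) h
  ext σ : 2
  simp [ofChain, toChain_gen]

lemma chainCx_ext {Y : TopCat.{u}} {n : ℕ} {M : Type (max u v)} [AddCommGroup M] [Module κ M]
    {g h : ((chainCx κ Y).X n) →ₗ[κ] M} (H : ∀ x, g (gen κ Y n x) = h (gen κ Y n x)) :
    g = h := by
  have : ModuleCat.ofHom g = ModuleCat.ofHom h := by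
    refine SSet.chainComplex_hom_ext (X := TopCat.toSSet.obj Y) (R := coeffs.{u} κ) (fun x => ?_)
    have key : ∀ G : (coeffs.{u} κ) →ₗ[κ] M, ∀ a : κ, G (ULift.up a) = a • G (ULift.up 1) := by
      intro G a
      rw [← map_smul]
      congr 1
      ext
      simp
    ext ⟨a⟩
    exact (key (SSet.ιChainComplex (TopCat.toSSet.obj Y) (R := coeffs.{u} κ) x ≫
      ModuleCat.ofHom (X := (chainCx κ Y).X n) g).hom a).trans
      ((congrArg (a • ·) (H x)).trans (key (SSet.ιChainComplex (TopCat.toSSet.obj Y)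
        (R := coeffs.{u} κ) x ≫ ModuleCat.ofHom (X := (chainCx κ Y).X n) h).hom a).symm)
  exact ModuleCat.hom_ext_iff.1 this

lemma ofChain_toChain (Y : TopCat.{u}) (n : ℕ) (c) :
    ofChain κ Y n (toChain κ Y n c) = c := by
  suffices h : ofChain κ Y n ∘ₗ toChain κ Y n = LinearMap.id from congrArg (fun g => g c) h
  apply chainCx_ext
  intro x
  simp [ofChain, toChain_gen]

/-- The `i`-th face of a singular simplex. -/
def face {n : ℕ} {X : Type u} [TopologicalSpace X] (i : Fin (n + 2))
    (σ : C(stdSimplex ℝ (Fin (n + 2)), X)) : C(stdSimplex ℝ (Fin (n + 1)), X) :=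
  σ.comp ⟨stdSimplex.map i.succAbove, stdSimplex.continuous_map _⟩

/-- The boundary operator on singular chains. -/
def bd (n : ℕ) (X : Type u) [TopologicalSpace X] :
    SingularChain κ (n + 1) X →ₗ[κ] SingularChain κ n X :=
  ∑ i : Fin (n + 2), (-1 : κ) ^ (i : ℕ) • Finsupp.lmapDomain κ κ (face i)

lemma bd_single {n : ℕ} {X : Type u} [TopologicalSpace X] (σ : C(stdSimplex ℝ (Fin (n + 2)), X)) :
    bd κ n X (Finsupp.single σ 1) =
      ∑ i : Fin (n + 2), (-1 : κ) ^ (i : ℕ) • Finsupp.single (face i σ) 1 := by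
  simp [bd]

lemma simplexEquiv_δ (Y : TopCat.{u}) (n : ℕ) (i) (x : (TopCat.toSSet.obj Y) _⦋n + 1⦌) :
    simplexEquiv Y n ((TopCat.toSSet.obj Y).δ i x) = face i (simplexEquiv Y (n + 1) x) :=
  rfl

lemma gen_d (Y : TopCat.{u}) (n : ℕ) (x : (TopCat.toSSet.obj Y) _⦋n + 1⦌) :
    ((chainCx κ Y).d (n + 1) n).hom (gen κ Y (n + 1) x) =
      ∑ i : Fin (n + 2), (-1 : κ) ^ (i : ℕ) • gen κ Y n ((TopCat.toSSet.obj Y).δ i x) := by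
  have := congrArg (fun g => g.hom (ULift.up 1))
    (SSet.ιChainComplex_d (TopCat.toSSet.obj Y) (R := coeffs.{u} κ) x)
  refine this.trans ?_
  simp only [ModuleCat.hom_sum, LinearMap.sum_apply]
  refine Finset.sum_congr rfl fun i _ => ?_
  rcases Nat.even_or_odd (i : ℕ) with h | h
  · simp only [h.neg_one_pow, one_smul]
    rfl
  · simp only [h.neg_one_pow, neg_one_smul, ModuleCat.hom_neg, LinearMap.neg_apply]
    rfl

lemma gen_map {Y Z : TopCat.{u}} (g : Y ⟶ Z) (n : ℕ) (x : (TopCat.toSSet.obj Y) _⦋n⦌) :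
    ((chainCxMap κ g).f n).hom (gen κ Y n x) = gen κ Z n ((TopCat.toSSet.map g).app _ x) :=
  congrArg (fun g => g.hom (ULift.up 1))
    (SSet.ι_chainComplexMap_f (TopCat.toSSet.obj Y) (TopCat.toSSet.obj Z)
      (R := coeffs.{u} κ) (TopCat.toSSet.map g) x)

lemma toChain_d (Y : TopCat.{u}) (n : ℕ) (c) :
    toChain κ Y n (((chainCx κ Y).d (n + 1) n).hom c) = bd κ n Y (toChain κ Y (n + 1) c) := by
  suffices h : toChain κ Y n ∘ₗ ((chainCx κ Y).d (n + 1) n).hom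
      = bd κ n Y ∘ₗ toChain κ Y (n + 1) from congrArg (fun g => g c) h
  apply chainCx_ext
  intro x
  simp only [LinearMap.comp_apply, gen_d, toChain_gen, bd_single, map_sum, map_smul,
    simplexEquiv_δ]

lemma simplexEquiv_map {Y Z : TopCat.{u}} (g : Y ⟶ Z) (n : ℕ)
    (x : (TopCat.toSSet.obj Y) _⦋n⦌) :
    simplexEquiv Z n ((TopCat.toSSet.map g).app _ x) = g.hom.comp (simplexEquiv Y n x) := rfl

lemma toChain_map {Y Z : TopCat.{u}} (g : Y ⟶ Z) (n : ℕ) (c) :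
    toChain κ Z n (((chainCxMap κ g).f n).hom c)
      = Finsupp.mapDomain (g.hom.comp ·) (toChain κ Y n c) := by
  suffices h : toChain κ Z n ∘ₗ ((chainCxMap κ g).f n).hom
      = Finsupp.lmapDomain κ κ (g.hom.comp ·) ∘ₗ toChain κ Y n from congrArg (fun g => g c) h
  apply chainCx_ext
  intro x
  simp only [LinearMap.comp_apply, gen_map, toChain_gen, simplexEquiv_map]
  simp

end Chains

/-! ### Homology classes of cycles -/

section ModuleCatHomology

variable {κ : Type v} [Field κ] (K : ChainComplex (ModuleCat.{w} κ) ℕ) (r : ℕ)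

/-- The cycles of a complex of modules. -/
def cycleSubmodule : Submodule κ (K.X r) :=
  LinearMap.ker (K.d r ((ComplexShape.down ℕ).next r)).hom

lemma moduleCat_hom_congr {M N : ModuleCat.{w} κ} {g h : M ⟶ N} (e : g = h) (x : M) :
    g.hom x = h.hom x := by rw [e]

/-- A cycle as an element of the cycle object of the complex. -/
def cycleLift : ModuleCat.of κ (cycleSubmodule K r) ⟶ K.cycles r :=
  K.liftCycles (ModuleCat.ofHom (cycleSubmodule K r).subtype) _ rfl (by ext x; exact x.2)

lemma iCycles_cycleLift (z : cycleSubmodule K r) :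
    (K.iCycles r).hom ((cycleLift K r).hom z) = z.1 :=
  moduleCat_hom_congr (K.liftCycles_i (ModuleCat.ofHom (cycleSubmodule K r).subtype) _ rfl
    (by ext x; exact x.2)) z

lemma iCycles_injective : Function.Injective (K.iCycles r).hom :=
  (ModuleCat.mono_iff_injective _).1 inferInstance

/-- The homology class of a cycle. -/
def cycleClass : cycleSubmodule K r →ₗ[κ] K.homology r :=
  (K.homologyπ r).hom ∘ₗ (cycleLift K r).hom

lemma cycleClass_surjective : Function.Surjective (cycleClass K r) := by
  intro h
  obtain ⟨z, rfl⟩ := (ModuleCat.epi_iff_surjective (K.homologyπ r)).1 inferInstance h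
  refine ⟨⟨(K.iCycles r).hom z, moduleCat_hom_congr (K.iCycles_d r _) z⟩, ?_⟩
  refine congrArg (K.homologyπ r).hom (iCycles_injective K r ?_)
  exact iCycles_cycleLift K r _

lemma cycleClass_eq_zero_iff (z : cycleSubmodule K r) :
    cycleClass K r z = 0 ↔ ∃ y, (K.d (r + 1) r).hom y = z.1 := by
  have h1 : (K.homologyι r).hom (cycleClass K r z) = (K.pOpcycles r).hom z.1 :=
    (moduleCat_hom_congr (K.homology_π_ι r) ((cycleLift K r).hom z)).trans
      (congrArg (K.pOpcycles r).hom (iCycles_cycleLift K r z))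
  have hi : Function.Injective (K.homologyι r).hom :=
    (ModuleCat.mono_iff_injective (K.homologyι r)).1 inferInstance
  rw [← map_eq_zero_iff _ hi, h1]
  refine ((K.sc r).moduleCat_pOpcycles_eq_zero_iff z.1).trans ?_
  have hp : (ComplexShape.down ℕ).prev r = r + 1 := ChainComplex.prev _ _
  change (∃ y, (K.d ((ComplexShape.down ℕ).prev r) r).hom y = z.1) ↔ _
  rw [hp]

lemma cycleClass_map {K L : ChainComplex (ModuleCat.{w} κ) ℕ} (φ : K ⟶ L)
    (z : cycleSubmodule K r) (z' : cycleSubmodule L r) (h : (φ.f r).hom z.1 = z'.1) :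
    (HomologicalComplex.homologyMap φ r).hom (cycleClass K r z) = cycleClass L r z' := by
  refine (moduleCat_hom_congr (HomologicalComplex.homologyπ_naturality φ r)
    ((cycleLift K r).hom z)).trans ?_
  refine congrArg (L.homologyπ r).hom (iCycles_injective L r ?_)
  rw [iCycles_cycleLift]
  refine (moduleCat_hom_congr (HomologicalComplex.cyclesMap_i φ r) _).trans ?_
  exact (congrArg (φ.f r).hom (iCycles_cycleLift K r z)).trans h

lemma mem_cycleSubmodule_zero (x : K.X 0) : x ∈ cycleSubmodule K 0 := by
  have : K.d 0 ((ComplexShape.down ℕ).next 0) = 0 :=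
    K.shape _ _ (by simp)
  rw [cycleSubmodule, this]
  exact LinearMap.mem_ker.2 rfl

lemma mem_cycleSubmodule_succ (x : K.X (r + 1)) :
    x ∈ cycleSubmodule K (r + 1) ↔ (K.d (r + 1) r).hom x = 0 := by
  have : (ComplexShape.down ℕ).next (r + 1) = r := by simp
  rw [cycleSubmodule, this, LinearMap.mem_ker]

end ModuleCatHomology

end

end LevelPersistence

open CategoryTheory AlgebraicTopology

namespace LevelPersistence

noncomputable section

/-! ### Functoriality and homotopy invariance -/

section Functoriality

variable (κ : Type v) [Field κ] (r : ℕ)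

/-- The singular homology `H_r(Y; κ)`. -/
abbrev spaceHomology (Y : Type u) [TopologicalSpace Y] : ModuleCat.{max u v} κ :=
  ((singularHomologyFunctor (ModuleCat.{max u v} κ) r).obj (coeffs.{u} κ)).obj (TopCat.of Y)

variable {X Y Z : Type u} [TopologicalSpace X] [TopologicalSpace Y] [TopologicalSpace Z]

/-- The map induced in homology by a continuous map. -/
def spaceMap (g : C(Y, Z)) : spaceHomology κ r Y →ₗ[κ] spaceHomology κ r Z :=
  (((singularHomologyFunctor (ModuleCat.{max u v} κ) r).obj (coeffs.{u} κ)).map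
    (TopCat.ofHom g)).hom

lemma spaceMap_id (x) : spaceMap κ r (ContinuousMap.id Y) x = x :=
  moduleCat_hom_congr (((singularHomologyFunctor (ModuleCat.{max u v} κ) r).obj
    (coeffs.{u} κ)).map_id (TopCat.of Y)) x

lemma spaceMap_comp (g : C(Y, Z)) (h : C(X, Y)) (x) :
    spaceMap κ r (g.comp h) x = spaceMap κ r g (spaceMap κ r h x) :=
  moduleCat_hom_congr (((singularHomologyFunctor (ModuleCat.{max u v} κ) r).obj
    (coeffs.{u} κ)).map_comp (TopCat.ofHom h) (TopCat.ofHom g)) x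

lemma spaceMap_congr_of_homotopic {g h : C(Y, Z)} (H : g.Homotopic h) :
    spaceMap κ r g = spaceMap κ r h := by
  obtain ⟨H⟩ := H
  have := TopCat.Homotopy.congr_homologyMap_singularChainComplexFunctor
    (f := TopCat.ofHom g) (g := TopCat.ofHom h) H (coeffs.{u} κ) r
  exact congrArg ModuleCat.Hom.hom this

/-- The homology of a subspace. -/
abbrev setHomology (A : Set X) : ModuleCat.{max u v} κ := spaceHomology κ r A

/-- The map induced by an inclusion of subspaces. -/
def setMap {A B : Set X} (h : A ⊆ B) : setHomology κ r A →ₗ[κ] setHomology κ r B :=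
  spaceMap κ r ⟨Set.inclusion h, by fun_prop⟩

lemma setMap_refl {A : Set X} (x) : setMap κ r (subset_refl A) x = x :=
  spaceMap_id κ r x

lemma setMap_setMap {A B D : Set X} (h : A ⊆ B) (h' : B ⊆ D) (x) :
    setMap κ r h' (setMap κ r h x) = setMap κ r (h.trans h') x :=
  (spaceMap_comp κ r _ _ x).symm

end Functoriality

/-! ### Chains in a subspace -/

section SubspaceChains

variable (κ : Type v) [Field κ] {X : Type u} [TopologicalSpace X]

/-- The singular chains of `X` whose simplices lie in `A`. -/
def chainsIn (n : ℕ) (A : Set X) : Submodule κ (SingularChain κ n X) :=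
  Finsupp.supported κ κ {σ | ∀ t, σ t ∈ A}

lemma single_mem_chainsIn {n : ℕ} {A : Set X} {σ : C(stdSimplex ℝ (Fin (n + 1)), X)}
    (h : ∀ t, σ t ∈ A) (a : κ) : Finsupp.single σ a ∈ chainsIn κ n A :=
  Finsupp.single_mem_supported κ a h

lemma chainsIn_mono {n : ℕ} {A B : Set X} (h : A ⊆ B) : chainsIn κ n A ≤ chainsIn κ n B :=
  Finsupp.supported_mono fun _ hσ t => h (hσ t)

lemma chainsIn_inter {n : ℕ} {A B : Set X} :
    chainsIn κ n (A ∩ B) = chainsIn κ n A ⊓ chainsIn κ n B := by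
  rw [chainsIn, chainsIn, chainsIn, ← Finsupp.supported_inter]
  congr 1
  ext σ
  exact forall_and

lemma chainsIn_induction {n : ℕ} {A : Set X} {N : Submodule κ (SingularChain κ n X)}
    (h : ∀ σ : C(stdSimplex ℝ (Fin (n + 1)), X), (∀ t, σ t ∈ A) → Finsupp.single σ 1 ∈ N) :
    chainsIn κ n A ≤ N := by
  rw [chainsIn, Finsupp.supported_eq_span_single, Submodule.span_le]
  rintro _ ⟨σ, hσ, rfl⟩
  exact h σ hσ

/-- Push-forward of chains along a continuous map. -/
def pushChain {Y : Type w} [TopologicalSpace Y] (n : ℕ) (g : C(Y, X)) :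
    SingularChain κ n Y →ₗ[κ] SingularChain κ n X :=
  Finsupp.lmapDomain κ κ (g.comp ·)

@[simp]
lemma pushChain_single {Y : Type w} [TopologicalSpace Y] {n : ℕ} (g : C(Y, X)) (σ) (a : κ) :
    pushChain κ n g (Finsupp.single σ a) = Finsupp.single (g.comp σ) a := by
  simp [pushChain]

lemma pushChain_pushChain {Y : Type w} {Z : Type*} [TopologicalSpace Y] [TopologicalSpace Z] {n : ℕ}
    (g : C(Y, X)) (h : C(Z, Y)) (c) :
    pushChain κ n g (pushChain κ n h c) = pushChain κ n (g.comp h) c := by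
  suffices H : pushChain κ n g ∘ₗ pushChain κ n h = pushChain κ n (g.comp h) from
    congrArg (fun g => g c) H
  ext σ : 2
  simp [ContinuousMap.comp_assoc]

lemma bd_pushChain {Y : Type w} [TopologicalSpace Y] {n : ℕ} (g : C(Y, X)) (c) :
    bd κ n X (pushChain κ (n + 1) g c) = pushChain κ n g (bd κ n Y c) := by
  suffices H : bd κ n X ∘ₗ pushChain κ (n + 1) g = pushChain κ n g ∘ₗ bd κ n Y from
    congrArg (fun g => g c) H
  ext σ : 2
  simp only [LinearMap.comp_apply, Finsupp.lsingle_apply, pushChain_single, bd_single, map_sum,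
    map_smul]
  rfl

lemma bd_bd {n : ℕ} (c : SingularChain κ (n + 2) X) : bd κ n X (bd κ (n + 1) X c) = 0 := by
  have h := moduleCat_hom_congr ((chainCx κ (TopCat.of X)).d_comp_d (n + 2) (n + 1) n)
    (ofChain κ (TopCat.of X) (n + 2) c)
  have h2 := congrArg (toChain κ (TopCat.of X) n) h
  rw [ModuleCat.hom_comp, LinearMap.comp_apply, toChain_d, toChain_d, toChain_ofChain] at h2
  rw [h2]
  exact map_zero _

lemma bd_mem_chainsIn {n : ℕ} {A : Set X} {c : SingularChain κ (n + 1) X}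
    (hc : c ∈ chainsIn κ (n + 1) A) : bd κ n X c ∈ chainsIn κ n A := by
  suffices chainsIn κ (n + 1) A ≤ (chainsIn κ n A).comap (bd κ n X) from this hc
  apply chainsIn_induction
  intro σ hσ
  rw [Submodule.mem_comap, bd_single]
  exact Submodule.sum_mem _ fun i _ => Submodule.smul_mem _ _
    (single_mem_chainsIn κ (σ := face i σ) (fun t => hσ _) 1)

/-- The inclusion of a subspace. -/
abbrev subtypeVal (A : Set X) : C(A, X) := ⟨Subtype.val, continuous_subtype_val⟩

lemma pushChain_subtypeVal_injective {n : ℕ} (A : Set X) :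
    Function.Injective (pushChain κ n (subtypeVal A)) := by
  apply Finsupp.mapDomain_injective
  intro σ τ h
  ext t
  exact congrArg (fun g : C(_, X) => g t) h

lemma range_pushChain_subtypeVal {n : ℕ} (A : Set X) :
    LinearMap.range (pushChain κ n (subtypeVal A)) = chainsIn κ n A := by
  apply le_antisymm
  · rintro _ ⟨c, rfl⟩
    induction c using Finsupp.induction_linear with
    | zero => rw [map_zero]; exact zero_mem _
    | add c d hc hd => rw [map_add]; exact add_mem hc hd
    | single σ a =>
      rw [pushChain_single]
      exact single_mem_chainsIn κ (fun t => (σ t).2) a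
  · apply chainsIn_induction
    intro σ hσ
    refine ⟨Finsupp.single ⟨fun t => ⟨σ t, hσ t⟩, by fun_prop⟩ 1, ?_⟩
    rw [pushChain_single]
    rfl

/-- The cycles among the singular chains; in degree `0` every chain is one. -/
def cyclesOf (X : Type u) [TopologicalSpace X] : (r : ℕ) → Submodule κ (SingularChain κ r X)
  | 0 => ⊤
  | r + 1 => LinearMap.ker (bd κ r X)

/-- The singular cycles of `X` lying in `A`. -/
def cyclesIn (r : ℕ) (A : Set X) : Submodule κ (SingularChain κ r X) :=
  chainsIn κ r A ⊓ cyclesOf κ X r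

lemma bd_mem_cyclesOf {r : ℕ} (c : SingularChain κ (r + 1) X) : bd κ r X c ∈ cyclesOf κ X r := by
  cases r with
  | zero => exact Submodule.mem_top
  | succ r => exact bd_bd κ c

lemma bd_mem_cyclesIn {r : ℕ} {A : Set X} {c : SingularChain κ (r + 1) X}
    (hc : c ∈ chainsIn κ (r + 1) A) : bd κ r X c ∈ cyclesIn κ r A :=
  ⟨bd_mem_chainsIn κ hc, bd_mem_cyclesOf κ c⟩

/-- The chains lying in `A` as chains of the subspace `A`. -/
def chainsInEquiv (n : ℕ) (A : Set X) : SingularChain κ n A ≃ₗ[κ] chainsIn κ n A :=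
  (LinearEquiv.ofInjective _ (pushChain_subtypeVal_injective κ A)).trans
    (LinearEquiv.ofEq _ _ (range_pushChain_subtypeVal κ A))

lemma chainsInEquiv_coe (n : ℕ) (A : Set X) (c) :
    (chainsInEquiv κ n A c : SingularChain κ n X) = pushChain κ n (subtypeVal A) c := rfl

lemma pushChain_chainsInEquiv_symm (n : ℕ) (A : Set X) (c) :
    pushChain κ n (subtypeVal A) ((chainsInEquiv κ n A).symm c) = c := by
  rw [← chainsInEquiv_coe, LinearEquiv.apply_symm_apply]

/-- A chain lying in `A` as an element of Mathlib's complex of the subspace `A`. -/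
def chainLift (n : ℕ) (A : Set X) : chainsIn κ n A →ₗ[κ] (chainCx κ (TopCat.of A)).X n :=
  ofChain κ (TopCat.of A) n ∘ₗ (chainsInEquiv κ n A).symm.toLinearMap

lemma push_toChain_chainLift (n : ℕ) (A : Set X) (c) :
    pushChain κ n (subtypeVal A) (toChain κ (TopCat.of A) n (chainLift κ n A c)) = c := by
  simp only [chainLift, LinearMap.comp_apply]
  rw [toChain_ofChain]
  exact pushChain_chainsInEquiv_symm κ n A c

lemma push_toChain_injective (n : ℕ) (A : Set X) :
    Function.Injective fun x => pushChain κ n (subtypeVal A) (toChain κ (TopCat.of A) n x) :=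
  (pushChain_subtypeVal_injective κ A).comp
    (Function.LeftInverse.injective (ofChain_toChain κ (TopCat.of A) n))

lemma push_toChain_d (n : ℕ) (A : Set X) (x) :
    pushChain κ n (subtypeVal A)
      (toChain κ (TopCat.of A) n (((chainCx κ (TopCat.of A)).d (n + 1) n).hom x)) =
    bd κ n X (pushChain κ (n + 1) (subtypeVal A) (toChain κ (TopCat.of A) (n + 1) x)) := by
  rw [toChain_d, bd_pushChain]

lemma mem_cycleSubmodule_iff (r : ℕ) (A : Set X) (x : (chainCx κ (TopCat.of A)).X r) :
    x ∈ cycleSubmodule (chainCx κ (TopCat.of A)) r ↔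
      pushChain κ r (subtypeVal A) (toChain κ (TopCat.of A) r x) ∈ cyclesOf κ X r := by
  cases r with
  | zero => exact ⟨fun _ => Submodule.mem_top, fun _ => mem_cycleSubmodule_zero _ _⟩
  | succ r =>
    rw [mem_cycleSubmodule_succ]
    refine Iff.trans ?_ LinearMap.mem_ker.symm
    rw [← push_toChain_d]
    constructor
    · intro h
      rw [h]
      simp
    · intro h
      apply push_toChain_injective κ r A
      simpa using h

/-- The class in `H_r(A)` of a cycle lying in `A`. -/
def classIn (r : ℕ) (A : Set X) : cyclesIn κ r A →ₗ[κ] setHomology κ r A :=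
  cycleClass (chainCx κ (TopCat.of A)) r ∘ₗ
    (chainLift κ r A ∘ₗ Submodule.inclusion inf_le_left).codRestrict
      (cycleSubmodule (chainCx κ (TopCat.of A)) r) (fun z => by
        rw [mem_cycleSubmodule_iff, LinearMap.comp_apply, push_toChain_chainLift]
        exact z.2.2)

lemma classIn_surjective (r : ℕ) (A : Set X) : Function.Surjective (classIn κ r A) := by
  intro h
  obtain ⟨x, rfl⟩ := cycleClass_surjective (chainCx κ (TopCat.of A)) r h
  have hx := (mem_cycleSubmodule_iff κ r A x.1).1 x.2
  refine ⟨⟨pushChain κ r (subtypeVal A) (toChain κ (TopCat.of A) r x.1), ?_, hx⟩, ?_⟩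
  · rw [SetLike.mem_coe, ← range_pushChain_subtypeVal]
    exact ⟨_, rfl⟩
  · refine congrArg (cycleClass (chainCx κ (TopCat.of A)) r) (Subtype.ext ?_)
    apply push_toChain_injective κ r A
    exact push_toChain_chainLift κ r A _

lemma classIn_eq_zero_iff {r : ℕ} {A : Set X} (z : cyclesIn κ r A) :
    classIn κ r A z = 0 ↔ ∃ y ∈ chainsIn κ (r + 1) A, bd κ r X y = z := by
  refine (cycleClass_eq_zero_iff (chainCx κ (TopCat.of A)) r _).trans ?_
  constructor
  · rintro ⟨y, hy⟩
    refine ⟨pushChain κ (r + 1) (subtypeVal A) (toChain κ (TopCat.of A) (r + 1) y), ?_, ?_⟩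
    · rw [← range_pushChain_subtypeVal]
      exact ⟨_, rfl⟩
    · rw [← push_toChain_d, hy]
      exact push_toChain_chainLift κ r A _
  · rintro ⟨y, hyA, hy⟩
    refine ⟨chainLift κ (r + 1) A ⟨y, hyA⟩, ?_⟩
    apply push_toChain_injective κ r A
    refine (push_toChain_d κ r A _).trans ?_
    rw [push_toChain_chainLift]
    exact hy.trans (push_toChain_chainLift κ r A ⟨z.1, z.2.1⟩).symm

lemma setMap_classIn {r : ℕ} {A B : Set X} (h : A ⊆ B) (z : cyclesIn κ r A)
    (z' : cyclesIn κ r B) (hz : (z : SingularChain κ r X) = z') :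
    setMap κ r h (classIn κ r A z) = classIn κ r B z' := by
  refine cycleClass_map r (chainCxMap κ (TopCat.ofHom ⟨Set.inclusion h, by fun_prop⟩)) _ _ ?_
  apply push_toChain_injective κ r B
  refine Eq.trans ?_ ((hz : _).trans (push_toChain_chainLift κ r B ⟨z'.1, z'.2.1⟩).symm)
  refine Eq.trans (congrArg (pushChain κ r (subtypeVal B)) (toChain_map κ (TopCat.ofHom
    (⟨Set.inclusion h, by fun_prop⟩ : C(A, B))) r (chainLift κ r A ⟨z.1, z.2.1⟩))) ?_
  refine Eq.trans (pushChain_pushChain κ (subtypeVal B)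
    (⟨Set.inclusion h, by fun_prop⟩ : C(A, B)) _) ?_
  exact push_toChain_chainLift κ r A ⟨z.1, z.2.1⟩

end SubspaceChains

/-! ### Barycentric subdivision of formal simplices -/

section TupleChains

variable (κ : Type v) [Field κ]

/-- Formal combinations of `k`-tuples of points, an augmented version of affine chains: a `k`-tuple
stands for the affine `(k - 1)`-simplex with these vertices. -/
abbrev TupleChain (k : ℕ) (P : Type w) : Type (max w v) := (Fin k → P) →₀ κ

variable {P : Type w} {Q : Type*}

/-- The augmented boundary operator on tuples. -/
def tupleBd (k : ℕ) : TupleChain κ (k + 1) P →ₗ[κ] TupleChain κ k P :=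
  ∑ i : Fin (k + 1), (-1 : κ) ^ (i : ℕ) • Finsupp.lmapDomain κ κ (fun v j => v (i.succAbove j))

lemma tupleBd_single {k : ℕ} (v : Fin (k + 1) → P) :
    tupleBd κ k (Finsupp.single v 1) =
      ∑ i : Fin (k + 1), (-1 : κ) ^ (i : ℕ) • Finsupp.single (fun j => v (i.succAbove j)) 1 := by
  simp [tupleBd]

/-- Joining a tuple to a point. -/
def cone (b : P) (k : ℕ) : TupleChain κ k P →ₗ[κ] TupleChain κ (k + 1) P :=
  Finsupp.lmapDomain κ κ (fun v => (Fin.cons b v : Fin (k + 1) → P))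

@[simp]
lemma cone_single {b : P} {k : ℕ} (v : Fin k → P) (a : κ) :
    cone κ b k (Finsupp.single v a) = Finsupp.single (Fin.cons b v) a := by
  simp [cone]

lemma tupleBd_cone_zero (b : P) (c : TupleChain κ 0 P) : tupleBd κ 0 (cone κ b 0 c) = c := by
  suffices h : tupleBd κ 0 ∘ₗ cone κ b 0 = LinearMap.id from congrArg (fun g => g c) h
  ext v : 2
  simp only [LinearMap.comp_apply, Finsupp.lsingle_apply, cone_single, tupleBd_single,
    LinearMap.id_apply]
  rw [Fin.sum_univ_succ, Finset.univ_eq_empty, Finset.sum_empty, add_zero, Fin.val_zero, pow_zero,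
    one_smul]
  congr 1

lemma tupleBd_cone (b : P) {k : ℕ} (c : TupleChain κ (k + 1) P) :
    tupleBd κ (k + 1) (cone κ b (k + 1) c) = c - cone κ b k (tupleBd κ k c) := by
  suffices h : tupleBd κ (k + 1) ∘ₗ cone κ b (k + 1) = LinearMap.id - cone κ b k ∘ₗ tupleBd κ k from
    congrArg (fun g => g c) h
  ext v : 2
  simp only [LinearMap.comp_apply, Finsupp.lsingle_apply, cone_single, tupleBd_single,
    LinearMap.id_apply, LinearMap.sub_apply, map_sum, map_smul]
  rw [Fin.sum_univ_succ, sub_eq_add_neg, ← Finset.sum_neg_distrib]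
  congr 1
  · simp
  · refine Finset.sum_congr rfl fun i _ => ?_
    rw [Fin.val_succ, pow_succ, mul_neg_one, neg_smul]
    congr 3
    ext j
    cases j using Fin.cases with
    | zero => simp
    | succ j => simp

lemma tupleBd_tupleBd {k : ℕ} (c : TupleChain κ (k + 2) P) :
    tupleBd κ k (tupleBd κ (k + 1) c) = 0 := by
  induction k with
  | zero =>
    suffices h : tupleBd κ 0 ∘ₗ tupleBd κ 1 = (0 : TupleChain κ 2 P →ₗ[κ] _) from
      congrArg (fun g => g c) h
    ext v : 2
    simp only [LinearMap.comp_apply, Finsupp.lsingle_apply]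
    rw [← Fin.cons_self_tail v, ← cone_single, tupleBd_cone, map_sub, tupleBd_cone_zero, sub_self]
    rfl
  | succ k ih =>
    suffices h : tupleBd κ (k + 1) ∘ₗ tupleBd κ (k + 2) = (0 : TupleChain κ (k + 3) P →ₗ[κ] _) from
      congrArg (fun g => g c) h
    ext v : 2
    simp only [LinearMap.comp_apply, Finsupp.lsingle_apply]
    rw [← Fin.cons_self_tail v, ← cone_single, tupleBd_cone, map_sub, tupleBd_cone, ih, map_zero,
      sub_zero, sub_self]
    rfl

variable (β : ∀ k : ℕ, (Fin (k + 1) → P) → P)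

/-- Subdivision of tuples with respect to a choice of "barycentres" `β`: the subdivision of a tuple
is the cone, from its barycentre, over the subdivision of its boundary. -/
def tupleSd : (k : ℕ) → TupleChain κ k P →ₗ[κ] TupleChain κ k P
  | 0 => LinearMap.id
  | k + 1 => Finsupp.linearCombination κ
      (fun v => cone κ (β k v) k (tupleSd k (tupleBd κ k (Finsupp.single v 1))))

/-- The chain homotopy between the identity and the subdivision. -/
def tupleHtpy : (k : ℕ) → TupleChain κ k P →ₗ[κ] TupleChain κ (k + 1) P
  | 0 => 0
  | k + 1 => Finsupp.linearCombination κ (fun v => cone κ (β k v) (k + 1)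
      (Finsupp.single v 1 - tupleHtpy k (tupleBd κ k (Finsupp.single v 1))))

lemma tupleSd_single {k : ℕ} (v : Fin (k + 1) → P) :
    tupleSd κ β (k + 1) (Finsupp.single v 1) =
      cone κ (β k v) k (tupleSd κ β k (tupleBd κ k (Finsupp.single v 1))) := by
  simp [tupleSd]

lemma tupleHtpy_single {k : ℕ} (v : Fin (k + 1) → P) :
    tupleHtpy κ β (k + 1) (Finsupp.single v 1) = cone κ (β k v) (k + 1)
      (Finsupp.single v 1 - tupleHtpy κ β k (tupleBd κ k (Finsupp.single v 1))) := by
  simp [tupleHtpy]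

lemma tupleBd_tupleSd {k : ℕ} (c : TupleChain κ (k + 1) P) :
    tupleBd κ k (tupleSd κ β (k + 1) c) = tupleSd κ β k (tupleBd κ k c) := by
  induction k with
  | zero =>
    suffices h : tupleBd κ 0 ∘ₗ tupleSd κ β 1 = tupleSd κ β 0 ∘ₗ tupleBd κ 0 from
      congrArg (fun g => g c) h
    ext v : 2
    simp only [LinearMap.comp_apply, Finsupp.lsingle_apply]
    rw [tupleSd_single, tupleBd_cone_zero]
  | succ k ih =>
    suffices h : tupleBd κ (k + 1) ∘ₗ tupleSd κ β (k + 2) =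
        tupleSd κ β (k + 1) ∘ₗ tupleBd κ (k + 1) from congrArg (fun g => g c) h
    ext v : 2
    simp only [LinearMap.comp_apply, Finsupp.lsingle_apply]
    rw [tupleSd_single, tupleBd_cone, ih, tupleBd_tupleBd, map_zero, map_zero, sub_zero]

lemma tupleBd_tupleHtpy {k : ℕ} (c : TupleChain κ (k + 1) P) :
    tupleBd κ (k + 1) (tupleHtpy κ β (k + 1) c) =
      c - tupleSd κ β (k + 1) c - tupleHtpy κ β k (tupleBd κ k c) := by
  have aux : ∀ k, (∀ c : TupleChain κ k P, ∀ c', c = tupleBd κ k c' →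
      tupleBd κ k (tupleHtpy κ β k c) = c - tupleSd κ β k c) → ∀ c : TupleChain κ (k + 1) P,
      tupleBd κ (k + 1) (tupleHtpy κ β (k + 1) c) =
      c - tupleSd κ β (k + 1) c - tupleHtpy κ β k (tupleBd κ k c) := by
    intro k hk c
    suffices h : tupleBd κ (k + 1) ∘ₗ tupleHtpy κ β (k + 1) =
      LinearMap.id - tupleSd κ β (k + 1) - tupleHtpy κ β k ∘ₗ tupleBd κ k from
      congrArg (fun g => g c) h
    ext v : 2
    simp only [LinearMap.comp_apply, Finsupp.lsingle_apply, LinearMap.sub_apply,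
      LinearMap.id_apply]
    rw [tupleHtpy_single, tupleBd_cone, map_sub, hk _ _ rfl, tupleSd_single]
    simp only [sub_sub_cancel]
    abel
  induction k with
  | zero =>
    refine aux 0 (fun c c' _ => ?_) c
    simp [tupleHtpy, tupleSd]
  | succ k ih =>
    refine aux (k + 1) (fun c c' hc => ?_) c
    rw [ih, hc, tupleBd_tupleBd, map_zero, sub_zero]

/-- Push-forward of tuples. -/
def pushTuple (φ : P → Q) (k : ℕ) : TupleChain κ k P →ₗ[κ] TupleChain κ k Q :=
  Finsupp.lmapDomain κ κ (φ ∘ ·)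

@[simp]
lemma pushTuple_single (φ : P → Q) {k : ℕ} (v : Fin k → P) (a : κ) :
    pushTuple κ φ k (Finsupp.single v a) = Finsupp.single (φ ∘ v) a := by
  simp [pushTuple]

lemma pushTuple_cone (φ : P → Q) {k : ℕ} (b : P) (c : TupleChain κ k P) :
    pushTuple κ φ (k + 1) (cone κ b k c) = cone κ (φ b) k (pushTuple κ φ k c) := by
  suffices h : pushTuple κ φ (k + 1) ∘ₗ cone κ b k = cone κ (φ b) k ∘ₗ pushTuple κ φ k from
    congrArg (fun g => g c) h
  ext v : 2
  simp only [LinearMap.comp_apply, Finsupp.lsingle_apply, cone_single, pushTuple_single]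
  congr 1
  exact Fin.comp_cons φ b v

lemma pushTuple_tupleBd (φ : P → Q) {k : ℕ} (c : TupleChain κ (k + 1) P) :
    pushTuple κ φ k (tupleBd κ k c) = tupleBd κ k (pushTuple κ φ (k + 1) c) := by
  suffices h : pushTuple κ φ k ∘ₗ tupleBd κ k = tupleBd κ k ∘ₗ pushTuple κ φ (k + 1) from
    congrArg (fun g => g c) h
  ext v : 2
  simp only [LinearMap.comp_apply, Finsupp.lsingle_apply, pushTuple_single, tupleBd_single,
    map_sum, map_smul]
  rfl

variable (β' : ∀ k : ℕ, (Fin (k + 1) → Q) → Q)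

lemma pushTuple_tupleSd (φ : P → Q) (hφ : ∀ k v, φ (β k v) = β' k (φ ∘ v)) {k : ℕ}
    (c : TupleChain κ k P) :
    pushTuple κ φ k (tupleSd κ β k c) = tupleSd κ β' k (pushTuple κ φ k c) := by
  induction k with
  | zero => rfl
  | succ k ih =>
    suffices h : pushTuple κ φ (k + 1) ∘ₗ tupleSd κ β (k + 1) =
        tupleSd κ β' (k + 1) ∘ₗ pushTuple κ φ (k + 1) from congrArg (fun g => g c) h
    ext v : 2
    simp only [LinearMap.comp_apply, Finsupp.lsingle_apply, pushTuple_single]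
    rw [tupleSd_single, tupleSd_single, pushTuple_cone, ih, pushTuple_tupleBd, pushTuple_single, hφ]

lemma pushTuple_tupleHtpy (φ : P → Q) (hφ : ∀ k v, φ (β k v) = β' k (φ ∘ v)) {k : ℕ}
    (c : TupleChain κ k P) :
    pushTuple κ φ (k + 1) (tupleHtpy κ β k c) = tupleHtpy κ β' k (pushTuple κ φ k c) := by
  induction k with
  | zero => simp [tupleHtpy]
  | succ k ih =>
    suffices h : pushTuple κ φ (k + 2) ∘ₗ tupleHtpy κ β (k + 1) =
        tupleHtpy κ β' (k + 1) ∘ₗ pushTuple κ φ (k + 1) from congrArg (fun g => g c) h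
    ext v : 2
    simp only [LinearMap.comp_apply, Finsupp.lsingle_apply, pushTuple_single]
    rw [tupleHtpy_single, tupleHtpy_single, pushTuple_cone, map_sub, ih, pushTuple_tupleBd,
      pushTuple_single, hφ]

end TupleChains

/-! ### Mesh of the iterated subdivision -/

section Mesh

variable (κ : Type v) [Field κ] {P : Type w} [PseudoMetricSpace P]
  (β : ∀ k : ℕ, (Fin (k + 1) → P) → P)

lemma supported_induction {ι : Type*} {M : Type*} [AddCommGroup M] [Module κ M] {s : Set ι}
    {N : Submodule κ M} (g : (ι →₀ κ) →ₗ[κ] M) (h : ∀ i ∈ s, g (Finsupp.single i 1) ∈ N)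
    {c : ι →₀ κ} (hc : c ∈ Finsupp.supported κ κ s) : g c ∈ N := by
  suffices Finsupp.supported κ κ s ≤ N.comap g from this hc
  rw [Finsupp.supported_eq_span_single, Submodule.span_le]
  rintro _ ⟨i, hi, rfl⟩
  exact h i hi

/-- The tuples in the subdivision of a tuple `v` with at most `n + 1` entries stay within every
closed ball that contains `v`, and their diameter is at most `n / (n + 1)` times that of `v`. -/
lemma tupleSd_single_mem_supported
    (hβ : ∀ k v y R, (∀ i, dist y (v i) ≤ R) → dist y (β k v) ≤ R)
    (hβ' : ∀ k v d, (∀ i j, dist (v i) (v j) ≤ d) → ∀ i, dist (β k v) (v i) ≤ k / (k + 1) * d)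
    {n k : ℕ} (hk : k ≤ n + 1) (v : Fin k → P) :
    tupleSd κ β k (Finsupp.single v 1) ∈ Finsupp.supported κ κ
      {w : Fin k → P | (∀ y R, (∀ i, dist y (v i) ≤ R) → ∀ j, dist y (w j) ≤ R) ∧
        ∀ d, (∀ i j, dist (v i) (v j) ≤ d) → ∀ i j, dist (w i) (w j) ≤ (n / (n + 1) : ℝ) * d} := by
  induction k with
  | zero =>
    apply Finsupp.single_mem_supported
    exact ⟨fun y R _ j => j.elim0, fun d _ i => i.elim0⟩
  | succ k ih =>
    rw [tupleSd_single]
    have hq : (k / (k + 1) : ℝ) ≤ n / (n + 1) := by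
      have h1 : (k : ℝ) ≤ n := by exact_mod_cast Nat.le_of_succ_le_succ hk
      rw [div_le_div_iff₀ (by positivity) (by positivity)]
      linarith
    have hface : ∀ i : Fin (k + 1), tupleSd κ β k (Finsupp.single (fun j => v (i.succAbove j)) 1) ∈
        Finsupp.supported κ κ {w : Fin k → P |
          (∀ y R, (∀ i, dist y (v i) ≤ R) → ∀ j, dist y (w j) ≤ R) ∧
          ∀ d, (∀ i j, dist (v i) (v j) ≤ d) →
            ∀ i j, dist (w i) (w j) ≤ (n / (n + 1) : ℝ) * d} := by
      intro i
      refine Finsupp.supported_mono ?_ (ih (by omega) _)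
      rintro w ⟨h1, h2⟩
      exact ⟨fun y R h => h1 y R fun j => h _, fun d h => h2 d fun i j => h _ _⟩
    have hbd : tupleSd κ β k (tupleBd κ k (Finsupp.single v 1)) ∈
        Finsupp.supported κ κ {w : Fin k → P |
          (∀ y R, (∀ i, dist y (v i) ≤ R) → ∀ j, dist y (w j) ≤ R) ∧
          ∀ d, (∀ i j, dist (v i) (v j) ≤ d) →
            ∀ i j, dist (w i) (w j) ≤ (n / (n + 1) : ℝ) * d} := by
      rw [tupleBd_single, map_sum]
      refine Submodule.sum_mem _ fun i _ => ?_
      rw [map_smul]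
      exact Submodule.smul_mem _ _ (hface i)
    refine supported_induction κ (cone κ (β k v) k) ?_ hbd
    rintro w ⟨h1, h2⟩
    rw [cone_single]
    apply Finsupp.single_mem_supported
    refine ⟨fun y R h j => ?_, fun d hd i j => ?_⟩
    · cases j using Fin.cases with
      | zero => exact hβ k v y R h
      | succ j => exact h1 y R h j
    · have hd0 : 0 ≤ d := dist_nonneg.trans (hd 0 0)
      have hb : ∀ j, dist (β k v) (w j) ≤ (n / (n + 1) : ℝ) * d := fun j =>
        (h1 _ _ (hβ' k v d hd) j).trans (mul_le_mul_of_nonneg_right hq hd0)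
      cases i using Fin.cases with
      | zero =>
        cases j using Fin.cases with
        | zero => simp only [Fin.cons_zero, dist_self]; positivity
        | succ j => exact hb j
      | succ i =>
        cases j using Fin.cases with
        | zero => rw [dist_comm]; exact hb i
        | succ j => exact h2 d hd i j

/-- The mesh of the iterated subdivisions tends to `0` geometrically. -/
lemma tupleSd_iterate_mem_supported
    (hβ : ∀ k v y R, (∀ i, dist y (v i) ≤ R) → dist y (β k v) ≤ R)
    (hβ' : ∀ k v d, (∀ i j, dist (v i) (v j) ≤ d) → ∀ i, dist (β k v) (v i) ≤ k / (k + 1) * d)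
    {n : ℕ} (v : Fin (n + 1) → P) {d : ℝ} (hd : ∀ i j, dist (v i) (v j) ≤ d) (m : ℕ) :
    (tupleSd κ β (n + 1))^[m] (Finsupp.single v 1) ∈ Finsupp.supported κ κ
      {w : Fin (n + 1) → P | ∀ i j, dist (w i) (w j) ≤ (n / (n + 1) : ℝ) ^ m * d} := by
  induction m with
  | zero =>
    apply Finsupp.single_mem_supported
    simpa using hd
  | succ m ih =>
    rw [Function.iterate_succ_apply']
    refine supported_induction κ _ ?_ ih
    intro w hw
    refine Finsupp.supported_mono ?_ (tupleSd_single_mem_supported κ β hβ hβ' le_rfl w)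
    rintro w' ⟨-, h⟩
    intro i j
    rw [pow_succ', mul_assoc]
    exact h _ hw i j

end Mesh

/-! ### Affine simplices -/

section Affine

variable {k l m : ℕ}

/-- The affine map from a standard simplex with prescribed values at the vertices. -/
def affineSimplex (v : Fin (k + 1) → stdSimplex ℝ (Fin (m + 1))) :
    C(stdSimplex ℝ (Fin (k + 1)), stdSimplex ℝ (Fin (m + 1))) where
  toFun t := ⟨∑ i, t i • (v i).1, (convex_stdSimplex ℝ _).sum_mem (fun i _ => t.2.1 i) t.2.2
    fun i _ => (v i).2⟩
  continuous_toFun := by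
    refine Continuous.subtype_mk (continuous_finsetSum _ fun i _ => ?_) _
    exact ((continuous_apply i).comp continuous_subtype_val).smul continuous_const

lemma affineSimplex_coe (v : Fin (k + 1) → stdSimplex ℝ (Fin (m + 1))) (t) :
    (affineSimplex v t).1 = ∑ i, t i • (v i).1 := rfl

lemma affineSimplex_apply (v : Fin (k + 1) → stdSimplex ℝ (Fin (m + 1))) (t) (j) :
    affineSimplex v t j = ∑ i, t i * v i j := by
  change (∑ i, t i • (v i).1) j = _
  rw [Finset.sum_apply]
  rfl

lemma affineSimplex_comp (v : Fin (k + 1) → stdSimplex ℝ (Fin (m + 1)))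
    (w : Fin (l + 1) → stdSimplex ℝ (Fin (k + 1))) :
    (affineSimplex v).comp (affineSimplex w) = affineSimplex (affineSimplex v ∘ w) := by
  ext t : 1
  apply stdSimplex.ext
  ext j
  simp only [ContinuousMap.comp_apply, affineSimplex_apply, Function.comp_apply, Finset.sum_mul,
    Finset.mul_sum]
  rw [Finset.sum_comm]
  exact Finset.sum_congr rfl fun i _ => Finset.sum_congr rfl fun i' _ => mul_assoc _ _ _

lemma affineSimplex_vertex (v : Fin (k + 1) → stdSimplex ℝ (Fin (m + 1))) (i) :
    affineSimplex v (stdSimplex.vertex i) = v i := by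
  apply stdSimplex.ext
  ext j
  simp [affineSimplex_apply, Pi.single_apply]

lemma affineSimplex_vertex_eq_id :
    affineSimplex (stdSimplex.vertex : Fin (k + 1) → stdSimplex ℝ (Fin (k + 1))) =
      ContinuousMap.id _ := by
  ext t : 1
  apply stdSimplex.ext
  ext j
  simp [affineSimplex_apply, Pi.single_apply]

lemma face_affineSimplex (v : Fin (k + 2) → stdSimplex ℝ (Fin (m + 1))) (i) :
    face i (affineSimplex v) = affineSimplex fun j => v (i.succAbove j) := by
  ext t : 1
  apply stdSimplex.ext
  ext j
  change affineSimplex v (stdSimplex.map i.succAbove t) j = _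
  simp only [affineSimplex_apply, stdSimplex.map_coe, FunOnFinite.linearMap_apply_apply,
    Finset.sum_mul]
  rw [← Finset.sum_fiberwise Finset.univ i.succAbove]
  refine Finset.sum_congr rfl fun a _ => Finset.sum_congr rfl fun b hb => ?_
  rw [(Finset.mem_filter.1 hb).2]

/-- The barycentre of a tuple of points of a simplex. -/
def baryPoint (k : ℕ) (v : Fin (k + 1) → stdSimplex ℝ (Fin (m + 1))) :
    stdSimplex ℝ (Fin (m + 1)) := affineSimplex v stdSimplex.barycenter

lemma affineSimplex_baryPoint (v : Fin (k + 1) → stdSimplex ℝ (Fin (m + 1))) (l : ℕ)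
    (w : Fin (l + 1) → stdSimplex ℝ (Fin (k + 1))) :
    affineSimplex v (baryPoint l w) = baryPoint l (affineSimplex v ∘ w) :=
  congrArg (fun g => g stdSimplex.barycenter) (affineSimplex_comp v w)

lemma dist_affineSimplex_le (v : Fin (k + 1) → stdSimplex ℝ (Fin (m + 1))) (t) (y) {R : ℝ}
    (h : ∀ i, dist y (v i) ≤ R) : dist y (affineSimplex v t) ≤ R := by
  have := (convex_closedBall y.1 R).sum_mem (t := Finset.univ) (fun i _ => t.2.1 i) t.2.2
    (z := fun i => (v i).1) fun i _ => by
      rw [Metric.mem_closedBall, dist_comm]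
      exact h i
  rw [Metric.mem_closedBall, dist_comm] at this
  exact this

lemma dist_baryPoint_le (k : ℕ) (v : Fin (k + 1) → stdSimplex ℝ (Fin (m + 1))) (d : ℝ)
    (hd : ∀ i j, dist (v i) (v j) ≤ d) (i) : dist (baryPoint k v) (v i) ≤ k / (k + 1) * d := by
  have h1 : (baryPoint k v).1 - (v i).1 =
      ∑ j ∈ Finset.univ.erase i, (k + 1 : ℝ)⁻¹ • ((v j).1 - (v i).1) := by
    rw [Finset.sum_erase _ (by simp), ← Finset.smul_sum, Finset.sum_sub_distrib, smul_sub,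
      baryPoint, affineSimplex_coe, Finset.smul_sum]
    congr 1
    · refine Finset.sum_congr rfl fun j _ => ?_
      congr 1
      change ((Fintype.card (Fin (k + 1)) : ℝ))⁻¹ = _
      simp
    · rw [Finset.sum_const, Finset.card_univ, Fintype.card_fin, ← Nat.cast_smul_eq_nsmul ℝ,
        smul_smul]
      push_cast
      rw [inv_mul_cancel₀ (by positivity), one_smul]
  rw [Subtype.dist_eq, dist_eq_norm, h1]
  refine (norm_sum_le _ _).trans ((Finset.sum_le_sum (g := fun _ => (k + 1 : ℝ)⁻¹ * d)
    fun j _ => ?_).trans ?_)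
  · rw [norm_smul, Real.norm_of_nonneg (by positivity), ← dist_eq_norm]
    exact mul_le_mul_of_nonneg_left (hd j i) (by positivity)
  · rw [Finset.sum_const, Finset.card_erase_of_mem (Finset.mem_univ _), Finset.card_univ,
      Fintype.card_fin, nsmul_eq_mul]
    apply le_of_eq
    simp
    ring

end Affine

/-! ### Subdivision of singular chains -/

section SingularSubdivision

variable (κ : Type v) [Field κ] {X : Type u} [TopologicalSpace X] {k m n : ℕ}

/-- The singular chain of a simplex given by an affine chain. -/
def realize (k m : ℕ) : TupleChain κ (k + 1) (stdSimplex ℝ (Fin (m + 1))) →ₗ[κ]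
    SingularChain κ k (stdSimplex ℝ (Fin (m + 1))) :=
  Finsupp.lmapDomain κ κ affineSimplex

@[simp]
lemma realize_single (v : Fin (k + 1) → stdSimplex ℝ (Fin (m + 1))) (a : κ) :
    realize κ k m (Finsupp.single v a) = Finsupp.single (affineSimplex v) a := by
  simp [realize]

lemma bd_realize (c : TupleChain κ (k + 2) (stdSimplex ℝ (Fin (m + 1)))) :
    bd κ k _ (realize κ (k + 1) m c) = realize κ k m (tupleBd κ (k + 1) c) := by
  suffices h : bd κ k _ ∘ₗ realize κ (k + 1) m = realize κ k m ∘ₗ tupleBd κ (k + 1) from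
    congrArg (fun g => g c) h
  ext v : 2
  simp only [LinearMap.comp_apply, Finsupp.lsingle_apply, realize_single, bd_single,
    tupleBd_single, map_sum, map_smul, face_affineSimplex]

lemma pushChain_realize (v : Fin (m + 1) → stdSimplex ℝ (Fin (n + 1)))
    (c : TupleChain κ (k + 1) (stdSimplex ℝ (Fin (m + 1)))) :
    pushChain κ k (affineSimplex v) (realize κ k m c) =
      realize κ k n (pushTuple κ (affineSimplex v) (k + 1) c) := by
  suffices h : pushChain κ k (affineSimplex v) ∘ₗ realize κ k m =
      realize κ k n ∘ₗ pushTuple κ (affineSimplex v) (k + 1) from congrArg (fun g => g c) h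
  ext w : 2
  simp only [LinearMap.comp_apply, Finsupp.lsingle_apply, realize_single, pushChain_single,
    pushTuple_single, affineSimplex_comp]

/-- The fundamental affine chain of a standard simplex. -/
abbrev fundChain (n : ℕ) : TupleChain κ (n + 1) (stdSimplex ℝ (Fin (n + 1))) :=
  Finsupp.single stdSimplex.vertex 1

/-- Barycentric subdivision of singular chains. -/
def singSd (n : ℕ) (X : Type u) [TopologicalSpace X] :
    SingularChain κ n X →ₗ[κ] SingularChain κ n X :=
  Finsupp.linearCombination κ fun σ => pushChain κ n σ (realize κ n n
    (tupleSd κ baryPoint (n + 1) (fundChain κ n)))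

/-- The chain homotopy from the identity to barycentric subdivision. -/
def singHtpy (n : ℕ) (X : Type u) [TopologicalSpace X] :
    SingularChain κ n X →ₗ[κ] SingularChain κ (n + 1) X :=
  Finsupp.linearCombination κ fun σ => pushChain κ (n + 1) σ (realize κ (n + 1) n
    (tupleHtpy κ baryPoint (n + 1) (fundChain κ n)))

@[simp]
lemma singSd_single (σ : C(stdSimplex ℝ (Fin (n + 1)), X)) :
    singSd κ n X (Finsupp.single σ 1) = pushChain κ n σ (realize κ n n
    (tupleSd κ baryPoint (n + 1) (fundChain κ n))) := by
  simp [singSd]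

@[simp]
lemma singHtpy_single (σ : C(stdSimplex ℝ (Fin (n + 1)), X)) :
    singHtpy κ n X (Finsupp.single σ 1) = pushChain κ (n + 1) σ (realize κ (n + 1) n
    (tupleHtpy κ baryPoint (n + 1) (fundChain κ n))) := by
  simp [singHtpy]

/-- Subdividing an affine chain inside a singular simplex is the same as subdividing it
formally. -/
lemma singSd_push (σ : C(stdSimplex ℝ (Fin (m + 1)), X))
    (c : TupleChain κ (n + 1) (stdSimplex ℝ (Fin (m + 1)))) :
    singSd κ n X (pushChain κ n σ (realize κ n m c)) =
      pushChain κ n σ (realize κ n m (tupleSd κ baryPoint (n + 1) c)) := by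
  suffices h : singSd κ n X ∘ₗ pushChain κ n σ ∘ₗ realize κ n m =
      pushChain κ n σ ∘ₗ realize κ n m ∘ₗ tupleSd κ baryPoint (n + 1) from
    congrArg (fun g => g c) h
  ext v : 2
  simp only [LinearMap.comp_apply, Finsupp.lsingle_apply, realize_single, pushChain_single,
    singSd_single]
  have hv : affineSimplex v ∘ stdSimplex.vertex = v := funext (affineSimplex_vertex v)
  rw [← pushChain_pushChain, pushChain_realize,
    pushTuple_tupleSd κ baryPoint baryPoint _ (affineSimplex_baryPoint v), pushTuple_single,
    hv]

lemma singHtpy_push (σ : C(stdSimplex ℝ (Fin (m + 1)), X))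
    (c : TupleChain κ (n + 1) (stdSimplex ℝ (Fin (m + 1)))) :
    singHtpy κ n X (pushChain κ n σ (realize κ n m c)) =
      pushChain κ (n + 1) σ (realize κ (n + 1) m (tupleHtpy κ baryPoint (n + 1) c)) := by
  suffices h : singHtpy κ n X ∘ₗ pushChain κ n σ ∘ₗ realize κ n m =
      pushChain κ (n + 1) σ ∘ₗ realize κ (n + 1) m ∘ₗ tupleHtpy κ baryPoint (n + 1) from
    congrArg (fun g => g c) h
  ext v : 2
  simp only [LinearMap.comp_apply, Finsupp.lsingle_apply, realize_single, pushChain_single,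
    singHtpy_single]
  have hv : affineSimplex v ∘ stdSimplex.vertex = v := funext (affineSimplex_vertex v)
  rw [← pushChain_pushChain, pushChain_realize,
    pushTuple_tupleHtpy κ baryPoint baryPoint _ (affineSimplex_baryPoint v), pushTuple_single,
    hv]

lemma push_realize_fundChain (σ : C(stdSimplex ℝ (Fin (n + 1)), X)) :
    pushChain κ n σ (realize κ n n (fundChain κ n)) = Finsupp.single σ 1 := by
  rw [realize_single, pushChain_single, affineSimplex_vertex_eq_id]
  rfl

lemma bd_single_eq_push (σ : C(stdSimplex ℝ (Fin (n + 2)), X)) :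
    bd κ n X (Finsupp.single σ 1) =
      pushChain κ n σ (realize κ n (n + 1) (tupleBd κ (n + 1) (fundChain κ (n + 1)))) := by
  rw [← bd_realize, ← bd_pushChain, push_realize_fundChain]

lemma bd_singSd (c : SingularChain κ (n + 1) X) :
    bd κ n X (singSd κ (n + 1) X c) = singSd κ n X (bd κ n X c) := by
  suffices h : bd κ n X ∘ₗ singSd κ (n + 1) X = singSd κ n X ∘ₗ bd κ n X from
    congrArg (fun g => g c) h
  ext σ : 2
  simp only [LinearMap.comp_apply, Finsupp.lsingle_apply]
  rw [singSd_single, bd_pushChain, bd_realize, tupleBd_tupleSd, bd_single_eq_push, singSd_push]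

lemma bd_singHtpy_zero (c : SingularChain κ 0 X) :
    bd κ 0 X (singHtpy κ 0 X c) = c - singSd κ 0 X c := by
  suffices h : bd κ 0 X ∘ₗ singHtpy κ 0 X = LinearMap.id - singSd κ 0 X from
    congrArg (fun g => g c) h
  ext σ : 2
  simp only [LinearMap.comp_apply, Finsupp.lsingle_apply, LinearMap.sub_apply, LinearMap.id_apply]
  rw [singHtpy_single, bd_pushChain, bd_realize, tupleBd_tupleHtpy, map_sub, map_sub, map_sub,
    map_sub, push_realize_fundChain, singSd_single]
  simp [tupleHtpy]

lemma bd_singHtpy_succ (c : SingularChain κ (n + 1) X) :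
    bd κ (n + 1) X (singHtpy κ (n + 1) X c) =
      c - singSd κ (n + 1) X c - singHtpy κ n X (bd κ n X c) := by
  suffices h : bd κ (n + 1) X ∘ₗ singHtpy κ (n + 1) X =
      LinearMap.id - singSd κ (n + 1) X - singHtpy κ n X ∘ₗ bd κ n X from
    congrArg (fun g => g c) h
  ext σ : 2
  simp only [LinearMap.comp_apply, Finsupp.lsingle_apply, LinearMap.sub_apply, LinearMap.id_apply]
  rw [singHtpy_single, bd_pushChain, bd_realize, tupleBd_tupleHtpy, map_sub, map_sub, map_sub,
    map_sub, push_realize_fundChain, singSd_single, bd_single_eq_push, singHtpy_push]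

lemma bd_singHtpy_of_mem_cyclesOf {z : SingularChain κ n X} (hz : z ∈ cyclesOf κ X n) :
    bd κ n X (singHtpy κ n X z) = z - singSd κ n X z := by
  cases n with
  | zero => exact bd_singHtpy_zero κ z
  | succ n => rw [bd_singHtpy_succ, LinearMap.mem_ker.1 hz, map_zero, sub_zero]

lemma push_mem_chainsIn {A : Set X} {σ : C(stdSimplex ℝ (Fin (m + 1)), X)} (hσ : ∀ t, σ t ∈ A)
    (c : SingularChain κ n (stdSimplex ℝ (Fin (m + 1)))) : pushChain κ n σ c ∈ chainsIn κ n A := by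
  induction c using Finsupp.induction_linear with
  | zero => rw [map_zero]; exact zero_mem _
  | add c d hc hd => rw [map_add]; exact add_mem hc hd
  | single τ a =>
    rw [pushChain_single]
    exact single_mem_chainsIn κ (σ := σ.comp τ) (fun t => hσ _) a

lemma singSd_mem_chainsIn {A : Set X} {c : SingularChain κ n X} (hc : c ∈ chainsIn κ n A) :
    singSd κ n X c ∈ chainsIn κ n A := by
  refine supported_induction κ _ (fun σ hσ => ?_) hc
  rw [singSd_single]
  exact push_mem_chainsIn κ hσ _

lemma singHtpy_mem_chainsIn {A : Set X} {c : SingularChain κ n X} (hc : c ∈ chainsIn κ n A) :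
    singHtpy κ n X c ∈ chainsIn κ (n + 1) A := by
  refine supported_induction κ _ (fun σ hσ => ?_) hc
  rw [singHtpy_single]
  exact push_mem_chainsIn κ hσ _

lemma singSd_mem_cyclesOf {z : SingularChain κ n X} (hz : z ∈ cyclesOf κ X n) :
    singSd κ n X z ∈ cyclesOf κ X n := by
  cases n with
  | zero => exact Submodule.mem_top
  | succ n =>
    refine LinearMap.mem_ker.2 ?_
    rw [bd_singSd, LinearMap.mem_ker.1 hz, map_zero]

/-- Iterated subdivision does not change the homology class of a cycle. -/
lemma exists_bd_eq_sub_iterate {A : Set X} {z : SingularChain κ n X} (hz : z ∈ cyclesIn κ n A)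
    (i : ℕ) : (singSd κ n X)^[i] z ∈ cyclesIn κ n A ∧
      ∃ y ∈ chainsIn κ (n + 1) A, bd κ n X y = z - (singSd κ n X)^[i] z := by
  induction i with
  | zero => exact ⟨hz, 0, zero_mem _, by simp⟩
  | succ i ih =>
    obtain ⟨h1, y, hy, hy'⟩ := ih
    rw [Function.iterate_succ_apply']
    refine ⟨⟨singSd_mem_chainsIn κ h1.1, singSd_mem_cyclesOf κ h1.2⟩,
      y + singHtpy κ n X ((singSd κ n X)^[i] z), add_mem hy (singHtpy_mem_chainsIn κ h1.1), ?_⟩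
    rw [map_add, hy', bd_singHtpy_of_mem_cyclesOf κ h1.2]
    abel

lemma singSd_iterate_mem_sup {A B : Set X} {c : SingularChain κ n X}
    (hc : c ∈ chainsIn κ n A ⊔ chainsIn κ n B) (i : ℕ) :
    (singSd κ n X)^[i] c ∈ chainsIn κ n A ⊔ chainsIn κ n B := by
  induction i with
  | zero => exact hc
  | succ i ih =>
    rw [Function.iterate_succ_apply']
    obtain ⟨a, ha, b, hb, hab⟩ := Submodule.mem_sup.1 ih
    rw [← hab, map_add]
    exact Submodule.add_mem_sup (singSd_mem_chainsIn κ ha) (singSd_mem_chainsIn κ hb)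

lemma singSd_iterate_push (σ : C(stdSimplex ℝ (Fin (n + 1)), X)) (i : ℕ) :
    (singSd κ n X)^[i] (Finsupp.single σ 1) = pushChain κ n σ (realize κ n n
      ((tupleSd κ baryPoint (n + 1))^[i] (fundChain κ n))) := by
  induction i with
  | zero => exact (push_realize_fundChain κ σ).symm
  | succ i ih =>
    rw [Function.iterate_succ_apply', Function.iterate_succ_apply', ih, singSd_push]

/-- A sufficiently fine subdivision of a singular simplex is small of order a given cover by two
open sets. -/
lemma exists_iterate_single_mem_sup {S O₁ O₂ : Set X} (h₁ : IsOpen O₁) (h₂ : IsOpen O₂)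
    (hS : S ⊆ O₁ ∪ O₂) {σ : C(stdSimplex ℝ (Fin (n + 1)), X)} (hσ : ∀ t, σ t ∈ S) :
    ∃ i, (singSd κ n X)^[i] (Finsupp.single σ 1) ∈
      chainsIn κ n (S ∩ O₁) ⊔ chainsIn κ n (S ∩ O₂) := by
  obtain ⟨δ, hδ, hL⟩ := lebesgue_number_lemma_of_metric (ι := Bool)
    (c := fun b => σ ⁻¹' (bif b then O₁ else O₂)) (isCompact_univ)
    (fun b => by cases b <;> exact IsOpen.preimage σ.continuous (by assumption))
    (fun t _ => by
      rcases hS (hσ t) with h | h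
      · exact Set.mem_iUnion.2 ⟨true, h⟩
      · exact Set.mem_iUnion.2 ⟨false, h⟩)
  have hq0 : (0 : ℝ) ≤ n / (n + 1) := by positivity
  have hq1 : (n / (n + 1) : ℝ) < 1 := by
    rw [div_lt_one (by positivity)]
    linarith
  obtain ⟨i, hi⟩ := exists_pow_lt_of_lt_one (show 0 < δ / 2 by positivity) hq1
  refine ⟨i, ?_⟩
  rw [singSd_iterate_push]
  have hd : ∀ a b : Fin (n + 1), dist (stdSimplex.vertex (S := ℝ) a) (stdSimplex.vertex b) ≤ 2 := by
    intro a b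
    rw [Subtype.dist_eq]
    refine (dist_triangle_right _ _ (0 : Fin (n + 1) → ℝ)).trans ?_
    have := fun a : Fin (n + 1) => stdSimplex_subset_closedBall
      (stdSimplex.vertex (S := ℝ) a).2
    simp only [Metric.mem_closedBall] at this
    linarith [this a, this b]
  have hmem := tupleSd_iterate_mem_supported κ (baryPoint (m := n))
    (fun k v y R h => dist_affineSimplex_le v _ y h)
    (fun k v d h => dist_baryPoint_le k v d h) stdSimplex.vertex hd i
  refine supported_induction κ (pushChain κ n σ ∘ₗ realize κ n n) (fun w hw => ?_) hmem
  rw [LinearMap.comp_apply, realize_single, pushChain_single]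
  have hw' : ∀ t, affineSimplex w t ∈ Metric.ball (w 0) δ := by
    intro t
    rw [Metric.mem_ball, dist_comm]
    refine (dist_affineSimplex_le w t (w 0) (fun i => hw 0 i)).trans_lt ?_
    linarith
  obtain ⟨b, hb⟩ := hL (w 0) trivial
  cases b with
  | true => exact Submodule.mem_sup_left (single_mem_chainsIn κ
      (A := S ∩ O₁) (σ := σ.comp (affineSimplex w)) (fun t => ⟨hσ _, hb (hw' t)⟩) 1)
  | false => exact Submodule.mem_sup_right (single_mem_chainsIn κ
      (A := S ∩ O₂) (σ := σ.comp (affineSimplex w)) (fun t => ⟨hσ _, hb (hw' t)⟩) 1)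

lemma exists_iterate_mem_sup {S O₁ O₂ : Set X} (h₁ : IsOpen O₁) (h₂ : IsOpen O₂)
    (hS : S ⊆ O₁ ∪ O₂) {c : SingularChain κ n X} (hc : c ∈ chainsIn κ n S) :
    ∃ i, (singSd κ n X)^[i] c ∈ chainsIn κ n (S ∩ O₁) ⊔ chainsIn κ n (S ∩ O₂) := by
  rw [chainsIn, Finsupp.supported_eq_span_single] at hc
  induction hc using Submodule.span_induction with
  | mem x hx =>
    obtain ⟨σ, hσ, rfl⟩ := hx
    exact exists_iterate_single_mem_sup κ h₁ h₂ hS hσ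
  | zero => exact ⟨0, zero_mem _⟩
  | add x y _ _ hx hy =>
    obtain ⟨i, hi⟩ := hx
    obtain ⟨j, hj⟩ := hy
    refine ⟨i + j, ?_⟩
    rw [← Module.End.coe_pow, map_add, Module.End.coe_pow]
    refine add_mem ?_ ?_
    · rw [add_comm i j, Function.iterate_add_apply]
      exact singSd_iterate_mem_sup κ hi j
    · rw [Function.iterate_add_apply]
      exact singSd_iterate_mem_sup κ hj i
  | smul a x _ hx =>
    obtain ⟨i, hi⟩ := hx
    refine ⟨i, ?_⟩
    rw [← Module.End.coe_pow, map_smul, Module.End.coe_pow]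
    exact Submodule.smul_mem _ a hi

end SingularSubdivision

/-! ### Mayer–Vietoris -/

section MayerVietoris

lemma finite_of_ker_le_ker {κ : Type*} [Field κ] {P M Q : Type*} [AddCommMonoid P] [Module κ P]
    [AddCommGroup M] [Module κ M] [AddCommGroup Q] [Module κ Q] [Module.Finite κ Q]
    (g : P →ₗ[κ] M) (hg : Function.Surjective g) (h : P →ₗ[κ] Q)
    (hle : LinearMap.ker h ≤ LinearMap.ker g) : Module.Finite κ M := by
  let : AddCommGroup P := Module.addCommMonoidToAddCommGroup κ
  have hQ : Module.Finite κ (P ⧸ LinearMap.ker h) :=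
    Module.Finite.equiv h.quotKerEquivRange.symm
  refine Module.Finite.of_surjective ((LinearMap.ker h).liftQ g hle) fun y => ?_
  obtain ⟨p, hp⟩ := hg y
  exact ⟨Submodule.Quotient.mk p, hp⟩

variable (κ : Type v) [Field κ] (r : ℕ) {X : Type u} [TopologicalSpace X]

/-- Exactness of the Mayer–Vietoris sequence of a relatively open cover in the middle term: classes
of the two pieces which agree in the union come from the intersection. -/
lemma mayerVietoris_exact {S A B O₁ O₂ : Set X} (h₁ : IsOpen O₁) (h₂ : IsOpen O₂)
    (hS : S ⊆ O₁ ∪ O₂) (hA : A = S ∩ O₁) (hB : B = S ∩ O₂) (hAS : A ⊆ S) (hBS : B ⊆ S)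
    (α : setHomology κ r A) (β : setHomology κ r B)
    (h : setMap κ r hAS α = setMap κ r hBS β) :
    ∃ γ : setHomology κ r (A ∩ B : Set X), setMap κ r Set.inter_subset_left γ = α ∧
      setMap κ r Set.inter_subset_right γ = β := by
  obtain ⟨a, rfl⟩ := classIn_surjective κ r A α
  obtain ⟨b, rfl⟩ := classIn_surjective κ r B β
  have haS : a.1 ∈ cyclesIn κ r S := ⟨chainsIn_mono κ hAS a.2.1, a.2.2⟩
  have hbS : b.1 ∈ cyclesIn κ r S := ⟨chainsIn_mono κ hBS b.2.1, b.2.2⟩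
  rw [setMap_classIn κ hAS a ⟨a.1, haS⟩ rfl, setMap_classIn κ hBS b ⟨b.1, hbS⟩ rfl, ← sub_eq_zero,
    ← map_sub, classIn_eq_zero_iff] at h
  obtain ⟨y, hy, hyab⟩ := h
  obtain ⟨i, hi⟩ := exists_iterate_mem_sup κ h₁ h₂ hS hy
  rw [← hA, ← hB] at hi
  obtain ⟨w, hw, w', hw', hww⟩ := Submodule.mem_sup.1 hi
  obtain ⟨-, p, hp, hpa⟩ := exists_bd_eq_sub_iterate κ a.2 i
  obtain ⟨-, q, hq, hqb⟩ := exists_bd_eq_sub_iterate κ b.2 i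
  have hbdi : ∀ j, bd κ r X ((singSd κ (r + 1) X)^[j] y) = (singSd κ r X)^[j] (bd κ r X y) := by
    intro j
    induction j with
    | zero => rfl
    | succ j ih => rw [Function.iterate_succ_apply', Function.iterate_succ_apply', bd_singSd, ih]
  have hsub : (singSd κ r X)^[i] (bd κ r X y) =
      (singSd κ r X)^[i] a.1 - (singSd κ r X)^[i] b.1 := by
    rw [hyab]
    simp only [← Module.End.coe_pow]
    exact map_sub _ _ _
  have hkey : a.1 - bd κ r X (w + p) = b.1 + bd κ r X (w' - q) := by
    have h3 := hbdi i
    rw [← hww, hsub, map_add] at h3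
    rw [map_add, map_sub, hpa, hqb]
    have : bd κ r X w' =
      (singSd κ r X)^[i] a.1 - (singSd κ r X)^[i] b.1 - bd κ r X w := by rw [← h3]; abel
    rw [this]
    abel
  have hwp : w + p ∈ chainsIn κ (r + 1) A := add_mem hw hp
  have hwq : w' - q ∈ chainsIn κ (r + 1) B := sub_mem hw' hq
  have hzA : a.1 - bd κ r X (w + p) ∈ cyclesIn κ r A := sub_mem a.2 (bd_mem_cyclesIn κ hwp)
  have hzB : a.1 - bd κ r X (w + p) ∈ cyclesIn κ r B := by
    rw [hkey]
    exact add_mem b.2 (bd_mem_cyclesIn κ hwq)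
  have hz : a.1 - bd κ r X (w + p) ∈ cyclesIn κ r (A ∩ B) := by
    refine ⟨?_, hzA.2⟩
    rw [SetLike.mem_coe, chainsIn_inter]
    exact ⟨hzA.1, hzB.1⟩
  refine ⟨classIn κ r _ ⟨_, hz⟩, ?_, ?_⟩
  · rw [setMap_classIn κ Set.inter_subset_left ⟨_, hz⟩ ⟨_, hzA⟩ rfl,
      ← sub_eq_zero, ← map_sub, classIn_eq_zero_iff]
    refine ⟨-(w + p), neg_mem hwp, ?_⟩
    rw [map_neg]
    change _ = (a.1 - _) - a.1
    abel
  · rw [setMap_classIn κ Set.inter_subset_right ⟨_, hz⟩ ⟨_, hzB⟩ rfl,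
      ← sub_eq_zero, ← map_sub, classIn_eq_zero_iff]
    refine ⟨w' - q, hwq, ?_⟩
    change _ = (a.1 - bd κ r X (w + p)) - b.1
    rw [hkey]
    abel

/-- If the homology of the pieces of a relatively open cover is finite-dimensional, and so is that
of the intersection one degree lower, then the homology of the union is finite-dimensional. -/
lemma mayerVietoris_finite {S A B O₁ O₂ : Set X} (h₁ : IsOpen O₁) (h₂ : IsOpen O₂)
    (hS : S ⊆ O₁ ∪ O₂) (hA : A = S ∩ O₁) (hB : B = S ∩ O₂) (hAS : A ⊆ S) (hBS : B ⊆ S)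
    (hAf : Module.Finite κ (setHomology κ r A)) (hBf : Module.Finite κ (setHomology κ r B))
    (hABf : ∀ s, r = s + 1 → Module.Finite κ (setHomology κ s (A ∩ B : Set X))) :
    Module.Finite κ (setHomology κ r S) := by
  -- the classes coming from the two pieces
  let N : Submodule κ (setHomology κ r S) :=
    LinearMap.range (setMap κ r hAS) ⊔ LinearMap.range (setMap κ r hBS)
  have hNf : Module.Finite κ N := by
    have := Module.Finite.range (setMap κ r hAS)
    have := Module.Finite.range (setMap κ r hBS)
    exact Submodule.finite_sup _ _
  have hclass : ∀ x : setHomology κ r S, ∃ a ∈ chainsIn κ r A, ∃ b ∈ chainsIn κ r B,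
      ∃ hab : a + b ∈ cyclesIn κ r S, classIn κ r S ⟨a + b, hab⟩ = x := by
    intro x
    obtain ⟨z, rfl⟩ := classIn_surjective κ r S x
    obtain ⟨i, hi⟩ := exists_iterate_mem_sup κ h₁ h₂ hS z.2.1
    rw [← hA, ← hB] at hi
    obtain ⟨hz', y, hy, hyz⟩ := exists_bd_eq_sub_iterate κ z.2 i
    obtain ⟨a, ha, b, hb, hab⟩ := Submodule.mem_sup.1 hi
    rw [← hab] at hz' hyz
    refine ⟨a, ha, b, hb, hz', ?_⟩
    rw [← sub_eq_zero, ← map_sub, classIn_eq_zero_iff]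
    refine ⟨-y, neg_mem hy, ?_⟩
    rw [map_neg, hyz]
    change _ = (a + b) - z.1
    abel
  have hmemA : ∀ a, ∀ ha : a ∈ cyclesIn κ r A, ∀ ha' : a ∈ cyclesIn κ r S,
      classIn κ r S ⟨a, ha'⟩ ∈ N := fun a ha ha' =>
    Submodule.mem_sup_left ⟨classIn κ r A ⟨a, ha⟩, setMap_classIn κ hAS _ _ rfl⟩
  have hmemB : ∀ a, ∀ ha : a ∈ cyclesIn κ r B, ∀ ha' : a ∈ cyclesIn κ r S,
      classIn κ r S ⟨a, ha'⟩ ∈ N := fun a ha ha' =>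
    Submodule.mem_sup_right ⟨classIn κ r B ⟨a, ha⟩, setMap_classIn κ hBS _ _ rfl⟩
  have hsplit : ∀ a b, ∀ ha : a ∈ cyclesIn κ r A, ∀ hb : b ∈ cyclesIn κ r B,
      ∀ hab : a + b ∈ cyclesIn κ r S, classIn κ r S ⟨a + b, hab⟩ ∈ N := by
    intro a b ha hb hab
    have ha' : a ∈ cyclesIn κ r S := ⟨chainsIn_mono κ hAS ha.1, ha.2⟩
    have hb' : b ∈ cyclesIn κ r S := ⟨chainsIn_mono κ hBS hb.1, hb.2⟩
    have : (⟨a + b, hab⟩ : cyclesIn κ r S) = ⟨a, ha'⟩ + ⟨b, hb'⟩ := rfl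
    rw [this, map_add]
    exact add_mem (hmemA a ha ha') (hmemB b hb hb')
  cases r with
  | zero =>
    have hN : N = ⊤ := by
      rw [eq_top_iff]
      intro x _
      obtain ⟨a, ha, b, hb, hab, rfl⟩ := hclass x
      exact hsplit a b ⟨ha, Submodule.mem_top⟩ ⟨hb, Submodule.mem_top⟩ hab
    rw [hN] at hNf
    exact Module.Finite.equiv (Submodule.topEquiv)
  | succ s =>
    have hf := hABf s rfl
    -- pairs of chains in the two pieces whose sum is a cycle
    let P : Submodule κ (SingularChain κ (s + 1) X × SingularChain κ (s + 1) X) :=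
      (chainsIn κ (s + 1) A).prod (chainsIn κ (s + 1) B) ⊓
        (cyclesIn κ (s + 1) S).comap (LinearMap.coprod LinearMap.id LinearMap.id)
    have hPadd : ∀ p : P, p.1.1 + p.1.2 ∈ cyclesIn κ (s + 1) S := fun p => p.2.2
    have hPbd : ∀ p : P, bd κ s X p.1.1 ∈ cyclesIn κ s (A ∩ B) := by
      intro p
      refine ⟨?_, bd_mem_cyclesOf κ _⟩
      rw [SetLike.mem_coe, chainsIn_inter]
      refine ⟨bd_mem_chainsIn κ p.2.1.1, ?_⟩
      have h0 : bd κ s X (p.1.1 + p.1.2) = 0 := LinearMap.mem_ker.1 (hPadd p).2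
      rw [map_add, ← eq_neg_iff_add_eq_zero] at h0
      rw [h0]
      exact neg_mem (bd_mem_chainsIn κ p.2.1.2)
    let total : P →ₗ[κ] setHomology κ (s + 1) S := classIn κ (s + 1) S ∘ₗ
      ((LinearMap.coprod LinearMap.id LinearMap.id) ∘ₗ P.subtype).codRestrict _ hPadd
    let conn : P →ₗ[κ] setHomology κ s (A ∩ B : Set X) := classIn κ s _ ∘ₗ
      ((bd κ s X ∘ₗ LinearMap.fst κ _ _) ∘ₗ P.subtype).codRestrict _ hPbd
    have htotal : Function.Surjective total := by
      intro x
      obtain ⟨a, ha, b, hb, hab, rfl⟩ := hclass x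
      exact ⟨⟨(a, b), ⟨ha, hb⟩, hab⟩, rfl⟩
    have hker : ∀ p, conn p = 0 → total p ∈ N := by
      intro p hp
      obtain ⟨w, hw, hwp⟩ := (classIn_eq_zero_iff κ _).1 hp
      rw [chainsIn_inter] at hw
      change bd κ s X w = bd κ s X p.1.1 at hwp
      have h0 : bd κ s X (p.1.1 + p.1.2) = 0 := LinearMap.mem_ker.1 (hPadd p).2
      have h1 : p.1.1 + p.1.2 = (p.1.1 - w) + (p.1.2 + w) := by abel
      have h2 : p.1.1 - w ∈ cyclesIn κ (s + 1) A := by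
        refine ⟨sub_mem p.2.1.1 hw.1, LinearMap.mem_ker.2 ?_⟩
        rw [map_sub, hwp, sub_self]
      have h3 : p.1.2 + w ∈ cyclesIn κ (s + 1) B := by
        refine ⟨add_mem p.2.1.2 hw.2, LinearMap.mem_ker.2 ?_⟩
        rw [map_add, hwp, add_comm, ← map_add, h0]
      have h4 : (p.1.1 - w) + (p.1.2 + w) ∈ cyclesIn κ (s + 1) S := h1 ▸ hPadd p
      have h5 : total p = classIn κ (s + 1) S ⟨_, h4⟩ :=
        congrArg (classIn κ (s + 1) S) (Subtype.ext h1)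
      rw [h5]
      exact hsplit _ _ h2 h3 h4
    have hmap : Function.Surjective (N.mkQ ∘ₗ total) := (N.mkQ_surjective).comp htotal
    have hle : LinearMap.ker conn ≤ LinearMap.ker (N.mkQ ∘ₗ total) := by
      intro p hp
      rw [LinearMap.mem_ker, LinearMap.comp_apply, Submodule.mkQ_apply,
        Submodule.Quotient.mk_eq_zero]
      exact hker p hp
    have hfin : Module.Finite κ (setHomology κ (s + 1) S ⧸ N) :=
      finite_of_ker_le_ker (N.mkQ ∘ₗ total) hmap conn hle
    exact Module.Finite.of_submodule_quotient N

end MayerVietoris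

/-! ### Homotopies and small spaces -/

section Small

variable (κ : Type v) [Field κ] (r : ℕ) {X : Type u} [TopologicalSpace X]

/-- A space with finitely many singular `r`-simplices has finite-dimensional homology. -/
lemma finite_setHomology_of_finite (A : Set X)
    [Finite C(stdSimplex ℝ (Fin (r + 1)), A)] : Module.Finite κ (setHomology κ r A) := by
  have h1 : Module.Finite κ (SingularChain κ r A) := inferInstance
  have h2 : Module.Finite κ (chainsIn κ r A) := Module.Finite.equiv (chainsInEquiv κ r A)
  have h3 : Module.Finite κ (cyclesIn κ r A) := Submodule.finiteDimensional_of_le inf_le_left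
  exact Module.Finite.of_surjective (classIn κ r A) (classIn_surjective κ r A)

/-- If `B` can be deformed inside itself into `A ⊆ B`, keeping `A` inside `A`, then the inclusion
`A ⊆ B` induces an isomorphism in homology. -/
lemma setMap_bijective_of_homotopy {A B : Set X} (h : A ⊆ B) (K : unitInterval × X → X)
    (hK : ContinuousOn K (Set.univ ×ˢ B)) (h0 : ∀ x ∈ B, K (0, x) = x)
    (hB : ∀ s, ∀ x ∈ B, K (s, x) ∈ B) (hA : ∀ s, ∀ x ∈ A, K (s, x) ∈ A)
    (h1 : ∀ x ∈ B, K (1, x) ∈ A) : Function.Bijective (setMap κ r h) := by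
  have hcont : Continuous fun p : unitInterval × B => K (p.1, p.2) :=
    hK.comp_continuous (by fun_prop) fun p => ⟨trivial, p.2.2⟩
  have hcontA : Continuous fun p : unitInterval × A => K (p.1, p.2) :=
    hK.comp_continuous (by fun_prop) fun p => ⟨trivial, h p.2.2⟩
  let ι : C(A, B) := ⟨Set.inclusion h, by fun_prop⟩
  let ρ : C(B, A) := ⟨fun x => ⟨K (1, x), h1 x x.2⟩,
    (hcont.comp (by fun_prop : Continuous fun x : B => ((1 : unitInterval), x))).subtype_mk _⟩
  have H1 : (ContinuousMap.id B).Homotopic (ι.comp ρ) := ⟨{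
    toFun := fun p => ⟨K (p.1, p.2), hB _ _ p.2.2⟩
    continuous_toFun := hcont.subtype_mk _
    map_zero_left := fun x => Subtype.ext (h0 _ x.2)
    map_one_left := fun x => rfl }⟩
  have H2 : (ContinuousMap.id A).Homotopic (ρ.comp ι) := ⟨{
    toFun := fun p => ⟨K (p.1, p.2), hA _ _ p.2.2⟩
    continuous_toFun := hcontA.subtype_mk _
    map_zero_left := fun x => Subtype.ext (h0 _ (h x.2))
    map_one_left := fun x => rfl }⟩
  have e1 := spaceMap_congr_of_homotopic κ r H1
  have e2 := spaceMap_congr_of_homotopic κ r H2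
  constructor
  · apply Function.LeftInverse.injective (g := spaceMap κ r ρ)
    intro x
    have := congrArg (fun g => g x) e2
    simp only [spaceMap_id, spaceMap_comp] at this
    exact this.symm
  · apply Function.RightInverse.surjective (g := spaceMap κ r ρ)
    intro x
    have := congrArg (fun g => g x) e1
    simp only [spaceMap_id, spaceMap_comp] at this
    exact this.symm

end Small

/-! ### Finiteness for compact subsets of absolute neighbourhood retracts -/

section Finiteness

variable (κ : Type v) [Field κ] (r : ℕ)

lemma finite_setHomology_empty {X : Type u} [TopologicalSpace X] :
    Module.Finite κ (setHomology κ r (∅ : Set X)) := by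
  have : IsEmpty C(stdSimplex ℝ (Fin (r + 1)), (∅ : Set X)) :=
    ⟨fun σ => (σ (stdSimplex.vertex 0)).2⟩
  exact finite_setHomology_of_finite κ r ∅

lemma finite_setHomology_of_convex {E : Type u} [NormedAddCommGroup E] [NormedSpace ℝ E]
    {C : Set E} (hC : Convex ℝ C) : Module.Finite κ (setHomology κ r C) := by
  rcases C.eq_empty_or_nonempty with rfl | ⟨x₀, hx₀⟩
  · exact finite_setHomology_empty κ r
  have : Subsingleton C(stdSimplex ℝ (Fin (r + 1)), ({x₀} : Set E)) :=
    ⟨fun σ τ => ContinuousMap.ext fun _ => Subsingleton.elim _ _⟩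
  have := finite_setHomology_of_finite κ r {x₀}
  refine Module.Finite.of_surjective _ (setMap_bijective_of_homotopy κ r
    (Set.singleton_subset_iff.2 hx₀) (fun p => (1 - p.1 : ℝ) • p.2 + (p.1 : ℝ) • x₀)
    (by fun_prop) (fun x _ => by simp) ?_ ?_ (fun x _ => by simp)).2
  · intro s x hx
    exact hC hx hx₀ (by linarith [s.2.2]) s.2.1 (by ring)
  · rintro s x rfl
    simp [← add_smul]

lemma finite_setHomology_iUnion_convex {E : Type u} [NormedAddCommGroup E] [NormedSpace ℝ E]
    {n : ℕ} (C : Fin n → Set E) (hC : ∀ i, Convex ℝ (C i)) (hO : ∀ i, IsOpen (C i)) :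
    Module.Finite κ (setHomology κ r (⋃ i, C i)) := by
  induction n generalizing r with
  | zero =>
    rw [Set.iUnion_of_empty]
    exact finite_setHomology_empty κ r
  | succ n ih =>
    have hS : ⋃ i, C i = (⋃ i : Fin n, C i.succ) ∪ C 0 := by
      ext x
      simp only [Set.mem_iUnion, Set.mem_union, Fin.exists_fin_succ]
      exact or_comm
    have h1 : (⋃ i : Fin n, C i.succ) ⊆ ⋃ i, C i := hS ▸ Set.subset_union_left
    have h2 : C 0 ⊆ ⋃ i, C i := Set.subset_iUnion C 0
    refine mayerVietoris_finite κ r (isOpen_iUnion fun i : Fin n => hO i.succ) (hO 0) hS.le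
      (Set.inter_eq_right.2 h1).symm (Set.inter_eq_right.2 h2).symm h1 h2
      (ih r _ (fun i => hC _) fun i => hO _) (finite_setHomology_of_convex κ r (hC 0)) ?_
    intro s _
    rw [Set.iUnion_inter]
    exact ih s _ (fun i => (hC _).inter (hC 0)) fun i => (hO _).inter (hO 0)

/-- In a compact absolute neighbourhood retract, the inclusion of a compact set into an open one
has finite rank in homology: embedded in a Banach space, it factors through a finite union of
balls. -/
lemma finite_range_setMap {X : Type u} [TopologicalSpace X] (hX : IsCompactANR X) {K O : Set X}
    (hK : IsClosed K) (hO : IsOpen O) (h : K ⊆ O) :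
    Module.Finite κ (LinearMap.range (setMap κ r h)) := by
  have := hX.compact
  have := hX.metrizable
  let : MetricSpace X := TopologicalSpace.metrizableSpaceMetric X
  let e : X → C(X, ℝ) := (⟨fun p : X × X => dist p.1 p.2, continuous_dist⟩ : C(X × X, ℝ)).curry
  have he : Continuous e := ContinuousMap.continuous _
  have hinj : Function.Injective e := by
    intro x y hxy
    have := congrArg (fun g : C(X, ℝ) => g y) hxy
    change dist x y = dist y y at this
    rwa [dist_self, dist_eq_zero] at this
  obtain ⟨W, hW, heW, ρ, hρ⟩ := hX.retract C(X, ℝ) e (he.isClosedEmbedding hinj)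
  let W' : Set C(X, ℝ) := Subtype.val '' (ρ ⁻¹' O)
  have hW' : IsOpen W' := hW.isOpenMap_subtype_val _ (hO.preimage ρ.continuous)
  have hKW : ∀ x ∈ K, e x ∈ W' := fun x hx =>
    ⟨⟨e x, heW ⟨x, rfl⟩⟩, by rw [Set.mem_preimage, hρ]; exact h hx, rfl⟩
  choose! δ hδ hball using fun x (hx : x ∈ K) => Metric.isOpen_iff.1 hW' _ (hKW x hx)
  obtain ⟨F, hFK, hF⟩ := (hK.isCompact.image he).elim_finite_subcover_image (b := K)
    (c := fun x => Metric.ball (e x) (δ x)) (fun x _ => Metric.isOpen_ball) (by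
      rintro _ ⟨x, hx, rfl⟩
      exact Set.mem_biUnion hx (Metric.mem_ball_self (hδ x hx)))
  obtain ⟨hFfin, hF⟩ := hF
  have := hFfin.fintype
  let C : Fin (Fintype.card F) → Set C(X, ℝ) := fun i =>
    Metric.ball (e ((Fintype.equivFin F).symm i)) (δ ((Fintype.equivFin F).symm i))
  let V := ⋃ i, C i
  have hVfin : Module.Finite κ (setHomology κ r V) :=
    finite_setHomology_iUnion_convex κ r C (fun i => convex_ball _ _) fun i => Metric.isOpen_ball
  have hKV : ∀ x ∈ K, e x ∈ V := by
    intro x hx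
    obtain ⟨y, hy, hxy⟩ := Set.mem_iUnion₂.1 (hF ⟨x, hx, rfl⟩)
    refine Set.mem_iUnion.2 ⟨Fintype.equivFin F ⟨y, hy⟩, ?_⟩
    simpa [C] using hxy
  have hVW : V ⊆ W' := Set.iUnion_subset fun i => hball _ (hFK (Subtype.coe_prop _))
  have hWO : ∀ y ∈ W', ∃ hy : y ∈ W, ρ ⟨y, hy⟩ ∈ O := by
    rintro _ ⟨y, hy, rfl⟩
    exact ⟨y.2, hy⟩
  let g : C(K, V) := ⟨fun x => ⟨e x, hKV x x.2⟩, by fun_prop⟩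
  let g' : C(V, O) := ⟨fun y => ⟨ρ ⟨y, (hWO y (hVW y.2)).1⟩, (hWO y (hVW y.2)).2⟩, by fun_prop⟩
  have hcomp : (⟨Set.inclusion h, by fun_prop⟩ : C(K, O)) = g'.comp g := by
    ext x
    exact (hρ _ _).symm
  have hle : LinearMap.range (setMap κ r h) ≤ LinearMap.range (spaceMap κ r g') := by
    rintro _ ⟨x, rfl⟩
    refine ⟨spaceMap κ r g x, ?_⟩
    rw [setMap, hcomp, spaceMap_comp]
  have := Module.Finite.range (spaceMap κ r g')
  exact Submodule.finiteDimensional_of_le hle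

lemma finite_setHomology_of_injective {X : Type u} [TopologicalSpace X] (hX : IsCompactANR X)
    {K O : Set X} (hK : IsClosed K) (hO : IsOpen O) (h : K ⊆ O)
    (hinj : Function.Injective (setMap κ r h)) : Module.Finite κ (setHomology κ r K) := by
  have := finite_range_setMap κ r hX hK hO h
  exact Module.Finite.equiv (LinearEquiv.ofInjective _ hinj).symm

end Finiteness

/-! ### Pushing the space along the levels -/

section Pushing

open Set

variable {X : Type u} [TopologicalSpace X]

/-- Over a neighbourhood of `t`, every self-map `k` of the base lifts to a self-map of the total
space which is homotopic to the identity over the straight-line homotopy from `id` to `k` (run at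
a suitable speed). -/
def ChartPush (f : X → ℝ) (t : ℝ) : Prop :=
  ∃ ε > 0, ∀ k : ℝ → ℝ, Continuous k → MapsTo k (Ioo (t - ε) (t + ε)) (Ioo (t - ε) (t + ε)) →
    ∃ G : unitInterval × X → X, ContinuousOn G (univ ×ˢ (f ⁻¹' Ioo (t - ε) (t + ε))) ∧
      ∀ x ∈ f ⁻¹' Ioo (t - ε) (t + ε), G (0, x) = x ∧ f (G (1, x)) = k (f x) ∧
        ∀ s, f (G (s, x)) ∈ uIcc (f x) (k (f x))

/-- `f ⁻¹ [t, t + ε]` deformation retracts onto the level `t`. -/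
def UpperRetract (f : X → ℝ) (t : ℝ) : Prop :=
  ∃ ε > 0, ∃ D : unitInterval × X → X, ContinuousOn D (univ ×ˢ (f ⁻¹' Icc t (t + ε))) ∧
    ∀ x ∈ f ⁻¹' Icc t (t + ε), D (0, x) = x ∧ f (D (1, x)) = t ∧
      (f x = t → ∀ s, D (s, x) = x) ∧ ∀ s, f (D (s, x)) ∈ Icc t (t + ε)

/-- The consequences of tameness used below, in a form invariant under `f ↦ -f`. -/
structure LocallyTame (f : X → ℝ) (C : Set ℝ) : Prop where
  compact : CompactSpace X
  continuous : Continuous f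
  finite : C.Finite
  regular : ∀ t ∉ C, ChartPush f t
  upper : ∀ t ∈ C, UpperRetract f t
  lower : ∀ t ∈ C, UpperRetract (fun x => -f x) (-t)

lemma exists_extension {S : Set X} (g : C(unitInterval × S, X)) :
    ∃ G : unitInterval × X → X, ContinuousOn G (univ ×ˢ S) ∧
      ∀ s x (h : x ∈ S), G (s, x) = g (s, ⟨x, h⟩) := by
  classical
  refine ⟨fun p => if h : p.2 ∈ S then g (p.1, ⟨p.2, h⟩) else p.2, ?_, fun s x h => dif_pos h⟩
  rw [continuousOn_iff_continuous_domRestrict]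
  have : (univ ×ˢ S : Set (unitInterval × X)).domRestrict
      (fun p => if h : p.2 ∈ S then g (p.1, ⟨p.2, h⟩) else p.2) =
      fun p => g (p.1.1, ⟨p.1.2, p.2.2⟩) := by
    ext p
    exact dif_pos p.2.2
  rw [this]
  fun_prop

lemma chartPush_of_fiberwiseHomotopyEquivalent {f : X → ℝ} (hf : Continuous f) {t ε : ℝ}
    (hε : 0 < ε) (h : FiberwiseHomotopyEquivalent (fun x : f ⁻¹' Ioo (t - ε) (t + ε) => f x)
      (fun y : (f ⁻¹' {t}) × (Ioo (t - ε) (t + ε)) => (y.2 : ℝ))) : ChartPush f t := by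
  obtain ⟨φ, ψ, hφ, hψ, ⟨H, hH⟩, -⟩ := h
  have hφ' : ∀ e, ((φ e).2 : ℝ) = f e := hφ
  have hH' : ∀ s e, f (H (s, e)) = f e := hH
  refine ⟨ε, hε, fun k hk hkI => ?_⟩
  have hmem : ∀ s : unitInterval, ∀ x : f ⁻¹' Ioo (t - ε) (t + ε),
      (1 - s : ℝ) * f x + s * k (f x) ∈ Ioo (t - ε) (t + ε) := fun s x =>
    convex_Ioo _ _ x.2 (hkI x.2) (by linarith [s.2.2]) s.2.1 (by ring)
  let L : ContinuousMap.Homotopy (ψ.comp φ) (ψ.comp ⟨fun x : f ⁻¹' Ioo (t - ε) (t + ε) =>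
      ((φ x).1, ⟨k (f x), hkI x.2⟩), by fun_prop⟩) := {
    toFun := fun p => ψ ((φ p.2).1, ⟨_, hmem p.1 p.2⟩)
    continuous_toFun := by fun_prop
    map_zero_left := fun x => by
      simp only [ContinuousMap.comp_apply]
      congr 1
      refine Prod.ext rfl (Subtype.ext ?_)
      rw [hφ']
      simp
    map_one_left := fun x => by
      simp only [ContinuousMap.comp_apply]
      congr 1
      refine Prod.ext rfl (Subtype.ext ?_)
      simp }
  have hL : ∀ s x, f (L (s, x)) = (1 - s : ℝ) * f x + s * k (f x) := fun s x => hψ _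
  obtain ⟨G, hG, hGe⟩ := exists_extension
    ((⟨Subtype.val, continuous_subtype_val⟩ : C(f ⁻¹' Ioo (t - ε) (t + ε), X)).comp
      (H.symm.trans L).toContinuousMap)
  refine ⟨G, hG, fun x hx => ⟨?_, ?_, fun s => ?_⟩⟩
  · rw [hGe 0 x hx]
    exact congrArg Subtype.val ((H.symm.trans L).apply_zero ⟨x, hx⟩)
  · rw [hGe 1 x hx]
    refine (congrArg (fun y : f ⁻¹' Ioo (t - ε) (t + ε) => f y)
      ((H.symm.trans L).apply_one ⟨x, hx⟩)).trans ?_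
    exact hψ _
  · rw [hGe s x hx]
    change f ((H.symm.trans L) (s, ⟨x, hx⟩)) ∈ _
    rw [ContinuousMap.Homotopy.trans_apply]
    split_ifs with hs
    · rw [ContinuousMap.Homotopy.symm_apply, hH']
      exact left_mem_uIcc
    · rw [hL, ← segment_eq_uIcc]
      refine ⟨_, _, ?_, ?_, ?_, rfl⟩
      · linarith [(⟨2 * (s : ℝ) - 1, unitInterval.two_mul_sub_one_mem_iff.2
          ⟨(not_le.1 hs).le, s.2.2⟩⟩ : unitInterval).2.2]
      · exact (⟨2 * (s : ℝ) - 1, unitInterval.two_mul_sub_one_mem_iff.2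
          ⟨(not_le.1 hs).le, s.2.2⟩⟩ : unitInterval).2.1
      · ring

/-- A deformation of `f ≤ u` inside `f ≤ p` which ends in `f ≤ q`, preserves the levels below `q`,
and does not let points from above `q` pass below `q`. -/
def PushDown (f : X → ℝ) (q u p : ℝ) : Prop :=
  ∃ K : unitInterval × X → X, ContinuousOn K (univ ×ˢ (f ⁻¹' Iic u)) ∧
    ∀ x, f x ≤ u → K (0, x) = x ∧ f (K (1, x)) ≤ q ∧ (∀ s, f (K (s, x)) ≤ p) ∧
      (f x ≤ q → ∀ s, f (K (s, x)) = f x) ∧ (q ≤ f x → ∀ s, q ≤ f (K (s, x)))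

lemma PushDown.refl (f : X → ℝ) (q : ℝ) : PushDown f q q q :=
  ⟨Prod.snd, continuousOn_snd, fun _ hx => ⟨rfl, hx, fun _ => hx, fun _ _ => rfl, fun h _ => h⟩⟩

/-- Push from `p` down to `u` and then from `u` down to `q`. -/
lemma PushDown.trans {f : X → ℝ} (hf : Continuous f) {q u p' p : ℝ} (hqu : q ≤ u) (hp : p' ≤ p)
    (h₁ : PushDown f q u p') (h₂ : PushDown f u p p) : PushDown f q p p := by
  obtain ⟨K, hK, hK'⟩ := h₁
  obtain ⟨M, hM, hM'⟩ := h₂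
  let σ : unitInterval → unitInterval := fun s => projIcc 0 1 zero_le_one (2 * s)
  let τ : unitInterval → unitInterval := fun s => projIcc 0 1 zero_le_one (2 * s - 1)
  have hσ : Continuous σ := by fun_prop
  have hτ : Continuous τ := by fun_prop
  classical
  refine ⟨fun z => if (z.1 : ℝ) ≤ 1 / 2 then M (σ z.1, z.2) else K (τ z.1, M (1, z.2)), ?_, ?_⟩
  · have hcl : IsClosed (f ⁻¹' Iic p) := isClosed_Iic.preimage hf
    have hcov : (univ ×ˢ (f ⁻¹' Iic p) : Set (unitInterval × X)) ⊆
        ({s : unitInterval | (s : ℝ) ≤ 1 / 2} ×ˢ (f ⁻¹' Iic p)) ∪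
        ({s : unitInterval | 1 / 2 ≤ (s : ℝ)} ×ˢ (f ⁻¹' Iic p)) := by
      rintro ⟨s, x⟩ ⟨-, hx⟩
      rcases le_total (s : ℝ) (1 / 2) with h | h
      · exact Or.inl ⟨h, hx⟩
      · exact Or.inr ⟨h, hx⟩
    refine ContinuousOn.mono (ContinuousOn.union_of_isClosed ?_ ?_
      ((isClosed_le (by fun_prop) (by fun_prop)).prod hcl)
      ((isClosed_le (by fun_prop) (by fun_prop)).prod hcl)) hcov
    · refine ContinuousOn.congr (f := fun z => M (σ z.1, z.2)) ?_
        fun z hz => if_pos (show (z.1 : ℝ) ≤ 1 / 2 from hz.1)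
      exact hM.comp (by fun_prop) fun z hz => ⟨trivial, hz.2⟩
    · refine ContinuousOn.congr (f := fun z => K (τ z.1, M (1, z.2))) ?_ fun z hz => ?_
      · refine hK.comp (ContinuousOn.prodMk (by fun_prop) ?_) fun z hz =>
          ⟨trivial, (hM' z.2 hz.2).2.1⟩
        exact hM.comp (by fun_prop) fun z hz => ⟨trivial, hz.2⟩
      · dsimp only
        split_ifs with h
        · have h12 : (z.1 : ℝ) = 1 / 2 := le_antisymm h hz.1
          have e1 : σ z.1 = 1 := projIcc_of_right_le _ (by rw [h12]; norm_num)
          have e2 : τ z.1 = 0 := projIcc_of_le_left _ (by rw [h12]; norm_num)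
          rw [e1, e2, (hK' _ (hM' z.2 hz.2).2.1).1]
        · rfl
  · intro x hx
    obtain ⟨m0, m1, mp, ml, mg⟩ := hM' x hx
    obtain ⟨k0, k1, kp, kl, kg⟩ := hK' (M (1, x)) m1
    have hge : u ≤ f x → u ≤ f (M (1, x)) := fun h => mg h 1
    have hge' : q ≤ f x → q ≤ f (M (1, x)) := fun h => by
      rcases le_total (f x) u with h' | h'
      · rwa [ml h' 1]
      · exact hqu.trans (hge h')
    refine ⟨?_, ?_, fun s => ?_, fun h s => ?_, fun h s => ?_⟩
    · have e1 : σ 0 = 0 := projIcc_of_le_left _ (by simp)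
      dsimp only
      rw [if_pos (by simp), e1, m0]
    · have e1 : τ 1 = 1 := projIcc_of_right_le _ (by norm_num)
      dsimp only
      rw [if_neg (by norm_num), e1]
      exact k1
    · dsimp only
      split_ifs
      · exact mp _
      · exact (kp _).trans hp
    · dsimp only
      split_ifs
      · exact ml (h.trans hqu) _
      · have := ml (h.trans hqu) 1
        rw [kl (this.le.trans h), this]
    · dsimp only
      split_ifs
      · rcases le_total (f x) u with h' | h'
        · rwa [ml h']
        · exact hqu.trans (mg h' _)
      · exact kg (hge' h) _

/-- The push attached to a chart. A cut-off function makes the deformation stationary near the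
lower end of the chart, so that it extends by the identity. -/
lemma ChartPush.exists_pushDown {f : X → ℝ} (hf : Continuous f) {t : ℝ} (h : ChartPush f t) :
    ∃ ε > 0, ∀ a b, t - ε < a → a ≤ b → b < t + ε → PushDown f a b b := by
  obtain ⟨ε, hε, h⟩ := h
  refine ⟨ε, hε, fun a b ha hab hb => ?_⟩
  obtain ⟨G, hG, hG'⟩ := h (fun y => min y a) (by fun_prop) fun y hy =>
    ⟨lt_min hy.1 ha, (min_le_left _ _).trans_lt hy.2⟩
  obtain ⟨a', ha', haa'⟩ := exists_between ha
  let χ : ℝ → unitInterval := fun y => projIcc 0 1 zero_le_one ((y - a') / (a - a'))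
  have hχ : Continuous χ := by
    have : Continuous fun y : ℝ => (y - a') / (a - a') := by fun_prop
    fun_prop
  have hχ0 : ∀ y ≤ a', χ y = 0 := fun y hy =>
    projIcc_of_le_left _ (div_nonpos_of_nonpos_of_nonneg (by linarith) (by linarith))
  have hχ1 : ∀ y, a ≤ y → χ y = 1 := fun y hy =>
    projIcc_of_right_le _ (by rw [le_div_iff₀ (by linarith)]; linarith)
  have hI : ∀ x, f x ≤ b → a' ≤ f x → x ∈ f ⁻¹' Ioo (t - ε) (t + ε) := fun x h1 h2 =>
    ⟨ha'.trans_le h2, h1.trans_lt hb⟩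
  classical
  refine ⟨fun z => if f z.2 ≤ a' then z.2 else G (z.1 * χ (f z.2), z.2), ?_, ?_⟩
  · have hcov : (univ ×ˢ (f ⁻¹' Iic b) : Set (unitInterval × X)) ⊆
        (univ ×ˢ (f ⁻¹' Iic a')) ∪ (univ ×ˢ (f ⁻¹' Icc a' b)) := by
      rintro ⟨s, x⟩ ⟨-, hx⟩
      rcases le_total (f x) a' with h | h
      · exact Or.inl ⟨trivial, h⟩
      · exact Or.inr ⟨trivial, h, hx⟩
    refine ContinuousOn.mono (ContinuousOn.union_of_isClosed ?_ ?_
      (isClosed_univ.prod (isClosed_Iic.preimage hf))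
      (isClosed_univ.prod (isClosed_Icc.preimage hf))) hcov
    · exact continuousOn_snd.congr fun z hz => if_pos hz.2
    · refine ContinuousOn.congr (f := fun z => G (z.1 * χ (f z.2), z.2)) ?_ fun z hz => ?_
      · refine hG.comp ?_ fun z hz => ⟨trivial, hI _ hz.2.2 hz.2.1⟩
        fun_prop
      · dsimp only
        split_ifs with h
        · rw [hχ0 _ h, mul_zero, (hG' _ (hI _ hz.2.2 hz.2.1)).1]
        · rfl
  · intro x hx
    by_cases hxa : f x ≤ a'
    · simp only [if_pos hxa]
      exact ⟨trivial, hxa.trans haa'.le, fun _ => hx, fun _ _ => trivial, fun h _ => h⟩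
    · simp only [if_neg hxa]
      push Not at hxa
      obtain ⟨g0, g1, gs⟩ := hG' x (hI x hx hxa.le)
      have gs' : ∀ s, min (f x) a ≤ f (G (s, x)) ∧ f (G (s, x)) ≤ f x := by
        intro s
        have := gs s
        rw [uIcc_of_ge (min_le_left _ _)] at this
        exact this
      refine ⟨?_, ?_, fun s => (gs' _).2.trans hx, fun h s => ?_, fun h s => ?_⟩
      · rw [zero_mul, g0]
      · rw [one_mul]
        rcases le_total (f x) a with h | h
        · exact (gs' _).2.trans h
        · rw [hχ1 _ h, g1]
          exact min_le_right _ _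
      · have := gs' (s * χ (f x))
        rw [min_eq_left h] at this
        exact le_antisymm this.2 this.1
      · have := gs' (s * χ (f x))
        rw [min_eq_right h] at this
        exact this.1

lemma pushDown_of_chartPush {f : X → ℝ} (hf : Continuous f) {q p : ℝ} (hqp : q ≤ p)
    (h : ∀ t ∈ Icc q p, ChartPush f t) : PushDown f q p p := by
  choose! ε hε hp using fun t (ht : t ∈ Icc q p) => (h t ht).exists_pushDown hf
  obtain ⟨u, hu0, humono, ⟨m, hm⟩, hu⟩ := exists_monotone_Icc_subset_open_cover_Icc hqp
    (c := fun t : Icc q p => Subtype.val ⁻¹' Ioo (t.1 - ε t) (t.1 + ε t))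
    (fun t => isOpen_Ioo.preimage continuous_subtype_val) (fun t _ => mem_iUnion.2
      ⟨t, by constructor <;> linarith [hε t t.2]⟩)
  have key : ∀ n, PushDown f q (u n) (u n) := by
    intro n
    induction n with
    | zero => rw [hu0]; exact PushDown.refl f q
    | succ n ih =>
      obtain ⟨t, ht⟩ := hu n
      have h1 := humono (Nat.le_succ n)
      exact PushDown.trans hf (u n).2.1 h1 ih (hp t t.2 _ _ (ht (left_mem_Icc.2 h1)).1 h1
        (ht (right_mem_Icc.2 h1)).2)
  have := key m
  rwa [hm m le_rfl] at this

/-- Just above a level with an upper deformation retraction, all levels can be pushed down to it.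
The given retraction `D` need not respect the levels, but by compactness it moves points close to
the level `q` only below a prescribed level `b`. -/
lemma UpperRetract.exists_pushDown [CompactSpace X] {f : X → ℝ} (hf : Continuous f) {q p₀ : ℝ}
    (h : UpperRetract f q) (hqp : q < p₀) (hreg : ∀ t, q < t → t ≤ p₀ → ChartPush f t) :
    ∃ b₀ > q, ∀ b, q < b → b ≤ b₀ → PushDown f q b b := by
  obtain ⟨ε, hε, D, hD, hD'⟩ := h
  refine ⟨min p₀ (q + ε), lt_min hqp (by linarith), fun b hqb hb => ?_⟩
  have hbε : b ≤ q + ε := hb.trans (min_le_right _ _)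
  have hcl : IsClosed (univ ×ˢ (f ⁻¹' Icc q (q + ε)) : Set (unitInterval × X)) :=
    isClosed_univ.prod (isClosed_Icc.preimage hf)
  have hM : IsCompact ((univ ×ˢ (f ⁻¹' Icc q (q + ε)) : Set (unitInterval × X)) ∩
      (fun z => f (D z)) ⁻¹' Ici b) :=
    ((hf.comp_continuousOn hD).preimage_isClosed_of_isClosed hcl isClosed_Ici).isCompact
  obtain ⟨c, hqc, hcb, hc⟩ : ∃ c, q < c ∧ c < b ∧ ∀ x, q ≤ f x → f x ≤ c → ∀ s,
      f (D (s, x)) ≤ b := by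
    rcases Set.eq_empty_or_nonempty ((univ ×ˢ (f ⁻¹' Icc q (q + ε)) : Set (unitInterval × X)) ∩
      (fun z => f (D z)) ⁻¹' Ici b) with he | hne
    · obtain ⟨c, h1, h2⟩ := exists_between hqb
      refine ⟨c, h1, h2, fun x hx1 hx2 s => ?_⟩
      by_contra hlt
      push Not at hlt
      have : (s, x) ∈ (∅ : Set (unitInterval × X)) := by
        rw [← he]
        exact ⟨⟨trivial, hx1, by linarith⟩, hlt.le⟩
      exact this
    · obtain ⟨⟨s₀, x₀⟩, hz, hmin⟩ := hM.exists_isMinOn hne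
        ((hf.comp continuous_snd).continuousOn)
      have hx₀ : q < f x₀ := by
        refine lt_of_le_of_ne hz.1.2.1 fun heq => ?_
        have h1 : b ≤ f (D (s₀, x₀)) := hz.2
        rw [(hD' x₀ hz.1.2).2.2.1 heq.symm] at h1
        linarith
      obtain ⟨c, h1, h2⟩ := exists_between (lt_min hqb hx₀)
      refine ⟨c, h1, h2.trans_le (min_le_left _ _), fun x hx1 hx2 s => ?_⟩
      by_contra hlt
      push Not at hlt
      have hcb := h2.trans_le (min_le_left _ _)
      have h3 : f x₀ ≤ f x := hmin (a := (s, x)) ⟨⟨trivial, hx1, by linarith⟩, hlt.le⟩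
      linarith [h2.trans_le (min_le_right _ _)]
  have h2 : PushDown f c b b := pushDown_of_chartPush hf hcb.le fun t ht =>
    hreg t (hqc.trans_le ht.1) (ht.2.trans (hb.trans (min_le_left _ _)))
  refine PushDown.trans hf hqc.le le_rfl (p' := b) ?_ h2
  have hI : ∀ x, f x ≤ c → q ≤ f x → x ∈ f ⁻¹' Icc q (q + ε) := fun x h1 h2 =>
    ⟨h2, by linarith⟩
  classical
  refine ⟨fun z => if f z.2 ≤ q then z.2 else D z, ?_, ?_⟩
  · have hcov : (univ ×ˢ (f ⁻¹' Iic c) : Set (unitInterval × X)) ⊆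
        (univ ×ˢ (f ⁻¹' Iic q)) ∪ (univ ×ˢ (f ⁻¹' Icc q c)) := by
      rintro ⟨s, x⟩ ⟨-, hx⟩
      rcases le_total (f x) q with h | h
      · exact Or.inl ⟨trivial, h⟩
      · exact Or.inr ⟨trivial, h, hx⟩
    refine ContinuousOn.mono (ContinuousOn.union_of_isClosed ?_ ?_
      (isClosed_univ.prod (isClosed_Iic.preimage hf))
      (isClosed_univ.prod (isClosed_Icc.preimage hf))) hcov
    · exact continuousOn_snd.congr fun z hz => if_pos hz.2
    · refine ContinuousOn.congr (f := D) ?_ fun z hz => ?_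
      · exact hD.mono fun z hz => ⟨trivial, hI _ hz.2.2 hz.2.1⟩
      · split_ifs with h
        · exact ((hD' z.2 (hI _ hz.2.2 hz.2.1)).2.2.1 (le_antisymm h hz.2.1) z.1).symm
        · rfl
  · intro x hx
    by_cases hxq : f x ≤ q
    · simp only [if_pos hxq]
      exact ⟨trivial, hxq, fun _ => by linarith, fun _ _ => trivial, fun h _ => h⟩
    · simp only [if_neg hxq]
      push Not at hxq
      obtain ⟨d0, d1, -, ds⟩ := hD' x (hI x hx hxq.le)
      exact ⟨d0, d1.le, hc x hxq.le hx, fun h => absurd h hxq.not_ge, fun _ s => (ds s).1⟩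

/-- All levels between `q` and `p` can be pushed down to `q` if no value in `C` lies above `q` and
up to `p`; the level `q` itself may be critical. -/
lemma LocallyTame.pushDown {f : X → ℝ} {C : Set ℝ} (h : LocallyTame f C) {q p : ℝ} (hqp : q ≤ p)
    (hC : ∀ t ∈ C, q < t → p < t) : PushDown f q p p := by
  have := h.compact
  have hreg : ∀ t, q < t → t ≤ p → ChartPush f t := fun t h1 h2 => h.regular t fun ht =>
    (hC t ht h1).not_ge h2
  rcases hqp.eq_or_lt with rfl | hlt
  · exact PushDown.refl f q
  by_cases hq : q ∈ C
  · obtain ⟨b₀, hb₀, hb⟩ := (h.upper q hq).exists_pushDown h.continuous hlt hreg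
    rcases le_total p b₀ with hp | hp
    · exact hb p hlt hp
    · exact PushDown.trans h.continuous hb₀.le hp (hb b₀ hb₀ le_rfl)
        (pushDown_of_chartPush h.continuous hp fun t ht => hreg t (hb₀.trans_le ht.1) ht.2)
  · refine pushDown_of_chartPush h.continuous hqp fun t ht => ?_
    rcases ht.1.eq_or_lt with rfl | h1
    · exact h.regular _ hq
    · exact hreg t h1 ht.2

lemma ChartPush.neg {f : X → ℝ} {t : ℝ} (h : ChartPush f t) :
    ChartPush (fun x => -f x) (-t) := by
  obtain ⟨ε, hε, h⟩ := h
  have hset : (fun x => -f x) ⁻¹' Ioo (-t - ε) (-t + ε) = f ⁻¹' Ioo (t - ε) (t + ε) := by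
    ext x
    simp only [mem_preimage, mem_Ioo]
    constructor <;> rintro ⟨h1, h2⟩ <;> constructor <;> linarith
  refine ⟨ε, hε, fun k hk hkI => ?_⟩
  obtain ⟨G, hG, hG'⟩ := h (fun y => -k (-y)) (by fun_prop) (by
    intro y hy
    have := hkI (x := -y) ⟨by linarith [hy.2], by linarith [hy.1]⟩
    exact ⟨by linarith [this.2], by linarith [this.1]⟩)
  rw [hset]
  refine ⟨G, hG, fun x hx => ?_⟩
  obtain ⟨g0, g1, gs⟩ := hG' x hx
  refine ⟨g0, (congrArg Neg.neg g1).trans (neg_neg _), fun s => ?_⟩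
  have := gs s
  rw [← neg_neg (k _), ← image_neg_uIcc]
  exact ⟨_, this, rfl⟩

lemma LocallyTame.neg {f : X → ℝ} {C : Set ℝ} (h : LocallyTame f C) :
    LocallyTame (fun x => -f x) (Neg.neg ⁻¹' C) where
  compact := h.compact
  continuous := h.continuous.neg
  finite := h.finite.preimage neg_injective.injOn
  regular t ht := by simpa using (h.regular (-t) ht).neg
  upper t ht := by simpa using h.lower (-t) ht
  lower t ht := by simpa using h.upper (-t) ht

end Pushing

/-! ### Homology of the preimages of intervals -/

section LevelHomology

open Set Filter Topology

variable {X : Type u} [TopologicalSpace X]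

lemma upperRetract_of_isDeformationRetract {f : X → ℝ} {t ε : ℝ} (hε : 0 < ε) {A S : Set X}
    (hA : A = f ⁻¹' {t}) (hS : S = f ⁻¹' Icc t (t + ε)) (h : IsDeformationRetract A S) :
    UpperRetract f t := by
  subst hA hS
  obtain ⟨-, H, h0, h1, hst⟩ := h
  obtain ⟨D, hD, hDe⟩ := exists_extension
    ((⟨Subtype.val, continuous_subtype_val⟩ : C(f ⁻¹' Icc t (t + ε), X)).comp H)
  refine ⟨ε, hε, D, hD, fun x hx => ⟨?_, ?_, fun hxt s => ?_, fun s => ?_⟩⟩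
  · rw [hDe 0 x hx]
    exact congrArg Subtype.val (h0 ⟨x, hx⟩)
  · rw [hDe 1 x hx]
    exact h1 ⟨x, hx⟩
  · rw [hDe s x hx]
    exact congrArg Subtype.val (hst s ⟨x, hx⟩ hxt)
  · rw [hDe s x hx]
    exact (H (s, ⟨x, hx⟩)).2

lemma IsTame.locallyTame {f : X → ℝ} {N : ℕ} {c : Fin (N + 1) → ℝ} (h : IsTame f c) :
    LocallyTame f (range c) where
  compact := h.compactANR.compact
  continuous := h.continuous
  finite := finite_range c
  regular t ht := by
    obtain ⟨ε, hε, he⟩ := h.regular t ht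
    exact chartPush_of_fiberwiseHomotopyEquivalent h.continuous hε he
  upper := by
    rintro _ ⟨i, rfl⟩
    obtain ⟨ε, hε, he, -⟩ := h.critical i
    exact upperRetract_of_isDeformationRetract hε rfl rfl he
  lower := by
    rintro _ ⟨i, rfl⟩
    obtain ⟨ε, hε, -, he⟩ := h.critical i
    refine upperRetract_of_isDeformationRetract hε ?_ ?_ he
    · ext x
      simp [neg_inj]
    · ext x
      simp only [mem_preimage, mem_Icc]
      constructor <;> rintro ⟨h1, h2⟩ <;> constructor <;> linarith

variable (κ : Type v) [Field κ] (r : ℕ)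

lemma setMap_bijective_of_eq {A B : Set X} (h : A = B) :
    Function.Bijective (setMap κ r h.subset) := by
  subst h
  rw [show ⇑(setMap κ r (subset_refl A)) = id from funext fun x => setMap_refl κ r x]
  exact Function.bijective_id

variable {f : X → ℝ} {C : Set ℝ} (hf : LocallyTame f C)
include hf

namespace LocallyTame

/-- Raising the upper end of an interval without meeting a critical value does not change the
homology. -/
lemma bijective_raise {A B : Set X} {a q p : ℝ} (hA : A = f ⁻¹' Icc a q) (hB : B = f ⁻¹' Icc a p)
    (haq : a ≤ q) (hqp : q ≤ p) (hC : ∀ t ∈ C, q < t → p < t) (h : A ⊆ B) :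
    Function.Bijective (setMap κ r h) := by
  subst hA hB
  obtain ⟨K, hK, hK'⟩ := hf.pushDown hqp hC
  have key : ∀ s x, a ≤ f x → f x ≤ p → a ≤ f (K (s, x)) := by
    intro s x h1 h2
    obtain ⟨-, -, -, kl, kg⟩ := hK' x h2
    rcases le_total (f x) q with h' | h'
    · rwa [kl h']
    · exact haq.trans (kg h' s)
  refine setMap_bijective_of_homotopy κ r h K (hK.mono fun z hz => ⟨trivial, hz.2.2⟩)
    (fun x hx => (hK' x hx.2).1) (fun s x hx => ⟨key s x hx.1 hx.2, (hK' x hx.2).2.2.1 s⟩)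
    (fun s x hx => ⟨key s x hx.1 (h hx).2, ?_⟩) (fun x hx => ⟨key 1 x hx.1 hx.2, ?_⟩)
  · rw [(hK' x (h hx).2).2.2.2.1 hx.2 s]
    exact hx.2
  · exact (hK' x hx.2).2.1

/-- Lowering the lower end of an interval without meeting a critical value does not change the
homology. -/
lemma bijective_lower {A B : Set X} {q p b : ℝ} (hA : A = f ⁻¹' Icc p b) (hB : B = f ⁻¹' Icc q b)
    (hpb : p ≤ b) (hqp : q ≤ p) (hC : ∀ t ∈ C, t < p → t < q) (h : A ⊆ B) :
    Function.Bijective (setMap κ r h) := by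
  refine hf.neg.bijective_raise κ r (a := -b) (q := -p) (p := -q) ?_ ?_ (by linarith) (by linarith)
    (fun t ht h1 => by linarith [hC (-t) ht (by linarith)]) h
  · rw [hA]
    ext x
    simp [and_comm]
  · rw [hB]
    ext x
    simp [and_comm]

/-- The level at the lower end of an interval without further critical values carries its
homology. -/
lemma bijective_bottom {A B : Set X} {q p : ℝ} (hA : A = f ⁻¹' {q}) (hB : B = f ⁻¹' Icc q p)
    (hqp : q ≤ p) (hC : ∀ t ∈ C, q < t → p < t) (h : A ⊆ B) :
    Function.Bijective (setMap κ r h) :=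
  hf.bijective_raise κ r (by rw [hA, Icc_self]) hB le_rfl hqp hC h

/-- The level at the upper end of an interval without further critical values carries its
homology. -/
lemma bijective_top {A B : Set X} {q p : ℝ} (hA : A = f ⁻¹' {p}) (hB : B = f ⁻¹' Icc q p)
    (hqp : q ≤ p) (hC : ∀ t ∈ C, t < p → t < q) (h : A ⊆ B) :
    Function.Bijective (setMap κ r h) :=
  hf.bijective_lower κ r (by rw [hA, Icc_self]) hB le_rfl hqp hC h

omit hf in
lemma _root_.LevelPersistence.exists_lt_of_finite (hC : C.Finite) {a b : ℝ} (hab : a < b) :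
    ∃ q, a < q ∧ q < b ∧ ∀ t ∈ C, t < b → t < q := by
  have h1 : ∀ᶠ q in 𝓝[<] b, ∀ t ∈ C, t < b → t < q := by
    refine (eventually_all_finite hC).2 fun t _ => ?_
    by_cases h : t < b
    · filter_upwards [Ioo_mem_nhdsLT h] with q hq _ using hq.1
    · exact Eventually.of_forall fun q h' => absurd h' h
  obtain ⟨q, h2, h3⟩ := (h1.and (Ioo_mem_nhdsLT hab)).exists
  exact ⟨q, h3.1, h3.2, h2⟩

omit hf in
lemma _root_.LevelPersistence.exists_gt_of_finite (hC : C.Finite) {a b : ℝ} (hab : a < b) :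
    ∃ p, a < p ∧ p < b ∧ ∀ t ∈ C, a < t → p < t := by
  have h1 : ∀ᶠ p in 𝓝[>] a, ∀ t ∈ C, a < t → p < t := by
    refine (eventually_all_finite hC).2 fun t _ => ?_
    by_cases h : a < t
    · filter_upwards [Ioo_mem_nhdsGT h] with q hq _ using hq.2
    · exact Eventually.of_forall fun q h' => absurd h' h
  obtain ⟨q, h2, h3⟩ := (h1.and (Ioo_mem_nhdsGT hab)).exists
  exact ⟨q, h3.1, h3.2, h2⟩

/-- A level carries the homology of a thin slab around it. -/
lemma bijective_slab {A B : Set X} {q t p : ℝ} (hA : A = f ⁻¹' {t}) (hB : B = f ⁻¹' Icc q p)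
    (hqt : q ≤ t) (htp : t ≤ p) (hq : ∀ s ∈ C, s < t → s < q) (hp : ∀ s ∈ C, t < s → p < s)
    (h : A ⊆ B) : Function.Bijective (setMap κ r h) := by
  have h1 : A ⊆ f ⁻¹' Icc t p := by
    rw [hA]
    exact preimage_mono (singleton_subset_iff.2 ⟨le_rfl, htp⟩)
  have h2 : f ⁻¹' Icc t p ⊆ B := by
    rw [hB]
    exact preimage_mono (Icc_subset_Icc_left hqt)
  have := (hf.bijective_lower κ r rfl hB htp hqt hq h2).comp
    (hf.bijective_bottom κ r hA rfl htp hp h1)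
  rwa [show setMap κ r h2 ∘ setMap κ r h1 = setMap κ r h from
    funext fun x => setMap_setMap κ r h1 h2 x] at this

/-- The homology of each level is finite-dimensional: it is detected in an open neighbourhood. -/
lemma finite_level (hX : IsCompactANR X) (t : ℝ) :
    Module.Finite κ (setHomology κ r (f ⁻¹' {t})) := by
  obtain ⟨q, -, hqt, hq⟩ := exists_lt_of_finite hf.finite (sub_one_lt t)
  obtain ⟨p, htp, -, hp⟩ := exists_gt_of_finite hf.finite (lt_add_one t)
  have h1 : f ⁻¹' {t} ⊆ f ⁻¹' Ioo q p := preimage_mono (singleton_subset_iff.2 ⟨hqt, htp⟩)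
  have h2 : f ⁻¹' Ioo q p ⊆ f ⁻¹' Icc q p := preimage_mono Ioo_subset_Icc_self
  refine finite_setHomology_of_injective κ r hX (isClosed_singleton.preimage hf.continuous)
    (isOpen_Ioo.preimage hf.continuous) h1 fun x y hxy => ?_
  refine (hf.bijective_slab κ r rfl rfl hqt.le htp.le hq hp (h1.trans h2)).1 ?_
  rw [← setMap_setMap κ r h1 h2, ← setMap_setMap κ r h1 h2, hxy]

/-- The Mayer-Vietoris property of two adjacent intervals: classes that agree on the union come
from the common level. -/
lemma exact_at {a b c : ℝ} (hab : a ≤ b) (hbc : b ≤ c)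
    (hL : f ⁻¹' {b} ⊆ f ⁻¹' Icc a b) (hR : f ⁻¹' {b} ⊆ f ⁻¹' Icc b c)
    (hLS : f ⁻¹' Icc a b ⊆ f ⁻¹' Icc a c) (hRS : f ⁻¹' Icc b c ⊆ f ⁻¹' Icc a c)
    (α : setHomology κ r (f ⁻¹' Icc a b)) (β : setHomology κ r (f ⁻¹' Icc b c))
    (h : setMap κ r hLS α = setMap κ r hRS β) :
    ∃ z, setMap κ r hL z = α ∧ setMap κ r hR z = β := by
  rcases hab.eq_or_lt with rfl | hab'
  · obtain ⟨z, rfl⟩ := (setMap_bijective_of_eq κ r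
      (show f ⁻¹' {a} = f ⁻¹' Icc a a by rw [Icc_self])).2 α
    refine ⟨z, rfl, ?_⟩
    rw [setMap_setMap] at h
    rw [h]
    exact setMap_refl κ r β
  rcases hbc.eq_or_lt with rfl | hbc'
  · obtain ⟨z, rfl⟩ := (setMap_bijective_of_eq κ r
      (show f ⁻¹' {b} = f ⁻¹' Icc b b by rw [Icc_self])).2 β
    refine ⟨z, ?_, rfl⟩
    rw [setMap_setMap] at h
    rw [← h]
    exact setMap_refl κ r α
  obtain ⟨q, haq, hqb, hq⟩ := exists_lt_of_finite hf.finite hab'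
  obtain ⟨p, hbp, hpc, hp⟩ := exists_gt_of_finite hf.finite hbc'
  have mono : ∀ {S T : Set ℝ}, S ⊆ T → f ⁻¹' S ⊆ f ⁻¹' T := fun h => preimage_mono h
  have iA : Icc a b ⊆ Ico a p := fun x hx => ⟨hx.1, hx.2.trans_lt hbp⟩
  have iB : Icc b c ⊆ Ioc q c := fun x hx => ⟨hqb.trans_le hx.1, hx.2⟩
  have jA : Ico a p ⊆ Icc a c := fun x hx => ⟨hx.1, (hx.2.trans hpc).le⟩
  have jB : Ioc q c ⊆ Icc a c := fun x hx => ⟨(haq.trans hx.1).le, hx.2⟩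
  obtain ⟨γ, hγA, hγB⟩ := mayerVietoris_exact κ r (S := f ⁻¹' Icc a c) (A := f ⁻¹' Ico a p)
    (B := f ⁻¹' Ioc q c) (isOpen_Iio.preimage hf.continuous : IsOpen (f ⁻¹' Iio p))
    (isOpen_Ioi.preimage hf.continuous : IsOpen (f ⁻¹' Ioi q))
    (fun x _ => by
      rcases lt_or_ge (f x) p with h | h
      · exact Or.inl h
      · exact Or.inr ((hqb.trans hbp).trans_le h))
    (by
      ext x
      exact ⟨fun h => ⟨jA h, h.2⟩, fun h => ⟨h.1.1, h.2⟩⟩)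
    (by
      ext x
      exact ⟨fun h => ⟨jB h, h.1⟩, fun h => ⟨h.2, h.1.2⟩⟩)
    (mono jA) (mono jB) (setMap κ r (mono iA) α) (setMap κ r (mono iB) β)
    (by rw [setMap_setMap, setMap_setMap, h])
  have hthin : f ⁻¹' Ico a p ∩ f ⁻¹' Ioc q c ⊆ f ⁻¹' Icc q p :=
    fun x hx => ⟨hx.2.1.le, hx.1.2.le⟩
  have hlev : f ⁻¹' {b} ⊆ f ⁻¹' Icc q p := mono (singleton_subset_iff.2 ⟨hqb.le, hbp.le⟩)
  obtain ⟨z, hz⟩ := (hf.bijective_slab κ r rfl rfl hqb.le hbp.le hq hp hlev).2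
    (setMap κ r hthin γ)
  have ap : f ⁻¹' Icc q p ⊆ f ⁻¹' Icc a p := mono (Icc_subset_Icc_left haq.le)
  have qc : f ⁻¹' Icc q p ⊆ f ⁻¹' Icc q c := mono (Icc_subset_Icc_right hpc.le)
  refine ⟨z, ?_, ?_⟩
  · refine (hf.bijective_raise κ r rfl rfl hab hbp.le hp
      (mono (Icc_subset_Icc_right hbp.le))).1 ?_
    have h1 := congrArg (setMap κ r (mono Ico_subset_Icc_self)) hγA
    have h2 := congrArg (setMap κ r ap) hz
    rw [setMap_setMap, setMap_setMap] at h1 h2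
    rw [setMap_setMap, h2, h1]
  · refine (hf.bijective_lower κ r rfl rfl hbc hqb.le hq
      (mono (Icc_subset_Icc_left hqb.le))).1 ?_
    have h1 := congrArg (setMap κ r (mono Ioc_subset_Icc_self)) hγB
    have h2 := congrArg (setMap κ r qc) hz
    rw [setMap_setMap, setMap_setMap] at h1 h2
    rw [setMap_setMap, h2, h1]

end LocallyTame

end LevelHomology

/-! ### Unitriangular changes of basis -/

section Unitriangular

open Submodule

variable {κ : Type*} [Field κ] {W : Type*} [AddCommGroup W] [Module κ W] {σ : Type*}

/-- The family `e'` arises from `e` by adding to each member a combination of members of smaller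
rank. -/
def Unitriangular (κ : Type*) [Field κ] {W : Type*} [AddCommGroup W] [Module κ W] {σ : Type*}
    (ρ : σ → ℕ) (e e' : σ → W) : Prop :=
  ∀ i, e' i - e i ∈ span κ (e '' {j | ρ j < ρ i})

lemma span_image_le_of_unitriangular {ρ : σ → ℕ} {e e' : σ → W} {J : Set σ}
    (h : ∀ i ∈ J, e' i - e i ∈ span κ (e '' {j | j ∈ J ∧ ρ j < ρ i})) :
    span κ (e '' J) ≤ span κ (e' '' J) := by
  have key : ∀ k, ∀ i ∈ J, ρ i < k → e i ∈ span κ (e' '' J) := by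
    intro k
    induction k with
    | zero => exact fun i _ hi => absurd hi (Nat.not_lt_zero _)
    | succ k ih =>
      intro i hi hk
      have h1 : span κ (e '' {j | j ∈ J ∧ ρ j < ρ i}) ≤ span κ (e' '' J) := by
        rw [span_le]
        rintro _ ⟨j, ⟨hj, hji⟩, rfl⟩
        exact ih j hj (by omega)
      rw [← sub_sub_cancel (e' i) (e i)]
      exact sub_mem (subset_span ⟨i, hi, rfl⟩) (h1 (h i hi))
  rw [span_le]
  rintro _ ⟨i, hi, rfl⟩
  exact key _ i hi (Nat.lt_succ_self _)

lemma Unitriangular.top_le_span {ρ : σ → ℕ} {e e' : σ → W} (h : Unitriangular κ ρ e e')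
    (he : ⊤ ≤ span κ (Set.range e)) : ⊤ ≤ span κ (Set.range e') := by
  have := span_image_le_of_unitriangular (κ := κ) (ρ := ρ) (e := e) (e' := e') (J := Set.univ)
    fun i _ => by simpa using h i
  rw [Set.image_univ, Set.image_univ] at this
  exact he.trans this

lemma Unitriangular.trans {ρ : σ → ℕ} {e e' e'' : σ → W} (h : Unitriangular κ ρ e e')
    (h' : Unitriangular κ ρ e' e'') : Unitriangular κ ρ e e'' := by
  intro i
  rw [← sub_add_sub_cancel (e'' i) (e' i)]
  refine add_mem ?_ (h i)
  refine (span_le.2 ?_ : span κ (e' '' {j | ρ j < ρ i}) ≤ _) (h' i)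
  rintro _ ⟨j, hj, rfl⟩
  have hj' : ρ j < ρ i := hj
  rw [← sub_add_cancel (e' j) (e j)]
  exact add_mem (span_mono (Set.image_mono fun k hk => lt_trans (show ρ k < ρ j from hk) hj')
    (h j)) (subset_span ⟨j, hj, rfl⟩)

/-- Gaussian elimination: a unitriangular change of basis makes the basis adapted to two nested
subspaces. -/
lemma exists_unitriangular_adapted [Finite σ] {ρ : σ → ℕ} (hρ : Function.Injective ρ) {e : σ → W}
    (he : ⊤ ≤ span κ (Set.range e)) {K K' : Submodule κ W} (hK : K ≤ K') :
    ∃ e' : σ → W, Unitriangular κ ρ e e' ∧ K ≤ span κ (e' '' {j | e' j ∈ K}) ∧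
      K' ≤ span κ (e' '' {j | e' j ∈ K'}) := by
  classical
  -- the ranks which occur as leading terms of vectors in `L`
  let P : Submodule κ W → σ → Prop := fun L j =>
    ∃ v ∈ L, v - e j ∈ span κ (e '' {i | ρ i < ρ j})
  let e' : σ → W := fun j =>
    if h : P K j then h.choose else if h : P K' j then h.choose else e j
  have htri : Unitriangular κ ρ e e' := by
    intro j
    simp only [e']
    split_ifs with h h'
    · exact h.choose_spec.2
    · exact h'.choose_spec.2
    · simp
  have hPK : ∀ j, P K j → e' j ∈ K := fun j h => by
    simp only [e', dif_pos h]
    exact h.choose_spec.1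
  have hPK' : ∀ j, P K' j → e' j ∈ K' := fun j h => by
    by_cases h' : P K j
    · exact hK (hPK j h')
    · simp only [e', dif_neg h', dif_pos h]
      exact h.choose_spec.1
  have key : ∀ L : Submodule κ W, (∀ j, P L j → e' j ∈ L) →
      ∀ k, ∀ x ∈ L, x ∈ span κ (e '' {i | ρ i < k}) → x ∈ span κ (e' '' {j | e' j ∈ L}) := by
    intro L hL k
    induction k with
    | zero =>
      intro x _ hx
      have : x = 0 := by simpa using hx
      rw [this]
      exact zero_mem _
    | succ k ih =>
      intro x hxL hx
      by_cases hk : ∃ j, ρ j = k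
      · obtain ⟨j, rfl⟩ := hk
        have hset : {i | ρ i < ρ j + 1} = insert j {i | ρ i < ρ j} := by
          ext i
          simp only [Set.mem_ofPred_eq, Set.mem_insert_iff, ← hρ.eq_iff (a := i)]
          omega
        rw [hset, Set.image_insert_eq, mem_span_insert] at hx
        obtain ⟨a, y, hy, rfl⟩ := hx
        rcases eq_or_ne a 0 with rfl | ha
        · rw [zero_smul, zero_add] at hxL ⊢
          exact ih y hxL hy
        · have hP : P L j := by
            refine ⟨a⁻¹ • (a • e j + y), L.smul_mem _ hxL, ?_⟩
            rw [smul_add, inv_smul_smul₀ ha, add_sub_cancel_left]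
            exact smul_mem _ _ hy
          have h1 : a • e j + y - a • e' j ∈ span κ (e' '' {j | e' j ∈ L}) := by
            refine ih _ (L.sub_mem hxL (L.smul_mem _ (hL j hP))) ?_
            rw [show a • e j + y - a • e' j = y - a • (e' j - e j) by rw [smul_sub]; abel]
            exact sub_mem hy (smul_mem _ _ (htri j))
          rw [← sub_add_cancel (a • e j + y) (a • e' j)]
          exact add_mem h1 (smul_mem _ _ (subset_span ⟨j, hL j hP, rfl⟩))
      · refine ih x hxL ?_
        rwa [show {i | ρ i < k} = {i | ρ i < k + 1} from Set.ext fun i =>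
          ⟨fun h => Nat.lt_succ_of_lt h, fun h => lt_of_le_of_ne (Nat.le_of_lt_succ h)
            fun h' => hk ⟨i, h'⟩⟩]
  obtain ⟨k, hk⟩ := (Set.finite_range ρ).bddAbove
  have hall : ∀ x, x ∈ span κ (e '' {i | ρ i < k + 1}) := fun x => by
    have : {i | ρ i < k + 1} = Set.univ := Set.eq_univ_of_forall fun i =>
      Nat.lt_succ_of_le (hk ⟨i, rfl⟩)
    rw [this, Set.image_univ]
    exact he trivial
  exact ⟨e', htri, fun x hx => key K hPK _ x hx (hall x), fun x hx => key K' hPK' _ x hx (hall x)⟩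

end Unitriangular

/-! ### Decomposition of chains of linear relations -/

section Relations

open Submodule

variable {κ : Type v} [Field κ] {V : ℕ → Type w} [∀ m, AddCommGroup (V m)] [∀ m, Module κ (V m)]

/-- A decomposition into intervals of the part `0, …, n` of a chain of linear relations
`R m ⊆ V m × V (m + 1)`. The bar `b` lives at the places `first b, …, last b`. Its class is
`vec b m`, and `coord b m` reads off its coefficient; both vanish where the bar does not live.
Where the bar continues (or is absent) the classes are related and the coefficients of related
elements agree; where it starts or ends, at least one of these holds. -/
structure ChainDecomposition (R : ∀ m, Submodule κ (V m × V (m + 1))) (n : ℕ) where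
  ι : Type
  fintype : Fintype ι
  first : ι → ℕ
  last : ι → ℕ
  vec : ι → ∀ m, V m
  coord : ι → ∀ m, V m →ₗ[κ] κ
  first_le_last : ∀ b, first b ≤ last b
  last_le : ∀ b, last b ≤ n
  vec_eq_zero : ∀ b m, ¬(first b ≤ m ∧ m ≤ last b) → vec b m = 0
  coord_eq_zero : ∀ b m, ¬(first b ≤ m ∧ m ≤ last b) → coord b m = 0
  coord_self : ∀ b m, first b ≤ m → m ≤ last b → coord b m (vec b m) = 1
  coord_ne : ∀ b b' m, b ≠ b' → coord b m (vec b' m) = 0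
  sum_coord : ∀ m ≤ n, ∀ x, ∑ b, coord b m x • vec b m = x
  step : ∀ m < n, ∀ b,
    ((first b ≤ m ∧ m ≤ last b ↔ first b ≤ m + 1 ∧ m + 1 ≤ last b) →
      (vec b m, vec b (m + 1)) ∈ R m ∧ ∀ p ∈ R m, coord b m p.1 = coord b (m + 1) p.2) ∧
    ((vec b m, vec b (m + 1)) ∈ R m ∨ ∀ p ∈ R m, coord b m p.1 = coord b (m + 1) p.2)

namespace ChainDecomposition

variable {R : ∀ m, Submodule κ (V m × V (m + 1))} {n : ℕ}

/-- Continue a decomposition by one step. The basis `β` of `V (n + 1)` is distributed by `ψ` over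
the old bars that continue and the new bars `N`. -/
def extend (D : ChainDecomposition R n) {N σ : Type} [Fintype N] [Fintype σ]
    (β : Module.Basis σ κ (V (n + 1))) (ψ : σ → D.ι ⊕ N) (hψ : Function.Injective ψ)
    (hnew : ∀ a, Sum.inr a ∈ Set.range ψ) (hlast : ∀ s b, ψ s = Sum.inl b → D.last b = n)
    (hcont : ∀ s b, ψ s = Sum.inl b → (D.vec b n, β s) ∈ R n ∧
      ∀ p ∈ R n, D.coord b n p.1 = β.coord s p.2)
    (hend : ∀ b, D.last b = n → Sum.inl b ∉ Set.range ψ → (D.vec b n, 0) ∈ R n ∨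
      ∀ p ∈ R n, D.coord b n p.1 = 0)
    (hstart : ∀ s a, ψ s = Sum.inr a → (0, β s) ∈ R n ∨ ∀ p ∈ R n, 0 = β.coord s p.2) :
    ChainDecomposition R (n + 1) := by
  classical
  letI := D.fintype
  let last' : D.ι ⊕ N → ℕ := fun b => if b ∈ Set.range ψ then n + 1 else Sum.elim D.last 0 b
  let first' : D.ι ⊕ N → ℕ := Sum.elim D.first fun _ => n + 1
  let vec' : D.ι ⊕ N → ∀ m, V m := fun b => Function.update
    (fun m => Sum.elim (fun b => D.vec b m) 0 b) (n + 1) (Function.extend ψ β 0 b)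
  let coord' : D.ι ⊕ N → ∀ m, V m →ₗ[κ] κ := fun b => Function.update
    (fun m => Sum.elim (fun b => D.coord b m) 0 b) (n + 1) (Function.extend ψ β.coord 0 b)
  have vtop : ∀ b, vec' b (n + 1) = Function.extend ψ β 0 b := fun b => Function.update_self ..
  have ctop : ∀ b, coord' b (n + 1) = Function.extend ψ β.coord 0 b :=
    fun b => Function.update_self ..
  have vold : ∀ b m, m ≠ n + 1 → vec' b m = Sum.elim (fun b => D.vec b m) 0 b :=
    fun b m h => Function.update_of_ne h ..
  have cold : ∀ b m, m ≠ n + 1 → coord' b m = Sum.elim (fun b => D.coord b m) 0 b :=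
    fun b m h => Function.update_of_ne h ..
  have hlast_inl : ∀ b, Sum.inl b ∈ Set.range ψ → D.last b = n := by
    rintro b ⟨s, hs⟩
    exact hlast s b hs
  have hfirst' : ∀ b, first' b ≤ n + 1 := by
    rintro (b | a)
    · exact (D.first_le_last b).trans ((D.last_le b).trans (Nat.le_succ n))
    · exact le_rfl
  have hlast' : ∀ b, last' b ≤ n + 1 := by
    rintro (b | a) <;> simp only [last'] <;> split_ifs
    · exact le_rfl
    · exact (D.last_le b).trans (Nat.le_succ n)
    · exact le_rfl
    · exact Nat.zero_le _
  -- whether a bar lives at `m`, in terms of the given data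
  have alive_top : ∀ b, (first' b ≤ n + 1 ∧ n + 1 ≤ last' b) ↔ b ∈ Set.range ψ := by
    intro b
    constructor
    · rintro ⟨-, h⟩
      by_contra hb
      simp only [last', if_neg hb] at h
      rcases b with b | a
      · exact absurd (h.trans (D.last_le b)) (by omega)
      · exact hb (hnew a)
    · intro hb
      exact ⟨hfirst' b, by simp only [last', if_pos hb, le_refl]⟩
  have alive_old : ∀ b m, m ≤ n → ((first' (Sum.inl b) ≤ m ∧ m ≤ last' (Sum.inl b)) ↔
      (D.first b ≤ m ∧ m ≤ D.last b)) := by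
    intro b m hm
    simp only [first', last', Sum.elim_inl]
    split_ifs with hb
    · rw [hlast_inl b hb]
      omega
    · rfl
  have alive_new : ∀ a m, m ≤ n → ¬(first' (Sum.inr a) ≤ m ∧ m ≤ last' (Sum.inr a)) := by
    intro a m hm
    simp only [first', Sum.elim_inr]
    omega
  refine
  { ι := D.ι ⊕ N
    fintype := inferInstance
    first := first'
    last := last'
    vec := vec'
    coord := coord'
    first_le_last := ?_
    last_le := hlast'
    vec_eq_zero := ?_
    coord_eq_zero := ?_
    coord_self := ?_
    coord_ne := ?_
    sum_coord := ?_
    step := ?_ }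
  · rintro (b | a)
    · simp only [first', last', Sum.elim_inl]
      split_ifs
      · exact hfirst' (Sum.inl b)
      · exact D.first_le_last b
    · simp only [first', last', Sum.elim_inr, if_pos (hnew a), le_refl]
  · intro b m hm
    rcases eq_or_ne m (n + 1) with rfl | hmn
    · rw [vtop, Function.extend_apply' _ _ _ ((alive_top b).not.1 hm)]
      rfl
    · rw [vold b m hmn]
      rcases b with b | a
      · refine D.vec_eq_zero b m fun h => hm ?_
        exact (alive_old b m (h.2.trans (D.last_le b))).2 h
      · rfl
  · intro b m hm
    rcases eq_or_ne m (n + 1) with rfl | hmn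
    · rw [ctop, Function.extend_apply' _ _ _ ((alive_top b).not.1 hm)]
      rfl
    · rw [cold b m hmn]
      rcases b with b | a
      · refine D.coord_eq_zero b m fun h => hm ?_
        exact (alive_old b m (h.2.trans (D.last_le b))).2 h
      · rfl
  · intro b m h1 h2
    rcases eq_or_ne m (n + 1) with rfl | hmn
    · obtain ⟨s, rfl⟩ := (alive_top b).1 ⟨h1, h2⟩
      rw [vtop, ctop, hψ.extend_apply, hψ.extend_apply]
      simp
    · have hm : m ≤ n := by have := hlast' b; omega
      rw [vold b m hmn, cold b m hmn]
      rcases b with b | a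
      · have := (alive_old b m hm).1 ⟨h1, h2⟩
        exact D.coord_self b m this.1 this.2
      · exact absurd ⟨h1, h2⟩ (alive_new a m hm)
  · intro b b' m hbb
    rcases eq_or_ne m (n + 1) with rfl | hmn
    · rw [vtop, ctop]
      by_cases h : b ∈ Set.range ψ
      · by_cases h' : b' ∈ Set.range ψ
        · obtain ⟨s, rfl⟩ := h
          obtain ⟨s', rfl⟩ := h'
          rw [hψ.extend_apply, hψ.extend_apply, Module.Basis.coord_apply, Module.Basis.repr_self,
            Finsupp.single_eq_of_ne fun h => hbb (congrArg ψ h)]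
        · rw [Function.extend_apply' _ _ b' h']
          exact map_zero _
      · rw [Function.extend_apply' _ _ b h]
        rfl
    · rw [vold b' m hmn, cold b m hmn]
      rcases b with b | a
      · rcases b' with b' | a'
        · exact D.coord_ne b b' m fun h => hbb (congrArg _ h)
        · exact map_zero _
      · rfl
  · intro m hm x
    rcases eq_or_ne m (n + 1) with rfl | hmn
    · refine (Fintype.sum_of_injective ψ hψ (fun s => β.repr x s • β s) _ ?_ ?_).symm.trans
        (β.sum_repr x)
      · intro b hb
        rw [ctop, Function.extend_apply' _ _ b hb]
        exact zero_smul _ _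
      · intro s
        rw [vtop, ctop, hψ.extend_apply, hψ.extend_apply, Module.Basis.coord_apply]
    · simp only [vold _ m hmn, cold _ m hmn, Fintype.sum_sum_type, Sum.elim_inl, Sum.elim_inr]
      rw [D.sum_coord m (by omega) x]
      simp
  · intro m hm b
    rcases eq_or_ne m n with rfl | hmn
    · rw [alive_top, vtop, ctop, vold b m (by omega), cold b m (by omega)]
      rcases b with b | a
      · rw [alive_old b m le_rfl]
        simp only [Sum.elim_inl]
        by_cases hb : Sum.inl b ∈ Set.range ψ
        · obtain ⟨s, hs⟩ := hb
          have := hcont s b hs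
          rw [← hs, hψ.extend_apply, hψ.extend_apply]
          exact ⟨fun _ => this, Or.inl this.1⟩
        · rw [Function.extend_apply' _ _ _ hb, Function.extend_apply' _ _ _ hb]
          refine ⟨fun h => ?_, ?_⟩
          · have hd := h.not.2 hb
            rw [D.vec_eq_zero b m hd, D.coord_eq_zero b m hd]
            exact ⟨zero_mem _, fun _ _ => rfl⟩
          · by_cases hl : D.last b = m
            · exact hend b hl hb
            · left
              rw [D.vec_eq_zero b m (by have := D.last_le b; omega)]
              exact zero_mem _
      · obtain ⟨s, hs⟩ := hnew a
        simp only [alive_new a m le_rfl, false_iff, hnew a, not_true_eq_false, false_implies,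
          true_and, Sum.elim_inr]
        rw [← hs, hψ.extend_apply, hψ.extend_apply]
        exact hstart s a hs
    · rw [vold b m (by omega), cold b m (by omega), vold b (m + 1) (by omega),
        cold b (m + 1) (by omega)]
      rcases b with b | a
      · rw [alive_old b m (by omega), alive_old b (m + 1) (by omega)]
        exact D.step m (by omega) b
      · exact ⟨fun _ => ⟨zero_mem _, fun _ _ => rfl⟩, Or.inl (zero_mem _)⟩

end ChainDecomposition

end Relations

/-! ### Existence of the decomposition -/

section Relations

open Submodule

lemma Unitriangular.exists_basis {κ : Type*} [Field κ] {W : Type*} [AddCommGroup W] [Module κ W]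
    {σ : Type*} [Fintype σ] {ρ : σ → ℕ} (e : Module.Basis σ κ W) {e' : σ → W}
    (h : Unitriangular κ ρ e e') : ∃ b : Module.Basis σ κ W, ⇑b = e' :=
  ⟨basisOfTopLeSpanOfCardEqFinrank e' (h.top_le_span e.span_eq.ge)
    (Module.finrank_eq_card_basis e).symm, coe_basisOfTopLeSpanOfCardEqFinrank ..⟩

variable {κ : Type v} [Field κ] {V : ℕ → Type w} [∀ m, AddCommGroup (V m)] [∀ m, Module κ (V m)]
  {R : ∀ m, Submodule κ (V m × V (m + 1))} {n : ℕ}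

namespace ChainDecomposition

section Extend

variable (D : ChainDecomposition R n) {N σ : Type} [Fintype N] [Fintype σ]
    (β : Module.Basis σ κ (V (n + 1))) (ψ : σ → D.ι ⊕ N) (hψ : Function.Injective ψ)
    (hnew : ∀ a, Sum.inr a ∈ Set.range ψ) (hlast : ∀ s b, ψ s = Sum.inl b → D.last b = n)
    (hcont : ∀ s b, ψ s = Sum.inl b → (D.vec b n, β s) ∈ R n ∧
      ∀ p ∈ R n, D.coord b n p.1 = β.coord s p.2)
    (hend : ∀ b, D.last b = n → Sum.inl b ∉ Set.range ψ → (D.vec b n, 0) ∈ R n ∨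
      ∀ p ∈ R n, D.coord b n p.1 = 0)
    (hstart : ∀ s a, ψ s = Sum.inr a → (0, β s) ∈ R n ∨ ∀ p ∈ R n, 0 = β.coord s p.2)

lemma extend_last_apply (s : σ) :
    (D.extend β ψ hψ hnew hlast hcont hend hstart).last (ψ s) = n + 1 :=
  if_pos ⟨s, rfl⟩

lemma mem_range_of_extend_last {b : D.ι ⊕ N}
    (hb : (D.extend β ψ hψ hnew hlast hcont hend hstart).last b = n + 1) : b ∈ Set.range ψ := by
  by_contra h
  have h1 : (D.extend β ψ hψ hnew hlast hcont hend hstart).last b = Sum.elim D.last 0 b := if_neg h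
  rw [h1] at hb
  rcases b with b | a
  · have := D.last_le b
    simp only [Sum.elim_inl] at hb
    omega
  · exact h (hnew a)

lemma extend_vec_apply (s : σ) :
    (D.extend β ψ hψ hnew hlast hcont hend hstart).vec (ψ s) (n + 1) = β s := by
  change Function.update (β := V) (fun m => Sum.elim (fun b => D.vec b m) 0 (ψ s)) (n + 1)
    (Function.extend ψ β 0 (ψ s)) (n + 1) = β s
  rw [Function.update_self, hψ.extend_apply]

end Extend

/-- The part `0, …, n` of the chain can be decomposed in such a way that the bars living at `n`
have the classes `e` there, or any unitriangular modification of `e` prescribed in advance. -/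
def IsFlexible (R : ∀ m, Submodule κ (V m × V (m + 1))) {n : ℕ} {σ : Type} (ρ : σ → ℕ)
    (e : σ → V n) : Prop :=
  ∀ e' : σ → V n, Unitriangular κ ρ e e' → ∃ (D : ChainDecomposition R n) (φ : σ → D.ι),
    Function.Injective φ ∧ (∀ i, D.last (φ i) = n) ∧ (∀ i, D.vec (φ i) n = e' i) ∧
      ∀ b, D.last b = n → b ∈ Set.range φ

lemma exists_isFlexible_zero [Subsingleton (V 0)] :
    ∃ (σ : Type) (_ : Fintype σ) (ρ : σ → ℕ) (e : Module.Basis σ κ (V 0)),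
      Function.Injective ρ ∧ IsFlexible R ρ e := by
  refine ⟨Empty, inferInstance, Empty.elim, Module.Basis.empty _, fun i => i.elim, fun _ _ => ?_⟩
  refine ⟨{
    ι := Empty
    fintype := inferInstance
    first := Empty.elim
    last := Empty.elim
    vec := fun b => b.elim
    coord := fun b => b.elim
    first_le_last := fun b => b.elim
    last_le := fun b => b.elim
    vec_eq_zero := fun b => b.elim
    coord_eq_zero := fun b => b.elim
    coord_self := fun b => b.elim
    coord_ne := fun b => b.elim
    sum_coord := fun m hm x => ?_
    step := fun m hm => absurd hm (Nat.not_lt_zero m) }, Empty.elim, fun i => i.elim,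
    fun i => i.elim, fun i => i.elim, fun b => b.elim⟩
  obtain rfl : m = 0 := by omega
  exact Subsingleton.elim _ _

/-- In the induction step the given basis is first adapted to the kernel and the domain of the
relation. Bars in the kernel or outside the domain end, the others continue. The bars starting at
`n + 1` come from the indeterminacy of the relation, which gets the lowest ranks, and from a
complement of its range, which gets the highest ranks: then a unitriangular change at `n + 1` can
be followed back to `n`. -/
lemma exists_isFlexible_succ [Module.Finite κ (V (n + 1))] {σ : Type} [Fintype σ] {ρ : σ → ℕ}
    (hρ : Function.Injective ρ) (e : Module.Basis σ κ (V n)) (he : IsFlexible R ρ e) :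
    ∃ (σ' : Type) (_ : Fintype σ') (ρ' : σ' → ℕ) (e' : Module.Basis σ' κ (V (n + 1))),
      Function.Injective ρ' ∧ IsFlexible R ρ' e' := by
  classical
  let K : Submodule κ (V n) := (R n).comap (LinearMap.inl κ _ _)
  let Dm : Submodule κ (V n) := (R n).map (LinearMap.fst κ _ _)
  let Rg : Submodule κ (V (n + 1)) := (R n).map (LinearMap.snd κ _ _)
  let I : Submodule κ (V (n + 1)) := (R n).comap (LinearMap.inr κ _ _)
  have hKD : K ≤ Dm := fun x hx => ⟨(x, 0), hx, rfl⟩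
  obtain ⟨f₀, hef, hfK, hfD⟩ := exists_unitriangular_adapted hρ e.span_eq.ge hKD
  obtain ⟨f, rfl⟩ := hef.exists_basis
  let M : Type := {j // f j ∈ Dm ∧ f j ∉ K}
  have hy : ∀ j : M, ∃ y, (f j.1, y) ∈ R n := by
    rintro ⟨j, ⟨p, hp, hpj⟩, -⟩
    exact ⟨p.2, by rw [← hpj]; exact hp⟩
  choose y hy using hy
  obtain ⟨Q, hQ⟩ := Submodule.exists_isCompl Rg
  let A : Type := Fin (Module.finrank κ I)
  let B : Type := Fin (Module.finrank κ Q)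
  let z : Module.Basis A κ I := Module.finBasis κ I
  let w : Module.Basis B κ Q := Module.finBasis κ Q
  let g₀ : A ⊕ (M ⊕ B) → V (n + 1) :=
    Sum.elim (fun a => (z a : V (n + 1))) (Sum.elim y fun b => (w b : V (n + 1)))
  have hI_span : ∀ v ∈ I, v ∈ span κ (Set.range fun a => (z a : V (n + 1))) := by
    intro v hv
    have h1 : (⟨v, hv⟩ : I) ∈ span κ (Set.range z) := by rw [z.span_eq]; trivial
    have h2 := Submodule.mem_map_of_mem (f := I.subtype) h1
    rwa [Submodule.map_span, ← Set.range_comp] at h2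
  have hg_top : ⊤ ≤ span κ (Set.range g₀) := by
    have hIg : ∀ v ∈ I, v ∈ span κ (Set.range g₀) := fun v hv =>
      span_mono (by rintro _ ⟨a, rfl⟩; exact ⟨Sum.inl a, rfl⟩) (hI_span v hv)
    have h1 : Dm ≤ (R n ⊓ (span κ (Set.range g₀)).comap (LinearMap.snd κ _ _)).map
        (LinearMap.fst κ _ _) := by
      refine hfD.trans (span_le.2 ?_)
      rintro _ ⟨j, hj, rfl⟩
      by_cases hjK : f j ∈ K
      · exact ⟨(f j, 0), ⟨hjK, zero_mem (span κ (Set.range g₀))⟩, rfl⟩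
      · exact ⟨(f j, y ⟨j, hj, hjK⟩), ⟨hy ⟨j, hj, hjK⟩,
          subset_span ⟨Sum.inr (Sum.inl ⟨j, hj, hjK⟩), rfl⟩⟩, rfl⟩
    have h2 : Rg ≤ span κ (Set.range g₀) := by
      rintro _ ⟨⟨x, v⟩, hp, rfl⟩
      obtain ⟨⟨x', v'⟩, ⟨hp', hv'⟩, hx'⟩ := h1 ⟨(x, v), hp, rfl⟩
      obtain rfl : x' = x := hx'
      have h3 : v - v' ∈ I := by
        have := (R n).sub_mem hp hp'
        rw [Prod.mk_sub_mk, sub_self] at this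
        exact this
      change v ∈ _
      rw [← sub_add_cancel v v']
      exact add_mem (hIg _ h3) hv'
    have h3 : Q ≤ span κ (Set.range g₀) := by
      intro v hv
      have h1 : (⟨v, hv⟩ : Q) ∈ span κ (Set.range w) := by rw [w.span_eq]; trivial
      have h2 := Submodule.mem_map_of_mem (f := Q.subtype) h1
      rw [Submodule.map_span, ← Set.range_comp] at h2
      refine span_mono ?_ h2
      rintro _ ⟨b, rfl⟩
      exact ⟨Sum.inr (Sum.inr b), rfl⟩
    rw [← hQ.sup_eq_top]
    exact sup_le h2 h3
  have hcoordK : ∀ j, f j ∉ K → ∀ x ∈ K, f.coord j x = 0 := by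
    intro j hj x hx
    have : span κ (f '' {j | f j ∈ K}) ≤ LinearMap.ker (f.coord j) := by
      rw [span_le]
      rintro _ ⟨i, hi, rfl⟩
      have hij : i ≠ j := fun h => hj (h ▸ hi)
      simp [hij]
    exact this (hfK hx)
  have hg_ind : LinearIndependent κ g₀ := by
    rw [Fintype.linearIndependent_iff]
    intro a ha
    simp only [Fintype.sum_sum_type, g₀, Sum.elim_inl, Sum.elim_inr] at ha
    set s1 := ∑ i, a (Sum.inl i) • (z i : V (n + 1)) with hs1
    set s2 := ∑ j, a (Sum.inr (Sum.inl j)) • y j with hs2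
    set s3 := ∑ b, a (Sum.inr (Sum.inr b)) • (w b : V (n + 1)) with hs3
    have m1 : s1 ∈ I := sum_mem fun i _ => I.smul_mem _ (z i).2
    have m1' : s1 ∈ Rg := ⟨(0, s1), m1, rfl⟩
    have m2 : (∑ j : M, a (Sum.inr (Sum.inl j)) • f j.1, s2) ∈ R n := by
      have : (∑ j : M, a (Sum.inr (Sum.inl j)) • f j.1, s2) =
          ∑ j : M, a (Sum.inr (Sum.inl j)) • ((f j.1, y j) : V n × V (n + 1)) := by
        refine Prod.ext ?_ ?_
        · simp [Prod.fst_sum]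
        · simp [Prod.snd_sum, hs2]
      rw [this]
      exact sum_mem fun j _ => (R n).smul_mem _ (hy j)
    have m2' : s2 ∈ Rg := ⟨_, m2, rfl⟩
    have m3 : s3 ∈ Q := sum_mem fun i _ => Q.smul_mem _ (w i).2
    have e3 : s3 = 0 := by
      refine Submodule.disjoint_def.1 hQ.disjoint s3 ?_ m3
      rw [show s3 = -(s1 + s2) by rw [eq_neg_iff_add_eq_zero, ← ha]; abel]
      exact Rg.neg_mem (Rg.add_mem m1' m2')
    have e3' : ∀ b, a (Sum.inr (Sum.inr b)) = 0 := by
      refine Fintype.linearIndependent_iff.1 w.linearIndependent _ (Subtype.ext (Eq.trans ?_ e3))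
      simp [hs3]
    have mK : ∑ j : M, a (Sum.inr (Sum.inl j)) • f j.1 ∈ K := by
      have h1 : ((0 : V n), s2) ∈ R n := by
        rw [show s2 = -s1 by rw [eq_neg_iff_add_eq_zero, ← ha, e3]; abel]
        exact I.neg_mem m1
      have h2 := (R n).sub_mem m2 h1
      rw [Prod.mk_sub_mk, sub_self, sub_zero] at h2
      exact h2
    have e2' : ∀ j, a (Sum.inr (Sum.inl j)) = 0 := by
      intro j
      have h1 := hcoordK j.1 j.2.2 _ mK
      rw [map_sum, Finset.sum_eq_single j] at h1
      · simpa using h1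
      · intro i _ hij
        have : i.1 ≠ j.1 := fun h => hij (Subtype.ext h)
        simp [this]
      · exact fun h => absurd (Finset.mem_univ j) h
    have e2 : s2 = 0 := by
      rw [hs2]
      exact Finset.sum_eq_zero fun j _ => by rw [e2' j, zero_smul]
    have e1 : s1 = 0 := by rwa [e2, e3, add_zero, add_zero] at ha
    have e1' : ∀ b, a (Sum.inl b) = 0 := by
      refine Fintype.linearIndependent_iff.1 z.linearIndependent _ (Subtype.ext (Eq.trans ?_ e1))
      simp [hs1]
    rintro (i | j | b)
    exacts [e1' i, e2' j, e3' b]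
  let g : Module.Basis (A ⊕ (M ⊕ B)) κ (V (n + 1)) := Module.Basis.mk hg_ind hg_top
  have hg : ⇑g = g₀ := Module.Basis.coe_mk ..
  obtain ⟨s, hs⟩ := (Set.finite_range ρ).bddAbove
  have hs' : ∀ j, ρ j ≤ s := fun j => hs ⟨j, rfl⟩
  let ρ' : A ⊕ (M ⊕ B) → ℕ := Sum.elim (fun a => a.1) (Sum.elim
    (fun j => Module.finrank κ I + ρ j.1) fun b => Module.finrank κ I + s + 1 + b.1)
  refine ⟨A ⊕ (M ⊕ B), inferInstance, ρ', g, ?_, fun g' hg' => ?_⟩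
  · rintro (a | j | b) (a' | j' | b') h <;> simp only [ρ', Sum.elim_inl, Sum.elim_inr] at h
    · exact congrArg Sum.inl (Fin.ext h)
    · have := a.2
      omega
    · have := a.2
      omega
    · have := a'.2
      omega
    · exact congrArg (Sum.inr ∘ Sum.inl) (Subtype.ext (hρ (by omega)))
    · have := hs' j.1
      omega
    · have := a'.2
      omega
    · have := hs' j'.1
      omega
    · exact congrArg (Sum.inr ∘ Sum.inr) (Fin.ext (by omega))
  -- a linear section of the relation over the classes that do not start outside its range
  let L : V (n + 1) →ₗ[κ] V n :=
    g.constr κ (Sum.elim (fun _ => 0) (Sum.elim (fun j => f j.1) fun _ => 0))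
  have hLz : ∀ a, L (z a) = 0 := fun a => by
    have := g.constr_basis κ (Sum.elim (fun _ => 0) (Sum.elim (fun j : M => f j.1) fun _ => 0))
      (Sum.inl a)
    rwa [hg] at this
  have hLy : ∀ j, L (y j) = f j.1 := fun j => by
    have := g.constr_basis κ (Sum.elim (fun _ => 0) (Sum.elim (fun j : M => f j.1) fun _ => 0))
      (Sum.inr (Sum.inl j))
    rwa [hg] at this
  have hLR : ∀ k ≤ Module.finrank κ I + s + 1, ∀ v ∈ span κ (g '' {i | ρ' i < k}),
      (L v, v) ∈ R n := by
    intro k hk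
    have : span κ (g '' {i | ρ' i < k}) ≤ (R n).comap (L.prod LinearMap.id) := by
      rw [span_le]
      rintro _ ⟨a | j | b, hi, rfl⟩ <;> rw [hg]
      · change (L (z a), (z a : V (n + 1))) ∈ R n
        rw [hLz]
        exact (z a).2
      · change (L (y j), y j) ∈ R n
        rw [hLy]
        exact hy j
      · have : Module.finrank κ I + s + 1 + b.1 < k := hi
        omega
    exact this
  have hmem' : ∀ i, g' i ∈ span κ (g '' {j | ρ' j < ρ' i + 1}) := by
    intro i
    rw [← sub_add_cancel (g' i) (g i)]
    exact add_mem (span_mono (Set.image_mono fun j hj => Nat.lt_succ_of_lt hj) (hg' i))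
      (subset_span ⟨i, Nat.lt_succ_self _, rfl⟩)
  let f' : σ → V n := fun j => if h : f j ∈ Dm ∧ f j ∉ K then L (g' (Sum.inr (Sum.inl ⟨j, h⟩)))
    else f j
  have hf'M : ∀ j : M, f' j.1 = L (g' (Sum.inr (Sum.inl j))) := fun j => dif_pos j.2
  have hf'K : ∀ j, f j ∈ K → f' j = f j := fun j h => dif_neg fun h' => h'.2 h
  have hf'D : ∀ j, f j ∉ Dm → f' j = f j := fun j h => dif_neg fun h' => h h'.1
  have htri' : ∀ j, f' j - f j ∈ span κ (f '' {i | f i ∈ Dm ∧ ρ i < ρ j}) := by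
    intro j
    by_cases h : f j ∈ Dm ∧ f j ∉ K
    · rw [hf'M ⟨j, h⟩, ← hLy ⟨j, h⟩, ← map_sub]
      have h1 := hg' (Sum.inr (Sum.inl ⟨j, h⟩))
      rw [hg] at h1
      refine (span_le.2 ?_ : _ ≤ (span κ (f '' {i | f i ∈ Dm ∧ ρ i < ρ j})).comap L) h1
      rintro _ ⟨a | i | b, hi, rfl⟩
      · change L (z a) ∈ span κ (f '' {i | f i ∈ Dm ∧ ρ i < ρ j})
        rw [hLz]
        exact zero_mem _
      · change L (y i) ∈ span κ (f '' {i | f i ∈ Dm ∧ ρ i < ρ j})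
        rw [hLy]
        have hi' : Module.finrank κ I + ρ i.1 < Module.finrank κ I + ρ j := hi
        exact subset_span ⟨i.1, ⟨i.2.1, by omega⟩, rfl⟩
      · have hi' : Module.finrank κ I + s + 1 + b.1 < Module.finrank κ I + ρ j := hi
        have := hs' j
        omega
    · rw [show f' j = f j from dif_neg h, sub_self]
      exact zero_mem _
  have hff' : Unitriangular κ ρ f f' := fun j =>
    span_mono (Set.image_mono fun i hi => hi.2) (htri' j)
  obtain ⟨D, φ, hφ, hφl, hφv, hφr⟩ := he f' (hef.trans hff')
  have hcoordφ : ∀ i j, i ≠ j → D.coord (φ i) n (f' j) = 0 := fun i j h => by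
    rw [← hφv j]
    exact D.coord_ne _ _ n fun h' => h (hφ h')
  have hcoordφ' : ∀ i, D.coord (φ i) n (f' i) = 1 := fun i => by
    rw [← hφv i]
    exact D.coord_self _ n ((D.first_le_last _).trans (hφl i).le) (hφl i).ge
  obtain ⟨β, rfl⟩ := hg'.exists_basis
  have hLM : ∀ j : M, (f' j.1, β (Sum.inr (Sum.inl j))) ∈ R n := fun j => by
    rw [hf'M]
    refine hLR _ ?_ _ (hmem' _)
    have := hs' j.1
    change Module.finrank κ I + ρ j.1 + 1 ≤ _
    omega
  have hLA : ∀ a, ((0 : V n), β (Sum.inl a)) ∈ R n := fun a => by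
    have h1 : span κ (g '' {j | ρ' j < ρ' (Sum.inl a) + 1}) ≤ I := by
      rw [span_le]
      rintro _ ⟨a' | j | b, hi, rfl⟩ <;> rw [hg]
      · exact (z a').2
      · have hi' : Module.finrank κ I + ρ j.1 < a.1 + 1 := hi
        have := a.2
        omega
      · have hi' : Module.finrank κ I + s + 1 + b.1 < a.1 + 1 := hi
        have := a.2
        omega
    exact h1 (hmem' _)
  -- a pair of functionals that agrees on the obvious related pairs agrees on the whole relation
  have hR : ∀ (F : V n →ₗ[κ] κ) (G : V (n + 1) →ₗ[κ] κ), (∀ j, f j ∈ K → F (f' j) = 0) →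
      (∀ j : M, F (f' j.1) = G (β (Sum.inr (Sum.inl j)))) → (∀ a, G (β (Sum.inl a)) = 0) →
      ∀ p ∈ R n, F p.1 = G p.2 := by
    intro F G hF hFG hG
    let E : Submodule κ (V n × V (n + 1)) :=
      R n ⊓ LinearMap.ker (F ∘ₗ LinearMap.fst κ _ _ - G ∘ₗ LinearMap.snd κ _ _)
    have hE : ∀ x y, (x, y) ∈ R n → F x = G y → (x, y) ∈ E := fun x y h1 h2 =>
      ⟨h1, LinearMap.mem_ker.2 (sub_eq_zero.2 h2)⟩
    have hE' : ∀ x y, (x, y) ∈ E → F x = G y := by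
      rintro x y ⟨-, h⟩
      exact sub_eq_zero.1 (LinearMap.mem_ker.1 h)
    have hD : Dm ≤ E.map (LinearMap.fst κ _ _) := by
      refine hfD.trans ((span_image_le_of_unitriangular (ρ := ρ) (e' := f')
        fun j _ => htri' j).trans (span_le.2 ?_))
      rintro _ ⟨j, hj, rfl⟩
      by_cases hjK : f j ∈ K
      · refine ⟨(f' j, 0), hE _ _ ?_ ((hF j hjK).trans (map_zero G).symm), rfl⟩
        rw [hf'K j hjK]
        exact hjK
      · exact ⟨(f' j, β (Sum.inr (Sum.inl ⟨j, hj, hjK⟩))),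
          hE _ _ (hLM ⟨j, hj, hjK⟩) (hFG ⟨j, hj, hjK⟩), rfl⟩
    have hIG : ∀ v ∈ I, G v = 0 := by
      have h1 : span κ (g '' Set.range Sum.inl) ≤ span κ (β '' Set.range Sum.inl) := by
        refine span_image_le_of_unitriangular (ρ := ρ') ?_
        rintro _ ⟨a, rfl⟩
        refine span_mono (Set.image_mono ?_) (hg' (Sum.inl a))
        rintro (a' | j | b) hi
        · exact ⟨⟨a', rfl⟩, hi⟩
        · have hi' : Module.finrank κ I + ρ j.1 < a.1 := hi
          have := a.2
          omega
        · have hi' : Module.finrank κ I + s + 1 + b.1 < a.1 := hi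
          have := a.2
          omega
      have h2 : span κ (β '' Set.range Sum.inl) ≤ LinearMap.ker G := by
        rw [span_le]
        rintro _ ⟨_, ⟨a, rfl⟩, rfl⟩
        exact hG a
      intro v hv
      refine h2 (h1 ?_)
      rw [hg, ← Set.range_comp]
      exact hI_span v hv
    rintro ⟨x, v⟩ hp
    obtain ⟨⟨x', v'⟩, hp', hx'⟩ := hD ⟨(x, v), hp, rfl⟩
    obtain rfl : x' = x := hx'
    have h3 : v - v' ∈ I := by
      have := (R n).sub_mem hp hp'.1
      rw [Prod.mk_sub_mk, sub_self] at this
      exact this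
    have h4 := hIG _ h3
    rw [map_sub, sub_eq_zero] at h4
    exact (hE' _ _ hp').trans h4.symm
  let ψ : A ⊕ (M ⊕ B) → D.ι ⊕ (A ⊕ B) := Sum.elim (fun a => Sum.inr (Sum.inl a))
    (Sum.elim (fun j => Sum.inl (φ j.1)) fun b => Sum.inr (Sum.inr b))
  have hψ : Function.Injective ψ := by
    rintro (a | j | b) (a' | j' | b') h <;>
      simp only [ψ, Sum.elim_inl, Sum.elim_inr, Sum.inr.injEq, Sum.inl.injEq, reduceCtorEq] at h
    · exact congrArg Sum.inl h
    · exact congrArg (Sum.inr ∘ Sum.inl) (Subtype.ext (hφ h))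
    · exact congrArg (Sum.inr ∘ Sum.inr) h
  have hψl : ∀ i b, ψ i = Sum.inl b → ∃ j : M, i = Sum.inr (Sum.inl j) ∧ b = φ j.1 := by
    rintro (a | j | b') b h <;> simp only [ψ, Sum.elim_inl, Sum.elim_inr, Sum.inl.injEq,
      reduceCtorEq] at h
    exact ⟨j, rfl, h.symm⟩
  have hKM : ∀ (j : M) i, f i ∈ K → j.1 ≠ i := fun j i hi h => j.2.2 (h ▸ hi)
  have hββ : ∀ i i', i ≠ i' → β.coord i (β i') = 0 := fun i i' h => by
    rw [Module.Basis.coord_apply, Module.Basis.repr_self, Finsupp.single_eq_of_ne h]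
  have hββ' : ∀ i, β.coord i (β i) = 1 := fun i => by simp
  refine ⟨D.extend β ψ hψ ?_ ?_ ?_ ?_ ?_, ψ, hψ,
    fun i => extend_last_apply D β ψ _ _ _ _ _ _ i, fun i => extend_vec_apply D β ψ _ _ _ _ _ _ i,
    fun b hb => mem_range_of_extend_last D β ψ _ _ _ _ _ _ hb⟩
  · rintro (a | b)
    exacts [⟨Sum.inl a, rfl⟩, ⟨Sum.inr (Sum.inr b), rfl⟩]
  · intro i b h
    obtain ⟨j, rfl, rfl⟩ := hψl i b h
    exact hφl j.1
  · intro i b h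
    obtain ⟨j, rfl, rfl⟩ := hψl i b h
    rw [hφv]
    refine ⟨hLM j, hR _ _ (fun i hi => hcoordφ _ _ (hKM j i hi)) (fun i => ?_) fun a =>
      hββ _ _ (by simp)⟩
    rcases eq_or_ne j i with rfl | hij
    · rw [hcoordφ', hββ']
    · rw [hcoordφ _ _ fun h => hij (Subtype.ext h),
        hββ _ _ fun h => hij (Sum.inl_injective (Sum.inr_injective h))]
  · intro b hb hbψ
    obtain ⟨j, rfl⟩ := hφr b hb
    by_cases hjK : f j ∈ K
    · left
      rw [hφv, hf'K j hjK]
      exact hjK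
    · right
      have hjD : f j ∉ Dm := fun h => hbψ ⟨Sum.inr (Sum.inl ⟨j, h, hjK⟩), rfl⟩
      exact hR _ 0 (fun i hi => hcoordφ _ _ fun h => hjK (h ▸ hi))
        (fun i => hcoordφ _ _ fun h => hjD (h ▸ i.2.1)) fun _ => rfl
  · rintro (a | j | b) c h
    · exact Or.inl (hLA a)
    · simp [ψ] at h
    · exact Or.inr (hR 0 _ (fun _ _ => rfl) (fun j => (hββ _ _ (by simp)).symm)
        fun a => hββ _ _ (by simp))

/-- A chain of linear relations between finite-dimensional spaces decomposes into intervals. -/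
theorem nonempty [Subsingleton (V 0)] [∀ m, Module.Finite κ (V m)]
    (R : ∀ m, Submodule κ (V m × V (m + 1))) (n : ℕ) : Nonempty (ChainDecomposition R n) := by
  have key : ∀ n, ∃ (σ : Type) (_ : Fintype σ) (ρ : σ → ℕ) (e : Module.Basis σ κ (V n)),
      Function.Injective ρ ∧ IsFlexible R ρ e := by
    intro n
    induction n with
    | zero => exact exists_isFlexible_zero
    | succ n ih =>
      obtain ⟨σ, _, ρ, e, hρ, he⟩ := ih
      exact exists_isFlexible_succ hρ e he
  obtain ⟨σ, _, ρ, e, -, he⟩ := key n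
  obtain ⟨D, -⟩ := he e fun i => by simp
  exact ⟨D⟩

end ChainDecomposition

end Relations

/-! ### The relations between the homology of two levels -/

section LevelRelation

open Set

variable (κ : Type v) [Field κ] (r : ℕ) {X : Type u} [TopologicalSpace X] (f : X → ℝ)

/-- A class of the level `t` and a class of the level `t'` are related if they agree in
`f ⁻¹ [t, t']`. -/
def levelRel (t t' : ℝ) : Submodule κ (levelHomology κ r f t × levelHomology κ r f t') :=
  LinearMap.ker (fromLeft κ r f t t' ∘ₗ LinearMap.fst κ _ _ -
    fromRight κ r f t t' ∘ₗ LinearMap.snd κ _ _)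

variable {κ r f}

lemma mem_levelRel {t t' : ℝ} {x : levelHomology κ r f t} {y : levelHomology κ r f t'} :
    (x, y) ∈ levelRel κ r f t t' ↔ fromLeft κ r f t t' x = fromRight κ r f t t' y :=
  LinearMap.mem_ker.trans sub_eq_zero

lemma levelRel_refl {t : ℝ} (x : levelHomology κ r f t) : (x, x) ∈ levelRel κ r f t t :=
  mem_levelRel.2 rfl

variable {C : Set ℝ} (hf : LocallyTame f C)
include hf

namespace LocallyTame

/-- `exact_at` with the intervals given up to equality, as unordered intervals `uIcc` occur in
`fromLeft` and `fromRight`. -/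
lemma exact_at_of_eq {a b c : ℝ} (hab : a ≤ b) (hbc : b ≤ c) {P Q S : Set ℝ} (hP : P = Icc a b)
    (hQ : Q = Icc b c) (hS : S = Icc a c) (hL : f ⁻¹' {b} ⊆ f ⁻¹' P) (hR : f ⁻¹' {b} ⊆ f ⁻¹' Q)
    (hLS : f ⁻¹' P ⊆ f ⁻¹' S) (hRS : f ⁻¹' Q ⊆ f ⁻¹' S)
    (α : setHomology κ r (f ⁻¹' P)) (β : setHomology κ r (f ⁻¹' Q))
    (h : setMap κ r hLS α = setMap κ r hRS β) :
    ∃ z, setMap κ r hL z = α ∧ setMap κ r hR z = β := by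
  subst hP hQ hS
  exact hf.exact_at κ r hab hbc hL hR hLS hRS α β h

/-- The relations compose: this is the exactness of the Mayer–Vietoris sequence of the decomposition
of `[t, t']` at `s`. -/
lemma mem_levelRel_comp {t s t' : ℝ} (h : t ≤ s) (h' : s ≤ t') {x : levelHomology κ r f t}
    {z : levelHomology κ r f t'} :
    (x, z) ∈ levelRel κ r f t t' ↔
      ∃ y, (x, y) ∈ levelRel κ r f t s ∧ (y, z) ∈ levelRel κ r f s t' := by
  have m1 : f ⁻¹' uIcc t s ⊆ f ⁻¹' uIcc t t' := by
    rw [uIcc_of_le h, uIcc_of_le (h.trans h')]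
    exact preimage_mono (Icc_subset_Icc_right h')
  have m2 : f ⁻¹' uIcc s t' ⊆ f ⁻¹' uIcc t t' := by
    rw [uIcc_of_le h', uIcc_of_le (h.trans h')]
    exact preimage_mono (Icc_subset_Icc_left h)
  have l1 : f ⁻¹' {t} ⊆ f ⁻¹' uIcc t s := preimage_mono (singleton_subset_iff.2 left_mem_uIcc)
  have l2 : f ⁻¹' {s} ⊆ f ⁻¹' uIcc t s := preimage_mono (singleton_subset_iff.2 right_mem_uIcc)
  have l3 : f ⁻¹' {s} ⊆ f ⁻¹' uIcc s t' := preimage_mono (singleton_subset_iff.2 left_mem_uIcc)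
  have l4 : f ⁻¹' {t'} ⊆ f ⁻¹' uIcc s t' := preimage_mono (singleton_subset_iff.2 right_mem_uIcc)
  rw [mem_levelRel]
  change setMap κ r (l1.trans m1) x = setMap κ r (l4.trans m2) z ↔ _
  rw [← setMap_setMap κ r l1 m1, ← setMap_setMap κ r l4 m2]
  constructor
  · intro hxz
    obtain ⟨y, hy1, hy2⟩ := hf.exact_at_of_eq h h' (uIcc_of_le h) (uIcc_of_le h')
      (uIcc_of_le (h.trans h')) l2 l3 m1 m2 _ _ hxz
    exact ⟨y, mem_levelRel.2 hy1.symm, mem_levelRel.2 hy2⟩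
  · rintro ⟨y, h1, h2⟩
    have h1' : setMap κ r l1 x = setMap κ r l2 y := mem_levelRel.1 h1
    have h2' : setMap κ r l3 y = setMap κ r l4 z := mem_levelRel.1 h2
    rw [h1', ← h2', setMap_setMap, setMap_setMap]

lemma fromLeft_bijective {t t' : ℝ} (h : t ≤ t') (hC : ∀ s ∈ C, t < s → t' < s) :
    Function.Bijective (fromLeft κ r f t t') :=
  hf.bijective_bottom κ r rfl (by rw [uIcc_of_le h]) h hC _

lemma fromRight_bijective {t t' : ℝ} (h : t ≤ t') (hC : ∀ s ∈ C, s < t' → s < t) :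
    Function.Bijective (fromRight κ r f t t') :=
  hf.bijective_top κ r rfl (by rw [uIcc_of_le h]) h hC _

lemma eq_of_mem_levelRel_self {t : ℝ} {x y : levelHomology κ r f t}
    (h : (x, y) ∈ levelRel κ r f t t) : x = y :=
  (hf.fromLeft_bijective le_rfl fun _ _ => id).1 (mem_levelRel.1 h)

end LocallyTame

end LevelRelation

/-! ### The position of a level among the critical values -/

section Position

variable {N : ℕ} {c : Fin (N + 1) → ℝ}

/-- The position of `t` relative to the critical values: `2 k + 1` at the critical value `c k`,
and an even number between, below and above the critical values. -/
def position (c : Fin (N + 1) → ℝ) (t : ℝ) : ℕ :=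
  (Finset.univ.filter fun k => c k < t).card + (Finset.univ.filter fun k => c k ≤ t).card

lemma card_filter_lt_iff {p : Fin (N + 1) → Prop} [DecidablePred p]
    (hp : ∀ j k, j ≤ k → p k → p j) (k : Fin (N + 1)) :
    (k : ℕ) < (Finset.univ.filter p).card ↔ p k := by
  constructor
  · intro h
    by_contra hk
    have : Finset.univ.filter p ⊆ Finset.Iio k := by
      intro j hj
      rw [Finset.mem_filter] at hj
      rw [Finset.mem_Iio]
      by_contra hjk
      exact hk (hp k j (not_lt.1 hjk) hj.2)
    have := Finset.card_le_card this
    rw [Fin.card_Iio] at this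
    omega
  · intro h
    have : Finset.Iic k ⊆ Finset.univ.filter p := by
      intro j hj
      rw [Finset.mem_filter]
      exact ⟨Finset.mem_univ j, hp j k (Finset.mem_Iic.1 hj) h⟩
    have := Finset.card_le_card this
    rw [Fin.card_Iic] at this
    omega

lemma position_mono (c : Fin (N + 1) → ℝ) : Monotone (position c) := fun _ _ h =>
  add_le_add
    (Finset.card_le_card (Finset.monotone_filter_right _ fun _ _ hk => lt_of_lt_of_le hk h))
    (Finset.card_le_card (Finset.monotone_filter_right _ fun _ _ hk => le_trans hk h))

lemma position_le (c : Fin (N + 1) → ℝ) (t : ℝ) : position c t ≤ 2 * N + 2 := by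
  have h1 := Finset.card_filter_le Finset.univ fun k => c k < t
  have h2 := Finset.card_filter_le Finset.univ fun k => c k ≤ t
  rw [Finset.card_fin] at h1 h2
  unfold position
  omega

variable (hc : StrictMono c)
include hc

lemma position_aux (t : ℝ) :
    (Finset.univ.filter fun k => c k < t).card ≤ (Finset.univ.filter fun k => c k ≤ t).card ∧
    (Finset.univ.filter fun k => c k ≤ t).card ≤
      (Finset.univ.filter fun k => c k < t).card + 1 := by
  classical
  refine ⟨Finset.card_le_card (Finset.monotone_filter_right _ fun _ _ h => le_of_lt h), ?_⟩
  have h1 : (Finset.univ.filter fun k => c k ≤ t) ⊆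
      (Finset.univ.filter fun k => c k < t) ∪ (Finset.univ.filter fun k => c k = t) := by
    intro k hk
    simpa [le_iff_lt_or_eq] using hk
  refine (Finset.card_le_card h1).trans ((Finset.card_union_le _ _).trans ?_)
  gcongr
  rw [Finset.card_le_one]
  intro a ha b hb
  rw [Finset.mem_filter] at ha hb
  exact hc.injective (ha.2.trans hb.2.symm)

lemma lt_iff_position {k : Fin (N + 1)} {t : ℝ} : c k < t ↔ 2 * (k : ℕ) + 2 ≤ position c t := by
  have h := position_aux hc t
  rw [← card_filter_lt_iff (p := fun k => c k < t)
    (fun i j hij hj => (hc.monotone hij).trans_lt hj) k]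
  unfold position
  omega

lemma le_iff_position {k : Fin (N + 1)} {t : ℝ} : c k ≤ t ↔ 2 * (k : ℕ) + 1 ≤ position c t := by
  have h := position_aux hc t
  rw [← card_filter_lt_iff (p := fun k => c k ≤ t)
    (fun i j hij hj => (hc.monotone hij).trans hj) k]
  unfold position
  omega

lemma gt_iff_position {k : Fin (N + 1)} {t : ℝ} : t < c k ↔ position c t ≤ 2 * (k : ℕ) := by
  have := le_iff_position hc (k := k) (t := t)
  rw [← not_le, this]
  omega

lemma ge_iff_position {k : Fin (N + 1)} {t : ℝ} : t ≤ c k ↔ position c t ≤ 2 * (k : ℕ) + 1 := by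
  have := lt_iff_position hc (k := k) (t := t)
  rw [← not_lt, this]
  omega

lemma exists_position_eq {n : ℕ} (hn : n ≤ 2 * N + 2) : ∃ t, position c t = n := by
  rcases Nat.even_or_odd' n with ⟨k, rfl | rfl⟩
  · rcases k with _ | k
    · refine ⟨c 0 - 1, ?_⟩
      have := (gt_iff_position hc).1 (sub_one_lt (c 0))
      simpa using this
    · rcases Nat.lt_or_ge k N with hk | hk
      · have hlt : c ⟨k, by omega⟩ < c ⟨k + 1, by omega⟩ := hc (Fin.mk_lt_mk.2 (Nat.lt_succ_self k))
        obtain ⟨t, h1, h2⟩ := exists_between hlt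
        refine ⟨t, ?_⟩
        have h3 := (lt_iff_position hc).1 h1
        have h4 := (gt_iff_position hc).1 h2
        simp only at h3 h4
        omega
      · refine ⟨c ⟨k, by omega⟩ + 1, ?_⟩
        have h3 := (lt_iff_position hc).1 (lt_add_one (c ⟨k, by omega⟩))
        have h4 := position_le c (c ⟨k, by omega⟩ + 1)
        simp only at h3
        omega
  · refine ⟨c ⟨k, by omega⟩, ?_⟩
    have h1 := (le_iff_position hc).1 (le_refl (c ⟨k, by omega⟩))
    have h2 := (ge_iff_position hc).1 (le_refl (c ⟨k, by omega⟩))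
    simp only at h1 h2
    omega

lemma eq_of_position_odd {s t : ℝ} (h : position c s = position c t) (ho : Odd (position c s)) :
    s = t := by
  obtain ⟨k, hk⟩ := ho
  have hkN : k < N + 1 := by
    have := position_le c s
    omega
  have key : ∀ s, position c s = 2 * k + 1 → s = c ⟨k, hkN⟩ := fun s hs =>
    le_antisymm ((ge_iff_position hc).2 hs.le) ((le_iff_position hc).2 hs.ge)
  rw [key s hk, key t (h ▸ hk)]

end Position

/-! ### Transport between levels in the same position -/

section Transport

open Set

variable {κ : Type v} [Field κ] {r : ℕ} {X : Type u} [TopologicalSpace X] {f : X → ℝ}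
  {N : ℕ} {c : Fin (N + 1) → ℝ} (hf : IsTame f c)
include hf

namespace IsTame

/-- A noncritical level at the bottom of a slab reaching at most the next critical
value: the top level carries the homology of the slab. -/
lemma fromRight_bijective {t t' : ℝ} (h : t ≤ t') (he : Even (position c t))
    (hp : position c t' ≤ position c t + 1) : Function.Bijective (fromRight κ r f t t') := by
  refine hf.locallyTame.fromRight_bijective h ?_
  rintro _ ⟨k, rfl⟩ hk
  rw [lt_iff_position hf.strictMono] at hk ⊢
  obtain ⟨m, hm⟩ := he
  omega

/-- A noncritical level at the top of a slab reaching at most the previous critical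
value: the bottom level carries the homology of the slab. -/
lemma fromLeft_bijective {t t' : ℝ} (h : t ≤ t') (he : Even (position c t'))
    (hp : position c t' ≤ position c t + 1) : Function.Bijective (fromLeft κ r f t t') := by
  refine hf.locallyTame.fromLeft_bijective h ?_
  rintro _ ⟨k, rfl⟩ hk
  rw [gt_iff_position hf.strictMono] at hk ⊢
  obtain ⟨m, hm⟩ := he
  omega

lemma bijective_of_position_eq {t t' : ℝ} (h : t ≤ t') (hp : position c t = position c t') :
    Function.Bijective (fromLeft κ r f t t') ∧ Function.Bijective (fromRight κ r f t t') := by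
  rcases Nat.even_or_odd (position c t) with he | ho
  · exact ⟨hf.fromLeft_bijective h (hp ▸ he) (by omega), hf.fromRight_bijective h he (by omega)⟩
  · obtain rfl := eq_of_position_odd hf.strictMono hp ho
    exact ⟨hf.locallyTame.fromLeft_bijective le_rfl fun _ _ => id,
      hf.locallyTame.fromRight_bijective le_rfl fun _ _ => id⟩

/-- Between two levels in the same position the relation is the graph of an isomorphism, whichever
of the two levels is lower. -/
lemma exists_levelEquiv {s t : ℝ} (hp : position c s = position c t) :
    ∃ E : levelHomology κ r f s ≃ₗ[κ] levelHomology κ r f t,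
      (s ≤ t → ∀ x y, (x, y) ∈ levelRel κ r f s t ↔ y = E x) ∧
      (t ≤ s → ∀ x y, (y, x) ∈ levelRel κ r f t s ↔ y = E x) := by
  rcases lt_trichotomy s t with h | rfl | h
  · obtain ⟨h1, h2⟩ := hf.bijective_of_position_eq (κ := κ) (r := r) h.le hp
    refine ⟨(LinearEquiv.ofBijective _ h1).trans (LinearEquiv.ofBijective _ h2).symm,
      fun _ x y => ?_, fun h' => absurd h h'.not_gt⟩
    rw [mem_levelRel, LinearEquiv.trans_apply, LinearEquiv.eq_symm_apply]
    exact eq_comm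
  · refine ⟨LinearEquiv.refl κ _, fun _ x y => ⟨fun h => ?_, fun h => ?_⟩,
      fun _ x y => ⟨fun h => ?_, fun h => ?_⟩⟩
    · exact (hf.locallyTame.eq_of_mem_levelRel_self h).symm
    · obtain rfl : y = x := h
      exact levelRel_refl y
    · exact hf.locallyTame.eq_of_mem_levelRel_self h
    · obtain rfl : y = x := h
      exact levelRel_refl y
  · obtain ⟨h1, h2⟩ := hf.bijective_of_position_eq (κ := κ) (r := r) h.le hp.symm
    refine ⟨(LinearEquiv.ofBijective _ h2).trans (LinearEquiv.ofBijective _ h1).symm,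
      fun h' => absurd h h'.not_gt, fun _ x y => ?_⟩
    rw [mem_levelRel, LinearEquiv.trans_apply, LinearEquiv.eq_symm_apply]
    rfl

end IsTame

omit hf in
/-- A relation on levels that composes, and in which a factor connecting two levels in the same
position can be cancelled. -/
structure IsTransport (c : Fin (N + 1) → ℝ) (Q : ℝ → ℝ → Prop) : Prop where
  refl : ∀ t, Q t t
  trans : ∀ {t s t'}, t ≤ s → s ≤ t' → Q t s → Q s t' → Q t t'
  cancel_left : ∀ {s t t'}, s ≤ t → t ≤ t' → position c s = position c t → Q s t → Q s t' → Q t t'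
  cancel_right : ∀ {t t' s}, t ≤ t' → t' ≤ s → position c t' = position c s → Q t' s → Q t s →
    Q t t'

lemma isTransport_linked (v : ∀ t, levelHomology κ r f t) :
    IsTransport c fun t t' => (v t, v t') ∈ levelRel κ r f t t' where
  refl t := levelRel_refl _
  trans h h' h1 h2 := (hf.locallyTame.mem_levelRel_comp h h').2 ⟨_, h1, h2⟩
  cancel_left := by
    intro s t t' h h' hp h1 h2
    obtain ⟨y, h3, h4⟩ := (hf.locallyTame.mem_levelRel_comp h h').1 h2
    obtain ⟨E, hE, -⟩ := hf.exists_levelEquiv (κ := κ) (r := r) hp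
    rwa [(hE h _ _).1 h3, ← (hE h _ _).1 h1] at h4
  cancel_right := by
    intro t t' s h h' hp h1 h2
    obtain ⟨y, h3, h4⟩ := (hf.locallyTame.mem_levelRel_comp h h').1 h2
    obtain ⟨E, -, hE⟩ := hf.exists_levelEquiv (κ := κ) (r := r) hp.symm
    rwa [(hE h' _ _).1 h4, ← (hE h' _ _).1 h1] at h3

lemma isTransport_detected (w : ∀ t, levelHomology κ r f t →ₗ[κ] κ) :
    IsTransport c fun t t' => ∀ p ∈ levelRel κ r f t t', w t p.1 = w t' p.2 where
  refl t := by
    rintro ⟨x, y⟩ h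
    rw [hf.locallyTame.eq_of_mem_levelRel_self h]
  trans := by
    rintro t s t' h h' h1 h2 ⟨x, z⟩ hp
    obtain ⟨y, h3, h4⟩ := (hf.locallyTame.mem_levelRel_comp h h').1 hp
    exact (h1 _ h3).trans (h2 _ h4)
  cancel_left := by
    rintro s t t' h h' hp h1 h2 ⟨x, z⟩ hxz
    obtain ⟨E, hE, -⟩ := hf.exists_levelEquiv (κ := κ) (r := r) hp
    have h3 : (E.symm x, x) ∈ levelRel κ r f s t := (hE h _ _).2 (E.apply_symm_apply x).symm
    exact (h1 _ h3).symm.trans (h2 _ ((hf.locallyTame.mem_levelRel_comp h h').2 ⟨_, h3, hxz⟩))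
  cancel_right := by
    rintro t t' s h h' hp h1 h2 ⟨x, z⟩ hxz
    obtain ⟨E, hE, -⟩ := hf.exists_levelEquiv (κ := κ) (r := r) hp
    have h3 : (z, E z) ∈ levelRel κ r f t' s := (hE h' _ _).2 rfl
    exact (h2 _ ((hf.locallyTame.mem_levelRel_comp h h').2 ⟨_, hxz, h3⟩)).trans (h1 _ h3).symm

omit hf in
/-- A transport relation that holds between consecutive representatives `u m`, and between each
level and its representative, holds in general. -/
lemma IsTransport.of_steps {Q : ℝ → ℝ → Prop} (hQ : IsTransport c Q) {u : ℕ → ℝ}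
    (hu : ∀ n ≤ 2 * N + 2, position c (u n) = n)
    (hu1 : ∀ t, u (position c t) ≤ t → Q (u (position c t)) t)
    (hu2 : ∀ t, t ≤ u (position c t) → Q t (u (position c t))) {t t' : ℝ} (h : t ≤ t')
    (hs : ∀ m, position c t ≤ m → m < position c t' → Q (u m) (u (m + 1))) : Q t t' := by
  have lt_of_pos : ∀ {s t : ℝ}, position c s < position c t → s < t := fun h => by
    by_contra hst
    exact h.not_ge (position_mono c (not_lt.1 hst))
  have pu : ∀ t, position c (u (position c t)) = position c t := fun t => hu _ (position_le c t)
  have same : ∀ {t t' : ℝ}, t ≤ t' → position c t = position c t' → Q t t' := by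
    intro t t' h hp
    rcases le_total (u (position c t)) t with h1 | h1
    · refine hQ.cancel_left h1 h (pu t) (hu1 t h1) ?_
      have := hu1 t'
      rw [← hp] at this
      exact this (h1.trans h)
    · rcases le_total (u (position c t)) t' with h2 | h2
      · have := hu1 t'
        rw [← hp] at this
        exact hQ.trans h1 h2 (hu2 t h1) (this h2)
      · refine hQ.cancel_right h h2 (hp.symm.trans (pu t).symm) ?_ (hu2 t h1)
        have := hu2 t'
        rw [← hp] at this
        exact this h2
  rcases (position_mono c h).eq_or_lt with hp | hp
  · exact same h hp
  have chain : ∀ n, position c t ≤ n → n ≤ position c t' →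
      u (position c t) ≤ u n ∧ Q (u (position c t)) (u n) := by
    intro n h1
    induction n, h1 using Nat.le_induction with
    | base => exact fun _ => ⟨le_rfl, hQ.refl _⟩
    | succ n h1 ih =>
      intro h2
      obtain ⟨h3, h4⟩ := ih (by omega)
      have hn := position_le c t'
      have h5 : u n < u (n + 1) := lt_of_pos (by rw [hu n (by omega), hu (n + 1) (by omega)]; omega)
      exact ⟨h3.trans h5.le, hQ.trans h3 h5.le h4 (hs n h1 (by omega))⟩
  obtain ⟨h1, h2⟩ := chain _ hp.le le_rfl
  have h3 : u (position c t) < t' := lt_of_pos (by rw [pu]; exact hp)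
  have h4 : Q (u (position c t)) t' := by
    rcases le_total (u (position c t')) t' with h5 | h5
    · exact hQ.trans h1 h5 h2 (hu1 t' h5)
    · exact hQ.cancel_right h3.le h5 (pu t').symm (hu2 t' h5) h2
  rcases le_total (u (position c t)) t with h5 | h5
  · exact hQ.cancel_left h5 h (pu t) (hu1 t h5) h4
  · exact hQ.trans h5 h3.le (hu2 t h5) h4

end Transport

/-! ### Existence of the bar code -/

section Existence

variable {κ : Type v} [Field κ] {r : ℕ} {X : Type u} [TopologicalSpace X] {f : X → ℝ}
  {N : ℕ} {c : Fin (N + 1) → ℝ}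

lemma subsingleton_setHomology_empty : Subsingleton (setHomology κ r (∅ : Set X)) := by
  have : IsEmpty C(stdSimplex ℝ (Fin (r + 1)), (∅ : Set X)) :=
    ⟨fun σ => (σ (stdSimplex.vertex 0)).2⟩
  have h1 : Subsingleton (SingularChain κ r (∅ : Set X)) :=
    inferInstanceAs (Subsingleton (_ →₀ κ))
  have h2 : Subsingleton (chainsIn κ r (∅ : Set X)) :=
    (chainsInEquiv κ r (∅ : Set X)).symm.injective.subsingleton
  have h3 : Subsingleton (cyclesIn κ r (∅ : Set X)) :=
    (Submodule.inclusion_injective inf_le_left).subsingleton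
  exact (classIn_surjective κ r (∅ : Set X)).subsingleton

lemma IsTame.subsingleton_levelHomology (hf : IsTame f c) {t : ℝ}
    (h : position c t = 0 ∨ position c t = 2 * N + 2) :
    Subsingleton (levelHomology κ r f t) := by
  have hempty : f ⁻¹' {t} = ∅ := by
    refine Set.eq_empty_of_forall_notMem fun x hx => ?_
    have hx' : f x = t := hx
    have h1 := (le_iff_position hf.strictMono).1 (hf.isLeast.2 ⟨x, rfl⟩)
    have h2 := (ge_iff_position hf.strictMono).1 (hf.isGreatest.2 ⟨x, rfl⟩)
    rw [hx'] at h1 h2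
    simp only [Fin.val_last] at h2
    omega
  change Subsingleton (setHomology κ r (f ⁻¹' {t}))
  rw [hempty]
  exact subsingleton_setHomology_empty

/-- The bar which lives at the positions `l, …, m`. -/
def barOfPositions (N l m : ℕ) (hl : 1 ≤ l) (hlm : l ≤ m) (hm : m ≤ 2 * N + 1) : Bar N where
  left := ⟨(l - 1) / 2, by omega⟩
  right := ⟨m / 2, by omega⟩
  leftClosed := decide (Odd l)
  rightClosed := decide (Odd m)
  valid := by
    simp only [Fin.mk_lt_mk, Fin.mk.injEq, decide_eq_true_eq, Nat.odd_iff]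
    omega

lemma mem_barOfPositions (hc : StrictMono c) {l m : ℕ} (hl : 1 ≤ l) (hlm : l ≤ m)
    (hm : m ≤ 2 * N + 1) (t : ℝ) :
    t ∈ (barOfPositions N l m hl hlm hm).toSet c ↔ l ≤ position c t ∧ position c t ≤ m := by
  have h1 : ∀ k : Fin (N + 1), c k = t ↔ position c t = 2 * (k : ℕ) + 1 := fun k => by
    rw [le_antisymm_iff, le_iff_position hc, ge_iff_position hc]
    omega
  simp only [Bar.toSet, barOfPositions, Set.mem_ofPred_eq, lt_iff_position hc, gt_iff_position hc,
    decide_eq_true_eq, Nat.odd_iff, eq_comm (a := c _) (b := t)]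
  simp only [eq_comm (a := t), h1]
  omega

end Existence

section Existence

variable {κ : Type v} [Field κ] {r : ℕ} {X : Type u} [TopologicalSpace X] {f : X → ℝ}
  {N : ℕ} {c : Fin (N + 1) → ℝ}

/-- What the decomposition of the chain of representative levels says about all levels. The bar `b`
lives at the positions `first b, …, last b`, with class `vec b t` and coefficient functional
`coord b t` at the level `t`. Classes are related unless a closed end lies in between, and
coefficients of related elements agree unless an open end lies in between. -/
structure LevelDecomposition (κ : Type v) [Field κ] (r : ℕ) {X : Type u} [TopologicalSpace X]
    (f : X → ℝ) {N : ℕ} (c : Fin (N + 1) → ℝ) where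
  ι : Type
  fintype : Fintype ι
  first : ι → ℕ
  last : ι → ℕ
  vec : ι → ∀ t, levelHomology κ r f t
  coord : ι → ∀ t, levelHomology κ r f t →ₗ[κ] κ
  one_le_first : ∀ b, 1 ≤ first b
  first_le_last : ∀ b, first b ≤ last b
  last_le : ∀ b, last b ≤ 2 * N + 1
  vec_eq_zero : ∀ b t, ¬(first b ≤ position c t ∧ position c t ≤ last b) → vec b t = 0
  coord_eq_zero : ∀ b t, ¬(first b ≤ position c t ∧ position c t ≤ last b) → coord b t = 0
  coord_self : ∀ b t, first b ≤ position c t → position c t ≤ last b → coord b t (vec b t) = 1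
  coord_ne : ∀ b b' t, b ≠ b' → coord b t (vec b' t) = 0
  sum_coord : ∀ t x, ∑ b, coord b t x • vec b t = x
  linked : ∀ b t t', t ≤ t' →
    (position c t ≤ last b → last b < position c t' → Even (last b)) →
    (position c t < first b → first b ≤ position c t' → Even (first b)) →
    (vec b t, vec b t') ∈ levelRel κ r f t t'
  detected : ∀ b t t', t ≤ t' →
    (position c t ≤ last b → last b < position c t' → Odd (last b)) →
    (position c t < first b → first b ≤ position c t' → Odd (first b)) →
    ∀ p ∈ levelRel κ r f t t', coord b t p.1 = coord b t' p.2

/-- The decomposition of the chain of relations between one level for each position carries over to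
all levels. Classes of the levels at the positions `0` and `2 * N + 2` vanish, which bounds the bars
by critical values. A bar that ends or starts does so in one of two ways, and the parity of the
position decides which, because levels between critical values map isomorphically onto slabs. -/
theorem IsTame.exists_levelDecomposition (hf : IsTame f c) :
    Nonempty (LevelDecomposition κ r f c) := by
  have hex : ∀ n, ∃ t, n ≤ 2 * N + 2 → position c t = n := by
    intro n
    by_cases hn : n ≤ 2 * N + 2
    · obtain ⟨t, ht⟩ := exists_position_eq hf.strictMono hn
      exact ⟨t, fun _ => ht⟩
    · exact ⟨0, fun h => absurd h hn⟩
  choose u hu using hex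
  have hlt : ∀ n < 2 * N + 2, u n < u (n + 1) := fun n hn => by
    by_contra h
    have := position_mono c (not_lt.1 h)
    rw [hu n hn.le, hu (n + 1) hn] at this
    omega
  have hfin : ∀ m, Module.Finite κ (levelHomology κ r f (u m)) := fun m =>
    hf.locallyTame.finite_level κ r hf.compactANR (u m)
  have hz0 : Subsingleton (levelHomology κ r f (u 0)) :=
    hf.subsingleton_levelHomology (Or.inl (hu 0 (by omega)))
  obtain ⟨D⟩ := ChainDecomposition.nonempty (κ := κ)
    (V := fun m => levelHomology κ r f (u m)) (fun m => levelRel κ r f (u m) (u (m + 1)))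
    (2 * N + 2)
  have hne : ∀ b m, D.first b ≤ m → m ≤ D.last b → D.vec b m ≠ 0 := fun b m h1 h2 h => by
    have := D.coord_self b m h1 h2
    rw [h, map_zero] at this
    exact zero_ne_one this
  have hfirst : ∀ b, 1 ≤ D.first b := fun b => by
    by_contra h
    exact hne b 0 (by omega) (Nat.zero_le _) (Subsingleton.elim _ _)
  have hlast : ∀ b, D.last b ≤ 2 * N + 1 := fun b => by
    by_contra h
    have hl : D.last b = 2 * N + 2 := le_antisymm (D.last_le b) (by omega)
    have : Subsingleton (levelHomology κ r f (u (2 * N + 2))) :=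
      hf.subsingleton_levelHomology (Or.inr (hu _ le_rfl))
    exact hne b (2 * N + 2) ((D.first_le_last b).trans hl.le) hl.ge (Subsingleton.elim _ _)
  -- around a level between critical values the relations are graphs of maps into it or out of it
  have hout : ∀ m < 2 * N + 2, Even m →
      (∀ x, ∃ y, (x, y) ∈ levelRel κ r f (u m) (u (m + 1))) ∧
      ∀ y, (0, y) ∈ levelRel κ r f (u m) (u (m + 1)) → y = 0 := by
    intro m hm he
    have hb := hf.fromRight_bijective (κ := κ) (r := r) (hlt m hm).le (by rwa [hu m hm.le])
      (by rw [hu m hm.le, hu (m + 1) hm])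
    refine ⟨fun x => ?_, fun y hy => ?_⟩
    · obtain ⟨y, hy⟩ := hb.2 (fromLeft κ r f _ _ x)
      exact ⟨y, mem_levelRel.2 hy.symm⟩
    · rw [mem_levelRel, map_zero] at hy
      exact hb.1 (hy.symm.trans (map_zero _).symm)
  have hinto : ∀ m < 2 * N + 2, Odd m →
      (∀ y, ∃ x, (x, y) ∈ levelRel κ r f (u m) (u (m + 1))) ∧
      ∀ x, (x, 0) ∈ levelRel κ r f (u m) (u (m + 1)) → x = 0 := by
    intro m hm ho
    have hb := hf.fromLeft_bijective (κ := κ) (r := r) (hlt m hm).le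
      (by rw [hu (m + 1) hm]; exact ho.add_one) (by rw [hu m hm.le, hu (m + 1) hm])
    refine ⟨fun y => ?_, fun x hx => ?_⟩
    · obtain ⟨x, hx⟩ := hb.2 (fromRight κ r f _ _ y)
      exact ⟨x, mem_levelRel.2 hx⟩
    · rw [mem_levelRel, map_zero] at hx
      exact hb.1 (hx.trans (map_zero _).symm)
  have hstep : ∀ b, ∀ m < 2 * N + 2,
      ((m = D.last b → Even m) → (m + 1 = D.first b → Odd m) →
        (D.vec b m, D.vec b (m + 1)) ∈ levelRel κ r f (u m) (u (m + 1))) ∧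
      ((m = D.last b → Odd m) → (m + 1 = D.first b → Even m) →
        ∀ p ∈ levelRel κ r f (u m) (u (m + 1)), D.coord b m p.1 = D.coord b (m + 1) p.2) := by
    intro b m hm
    obtain ⟨hs1, hs2⟩ := D.step m hm b
    have hfl := D.first_le_last b
    by_cases hml : m = D.last b
    · have hv0 : D.vec b (m + 1) = 0 := D.vec_eq_zero b _ (by omega)
      have hc0 : D.coord b (m + 1) = 0 := D.coord_eq_zero b _ (by omega)
      have hc1 := D.coord_self b m (by omega) (by omega)
      refine ⟨fun h _ => hs2.resolve_right fun h' => ?_, fun h _ => hs2.resolve_left fun h' => ?_⟩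
      · obtain ⟨y, hy⟩ := (hout m hm (h hml)).1 (D.vec b m)
        have h3 := h' _ hy
        rw [hc0] at h3
        exact one_ne_zero (hc1.symm.trans h3)
      · rw [hv0] at h'
        exact hne b m (by omega) (by omega) ((hinto m hm (h hml)).2 _ h')
    · by_cases hmf : m + 1 = D.first b
      · have hv0 : D.vec b m = 0 := D.vec_eq_zero b _ (by omega)
        have hc0 : D.coord b m = 0 := D.coord_eq_zero b _ (by omega)
        have hc1 := D.coord_self b (m + 1) (by omega) (by omega)
        refine ⟨fun _ h => hs2.resolve_right fun h' => ?_,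
          fun _ h => hs2.resolve_left fun h' => ?_⟩
        · obtain ⟨x, hx⟩ := (hinto m hm (h hmf)).1 (D.vec b (m + 1))
          have h3 := h' _ hx
          rw [hc0] at h3
          exact one_ne_zero (hc1.symm.trans h3.symm)
        · rw [hv0] at h'
          exact hne b (m + 1) (by omega) (by omega) ((hout m hm (h hmf)).2 _ h')
      · have := hs1 (by omega)
        exact ⟨fun _ _ => this.1, fun _ _ => this.2⟩
  have hup : ∀ t, position c (u (position c t)) = position c t := fun t => hu _ (position_le c t)
  choose E hE1 hE2 using fun t => hf.exists_levelEquiv (κ := κ) (r := r) (hup t)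
  let vec : D.ι → ∀ t, levelHomology κ r f t := fun b t => E t (D.vec b (position c t))
  let coord : D.ι → ∀ t, levelHomology κ r f t →ₗ[κ] κ := fun b t =>
    D.coord b (position c t) ∘ₗ (E t).symm.toLinearMap
  have hvec : ∀ b, ∀ m ≤ 2 * N + 2, vec b (u m) = D.vec b m := by
    intro b m hm
    have key : ∀ p, p = m → ∀ F : levelHomology κ r f (u p) → levelHomology κ r f (u m),
        (u p ≤ u m → ∀ x y, (x, y) ∈ levelRel κ r f (u p) (u m) ↔ y = F x) →
        F (D.vec b p) = D.vec b m := by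
      rintro p rfl F hF
      exact ((hF le_rfl _ _).1 (levelRel_refl _)).symm
    exact key _ (hu m hm) (E (u m)) (hE1 (u m))
  have hcoord : ∀ b, ∀ m ≤ 2 * N + 2, coord b (u m) = D.coord b m := by
    intro b m hm
    have key : ∀ p, p = m → ∀ F : levelHomology κ r f (u p) ≃ₗ[κ] levelHomology κ r f (u m),
        (u p ≤ u m → ∀ x y, (x, y) ∈ levelRel κ r f (u p) (u m) ↔ y = F x) →
        D.coord b p ∘ₗ F.symm.toLinearMap = D.coord b m := by
      rintro p rfl F hF
      ext x
      have : x = F x := (hF le_rfl _ _).1 (levelRel_refl _)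
      change D.coord b p (F.symm x) = D.coord b p x
      rw [(LinearEquiv.symm_apply_eq F).2 this]
    exact key _ (hu m hm) (E (u m)) (hE1 (u m))
  refine ⟨{
    ι := D.ι
    fintype := D.fintype
    first := D.first
    last := D.last
    vec := vec
    coord := coord
    one_le_first := hfirst
    first_le_last := D.first_le_last
    last_le := hlast
    vec_eq_zero := fun b t h => by simp only [vec, D.vec_eq_zero b _ h, map_zero]
    coord_eq_zero := fun b t h => by simp only [coord, D.coord_eq_zero b _ h, LinearMap.zero_comp]
    coord_self := fun b t h1 h2 => by
      change D.coord b (position c t) ((E t).symm (E t (D.vec b (position c t)))) = 1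
      rw [LinearEquiv.symm_apply_apply]
      exact D.coord_self b _ h1 h2
    coord_ne := fun b b' t h => by
      change D.coord b (position c t) ((E t).symm (E t (D.vec b' (position c t)))) = 0
      rw [LinearEquiv.symm_apply_apply]
      exact D.coord_ne b b' _ h
    sum_coord := fun t x => ?_
    linked := fun b t t' h h1 h2 => ?_
    detected := fun b t t' h h1 h2 => ?_ }⟩
  · have h := congrArg (E t) (D.sum_coord (position c t) (position_le c t) ((E t).symm x))
    rw [LinearEquiv.apply_symm_apply, map_sum] at h
    refine Eq.trans (Finset.sum_congr rfl fun b _ => ?_) h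
    rw [map_smul]
    rfl
  · refine (isTransport_linked hf (vec b)).of_steps hu (fun s hs => ?_) (fun s hs => ?_) h
      fun m hm hm' => ?_
    · rw [hvec b _ (position_le c s)]
      exact (hE1 s hs _ _).2 rfl
    · rw [hvec b _ (position_le c s)]
      exact (hE2 s hs _ _).2 rfl
    · have hm2 : m < 2 * N + 2 := hm'.trans_le (position_le c t')
      rw [hvec b m hm2.le, hvec b (m + 1) hm2]
      refine (hstep b m hm2).1 (fun e => ?_) fun e => ?_
      · rw [e]
        exact h1 (by omega) (by omega)
      · have h3 := h2 (by omega) (by omega)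
        rw [← e] at h3
        rcases Nat.even_or_odd m with h4 | h4
        · exact absurd h3 (Nat.not_even_iff_odd.2 h4.add_one)
        · exact h4
  · refine (isTransport_detected hf (coord b)).of_steps hu (fun s hs => ?_) (fun s hs => ?_) h
      fun m hm hm' => ?_
    · rw [hcoord b _ (position_le c s)]
      rintro ⟨x, y⟩ hp
      rw [(hE1 s hs _ _).1 hp]
      exact congrArg (D.coord b (position c s)) ((E s).symm_apply_apply x).symm
    · rw [hcoord b _ (position_le c s)]
      rintro ⟨y, x⟩ hp
      rw [(hE2 s hs _ _).1 hp]
      exact congrArg (D.coord b (position c s)) ((E s).symm_apply_apply x)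
    · have hm2 : m < 2 * N + 2 := hm'.trans_le (position_le c t')
      rw [hcoord b m hm2.le, hcoord b (m + 1) hm2]
      refine (hstep b m hm2).2 (fun e => ?_) fun e => ?_
      · rw [e]
        exact h1 (by omega) (by omega)
      · have h3 := h2 (by omega) (by omega)
        rw [← e] at h3
        rcases Nat.even_or_odd m with h4 | h4
        · exact h4
        · exact absurd h4.add_one (Nat.not_even_iff_odd.2 h3)

/-- A tame map has a level bar code. -/
theorem IsTame.exists_levelBarcode (hf : IsTame f c) : Nonempty (LevelBarcode κ r f c) := by
  classical
  obtain ⟨D⟩ := hf.exists_levelDecomposition (κ := κ) (r := r)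
  let _ := D.fintype
  let e : Fin (Fintype.card D.ι) ≃ D.ι := (Fintype.equivFin D.ι).symm
  let bar : Fin (Fintype.card D.ι) → Bar N := fun i => barOfPositions N (D.first (e i))
    (D.last (e i)) (D.one_le_first _) (D.first_le_last _) (D.last_le _)
  have hbar : ∀ i t, t ∈ (bar i).toSet c ↔
      D.first (e i) ≤ position c t ∧ position c t ≤ D.last (e i) := fun i t =>
    mem_barOfPositions hf.strictMono _ _ _ t
  have hleft : ∀ i, (bar i).leftClosed = decide (Odd (D.first (e i))) := fun i => rfl
  have hright : ∀ i, (bar i).rightClosed = decide (Odd (D.last (e i))) := fun i => rfl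
  have hli : ∀ t, LinearIndependent κ fun b : {b // t ∈ (bar b).toSet c} => D.vec (e b) t := by
    intro t
    rw [Fintype.linearIndependent_iff]
    intro a ha b
    have h := congrArg (D.coord (e b) t) ha
    rw [map_sum, map_zero, Finset.sum_eq_single b] at h
    · have hb := (hbar b t).1 b.2
      rwa [map_smul, D.coord_self _ _ hb.1 hb.2, smul_eq_mul, mul_one] at h
    · intro b' _ hb'
      rw [map_smul, D.coord_ne _ _ t fun h => hb' (Subtype.ext (e.injective h)).symm, smul_zero]
    · exact fun h => absurd (Finset.mem_univ b) h
  have hsp : ∀ t, ⊤ ≤ Submodule.span κ (Set.range fun b : {b // t ∈ (bar b).toSet c} =>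
      D.vec (e b) t) := by
    intro t x _
    rw [← D.sum_coord t x]
    refine Submodule.sum_mem _ fun b _ => Submodule.smul_mem _ _ ?_
    by_cases hb : t ∈ (bar (e.symm b)).toSet c
    · exact Submodule.subset_span ⟨⟨e.symm b, hb⟩, congrArg (D.vec · t) (e.apply_symm_apply b)⟩
    · rw [hbar, e.apply_symm_apply] at hb
      rw [D.vec_eq_zero b t hb]
      exact Submodule.zero_mem _
  have hbasis : ∀ t b, Module.Basis.mk (hli t) (hsp t) b = D.vec (e b) t := fun t b =>
    Module.Basis.mk_apply ..
  refine ⟨{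
    size := Fintype.card D.ι
    bar := bar
    basis := fun t => Module.Basis.mk (hli t) (hsp t)
    detect := fun t t' h b hb hb' => ?_
    dieUp := fun t t' h b hb hb' ho => ?_
    dieDown := fun t t' h b hb' hb ho => ?_
    independent := fun t t' h => ?_ }⟩
  · rw [hbasis, hbasis]
    rw [hbar] at hb hb'
    exact mem_levelRel.1 (D.linked (e b) t t' h (fun _ _ => by omega) fun _ _ => by omega)
  · rw [hbasis]
    rw [hbar] at hb hb'
    have hmono := position_mono c h
    have h1 := mem_levelRel.1 (D.linked (e b) t t' h (fun _ _ => by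
      rw [hright, decide_eq_false_iff_not] at ho
      exact Nat.not_odd_iff_even.1 ho) fun _ _ => by omega)
    rwa [D.vec_eq_zero (e b) t' hb', map_zero] at h1
  · rw [hbasis]
    rw [hbar] at hb hb'
    have hmono := position_mono c h
    have h1 := mem_levelRel.1 (D.linked (e b) t t' h (fun _ _ => by omega) fun _ _ => by
      rw [hleft, decide_eq_false_iff_not] at ho
      exact Nat.not_odd_iff_even.1 ho)
    rw [D.vec_eq_zero (e b) t hb, map_zero] at h1
    exact h1.symm
  · have hmono := position_mono c h
    rw [Fintype.linearIndependent_iff]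
    intro a ha
    simp only [Fintype.sum_sum_type, Sum.elim_inl, Sum.elim_inr, hbasis] at ha
    set x := ∑ b : {b // t ∈ (bar b).toSet c ∧
        (t' ∈ (bar b).toSet c ∨ (bar b).rightClosed = true)}, a (Sum.inl b) • D.vec (e b.1) t
      with hx
    set y := ∑ b : {b // t' ∈ (bar b).toSet c ∧ t ∉ (bar b).toSet c ∧
        (bar b).leftClosed = true}, a (Sum.inr b) • D.vec (e b.1) t' with hy
    have hxy : (x, -y) ∈ levelRel κ r f t t' := by
      rw [mem_levelRel, map_neg, eq_neg_iff_add_eq_zero, ← ha, hx, hy]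
      simp only [map_sum, map_smul]
    rintro (b | b)
    · obtain ⟨hb, hb'⟩ := b.2
      rw [hbar] at hb
      have h1 : D.coord (e b.1) t x = a (Sum.inl b) := by
        rw [hx, map_sum, Finset.sum_eq_single b]
        · rw [map_smul, D.coord_self _ _ hb.1 hb.2, smul_eq_mul, mul_one]
        · intro b' _ hbb
          rw [map_smul, D.coord_ne _ _ t fun h => hbb (Subtype.ext (e.injective h)).symm, smul_zero]
        · exact fun h => absurd (Finset.mem_univ b) h
      have h2 : D.coord (e b.1) t' y = 0 := by
        rw [hy, map_sum]
        refine Finset.sum_eq_zero fun b' _ => ?_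
        rw [map_smul, D.coord_ne _ _ t' fun h => b'.2.2.1 ?_, smul_zero]
        rw [← e.injective h]
        exact b.2.1
      have h3 := D.detected (e b.1) t t' h (fun h4 h5 => by
        rw [hbar, hright, decide_eq_true_eq] at hb'
        rcases hb' with hb' | hb'
        · omega
        · exact hb') (fun _ _ => by omega) _ hxy
      change D.coord (e b.1) t x = D.coord (e b.1) t' (-y) at h3
      rw [h1, map_neg, h2, neg_zero] at h3
      exact h3
    · obtain ⟨hb', hb, hl⟩ := b.2
      rw [hbar] at hb hb'
      have h1 : D.coord (e b.1) t' y = a (Sum.inr b) := by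
        rw [hy, map_sum, Finset.sum_eq_single b]
        · rw [map_smul, D.coord_self _ _ hb'.1 hb'.2, smul_eq_mul, mul_one]
        · intro b' _ hbb
          rw [map_smul, D.coord_ne _ _ t' fun h => hbb (Subtype.ext (e.injective h)).symm,
            smul_zero]
        · exact fun h => absurd (Finset.mem_univ b) h
      have h3 := D.detected (e b.1) t t' h (fun _ _ => by omega) (fun _ _ => by
        rw [hleft, decide_eq_true_eq] at hl
        exact hl) _ hxy
      change D.coord (e b.1) t x = D.coord (e b.1) t' (-y) at h3
      rw [D.coord_eq_zero _ _ hb, LinearMap.zero_apply, map_neg, h1] at h3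
      exact neg_eq_zero.1 h3.symm

end Existence

/-! ### Subspaces spanned by parts of an independent family -/

section Independent

open Submodule

variable {κ : Type*} [Field κ] {W W' : Type*} [AddCommGroup W] [Module κ W] [AddCommGroup W']
  [Module κ W'] {τ : Type*}

lemma span_image_inf_span_image {x : τ → W} (hx : LinearIndependent κ x) (s t : Set τ) :
    span κ (x '' s) ⊓ span κ (x '' t) = span κ (x '' (s ∩ t)) := by
  refine le_antisymm ?_ (le_inf (span_mono (Set.image_mono Set.inter_subset_left))
    (span_mono (Set.image_mono Set.inter_subset_right)))
  rintro y ⟨h1, h2⟩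
  obtain ⟨l, hl, rfl⟩ := (Finsupp.mem_span_image_iff_linearCombination κ).1 h1
  obtain ⟨l', hl', he⟩ := (Finsupp.mem_span_image_iff_linearCombination κ).1 h2
  obtain rfl : l' = l := hx he
  refine (Finsupp.mem_span_image_iff_linearCombination κ).2 ⟨l', ?_, rfl⟩
  rw [Finsupp.mem_supported] at hl hl' ⊢
  exact Set.subset_inter hl hl'

lemma finrank_span_image [Finite τ] {x : τ → W} (hx : LinearIndependent κ x) (s : Set τ) :
    Module.finrank κ (span κ (x '' s)) = Nat.card s := by
  have := Fintype.ofFinite s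
  rw [Set.image_eq_range, Nat.card_eq_fintype_card]
  exact finrank_span_eq_card (hx.comp _ Subtype.val_injective)

lemma ker_eq_span_image [Finite τ] (e : Module.Basis τ κ W) (T : W →ₗ[κ] W') (s : Set τ)
    (hs : ∀ i ∈ s, T (e i) = 0) (hi : LinearIndependent κ fun i : {i // i ∉ s} => T (e i)) :
    LinearMap.ker T = span κ (e '' s) := by
  classical
  have := Fintype.ofFinite τ
  refine le_antisymm (fun x hx => ?_) (span_le.2 ?_)
  · rw [LinearMap.mem_ker, ← e.sum_repr x, map_sum,
      ← Fintype.sum_subtype_add_sum_subtype (fun i => i ∈ s)] at hx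
    rw [Finset.sum_eq_zero fun i _ => by rw [map_smul, hs i.1 i.2, smul_zero], zero_add] at hx
    simp only [map_smul] at hx
    have h0 := Fintype.linearIndependent_iff.1 hi _ hx
    rw [e.mem_span_image]
    intro i hi
    by_contra h
    exact (Finsupp.mem_support_iff.1 hi) (h0 ⟨i, h⟩)
  · rintro _ ⟨i, hi, rfl⟩
    exact hs i hi

end Independent

/-! ### The numbers as numbers of bars -/

section Counting

open Submodule

variable {κ : Type v} [Field κ] {r : ℕ} {X : Type u} [TopologicalSpace X] {f : X → ℝ}
  {N : ℕ} {c : Fin (N + 1) → ℝ}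

namespace LevelBarcode

variable (B : LevelBarcode κ r f c)

/-- The kernel `L_r^+(t; t')` belongs to the bars through `t` which end openly up to `t'`, since the
images of the other basis elements are linearly independent. -/
lemma lPlus_eq_span {t t' : ℝ} (h : t ≤ t') : LPlus κ r f t t' = span κ (B.basis t ''
    {b | t' ∉ (B.bar b).toSet c ∧ (B.bar b).rightClosed = false}) := by
  refine ker_eq_span_image (B.basis t) _ _ (fun b hb => B.dieUp t t' h b b.2 hb.1 hb.2) ?_
  have hd : ∀ b : {b : {b // t ∈ (B.bar b).toSet c} // b ∉ {b : {b // t ∈ (B.bar b).toSet c} |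
      t' ∉ (B.bar b).toSet c ∧ (B.bar b).rightClosed = false}},
      t' ∈ (B.bar b.1).toSet c ∨ (B.bar b.1).rightClosed = true := fun b => by
    have := b.2
    simp only [Set.mem_ofPred_eq, not_and_or, not_not, Bool.not_eq_false] at this
    exact this
  have hi := (B.independent t t' h).comp (fun b : {b : {b // t ∈ (B.bar b).toSet c} //
      b ∉ {b : {b // t ∈ (B.bar b).toSet c} |
        t' ∉ (B.bar b).toSet c ∧ (B.bar b).rightClosed = false}} =>
    Sum.inl ⟨b.1.1, b.1.2, hd b⟩) fun a b hab =>
      Subtype.ext (Subtype.ext (Subtype.mk.inj (Sum.inl.inj hab)))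
  exact hi

lemma lMinus_eq_span {t'' t : ℝ} (h : t'' ≤ t) : LMinus κ r f t t'' = span κ (B.basis t ''
    {b | t'' ∉ (B.bar b).toSet c ∧ (B.bar b).leftClosed = false}) := by
  classical
  refine ker_eq_span_image (B.basis t) _ _ (fun b hb => B.dieDown t'' t h b b.2 hb.1 hb.2) ?_
  have hd : ∀ b : {b : {b // t ∈ (B.bar b).toSet c} // b ∉ {b : {b // t ∈ (B.bar b).toSet c} |
      t'' ∉ (B.bar b).toSet c ∧ (B.bar b).leftClosed = false}},
      t'' ∉ (B.bar b.1).toSet c → (B.bar b.1).leftClosed = true := fun b => by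
    have := b.2
    simp only [Set.mem_ofPred_eq, not_and_or, not_not, Bool.not_eq_false] at this
    exact this.resolve_left
  have hi := (B.independent t'' t h).comp (fun b : {b : {b // t ∈ (B.bar b).toSet c} //
      b ∉ {b : {b // t ∈ (B.bar b).toSet c} |
        t'' ∉ (B.bar b).toSet c ∧ (B.bar b).leftClosed = false}} =>
    if hb : t'' ∈ (B.bar b.1).toSet c then Sum.inl ⟨b.1.1, hb, Or.inl b.1.2⟩
    else Sum.inr ⟨b.1.1, b.1.2, hb, hd b hb⟩) (by
      intro a b hab
      dsimp only at hab
      split_ifs at hab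
      · exact Subtype.ext (Subtype.ext (Subtype.mk.inj (Sum.inl.inj hab)))
      · exact Subtype.ext (Subtype.ext (Subtype.mk.inj (Sum.inr.inj hab))))
  convert hi using 1
  ext1 b
  rw [Function.comp_apply]
  split_ifs with hb
  · exact (B.detect t'' t h b.1.1 hb b.1.2).symm
  · rfl

/-- The classes in `I_r(t, t')` come from the bars through both levels. -/
lemma iNum_eq_card {t t' : ℝ} (h : t ≤ t') : iNum κ r f t t' =
    Nat.card {b // t ∈ (B.bar b).toSet c ∧ t' ∈ (B.bar b).toSet c} := by
  set F := Sum.elim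
    (fun b : {b : Fin B.size // t ∈ (B.bar b).toSet c ∧
        (t' ∈ (B.bar b).toSet c ∨ (B.bar b).rightClosed = true)} =>
      fromLeft κ r f t t' (B.basis t ⟨b.1, b.2.1⟩))
    (fun b : {b : Fin B.size // t' ∈ (B.bar b).toSet c ∧
        t ∉ (B.bar b).toSet c ∧ (B.bar b).leftClosed = true} =>
      fromRight κ r f t t' (B.basis t' ⟨b.1, b.2.1⟩)) with hF
  have hind : LinearIndependent κ F := B.independent t t' h
  have hL : LinearMap.range (fromLeft κ r f t t') = span κ (F '' Set.range Sum.inl) := by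
    rw [LinearMap.range_eq_map, ← (B.basis t).span_eq, map_span]
    refine le_antisymm (span_le.2 ?_) (span_mono ?_)
    · rintro _ ⟨_, ⟨b, rfl⟩, rfl⟩
      by_cases hb : t' ∈ (B.bar b.1).toSet c ∨ (B.bar b.1).rightClosed = true
      · exact subset_span ⟨Sum.inl ⟨b.1, b.2, hb⟩, ⟨_, rfl⟩, rfl⟩
      · rw [not_or, Bool.not_eq_true] at hb
        rw [B.dieUp t t' h b.1 b.2 hb.1 hb.2]
        exact zero_mem _
    · rintro _ ⟨_, ⟨b, rfl⟩, rfl⟩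
      exact ⟨_, ⟨_, rfl⟩, rfl⟩
  have hR : LinearMap.range (fromRight κ r f t t') =
      span κ (F '' {b | ∀ b', b = Sum.inl b' → t' ∈ (B.bar b'.1).toSet c}) := by
    rw [LinearMap.range_eq_map, ← (B.basis t').span_eq, map_span]
    refine le_antisymm (span_le.2 ?_) (span_mono ?_)
    · rintro _ ⟨_, ⟨b, rfl⟩, rfl⟩
      by_cases hb : t ∈ (B.bar b.1).toSet c
      · rw [← B.detect t t' h b.1 hb b.2]
        refine subset_span ⟨Sum.inl ⟨b.1, hb, Or.inl b.2⟩, ?_, rfl⟩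
        rintro b' hb'
        rw [← Sum.inl_injective hb']
        exact b.2
      · by_cases hb' : (B.bar b.1).leftClosed = true
        · exact subset_span ⟨Sum.inr ⟨b.1, b.2, hb, hb'⟩, by rintro b' ⟨⟩, rfl⟩
        · rw [B.dieDown t t' h b.1 b.2 hb (Bool.not_eq_true _ ▸ hb')]
          exact zero_mem _
    · rintro _ ⟨b | b, hb, rfl⟩
      · exact ⟨_, ⟨⟨b.1, hb b rfl⟩, rfl⟩, (B.detect t t' h b.1 b.2.1 (hb b rfl)).symm⟩
      · exact ⟨_, ⟨⟨b.1, b.2.1⟩, rfl⟩, rfl⟩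
  rw [iNum, IInter, hL, hR, span_image_inf_span_image hind, finrank_span_image hind]
  refine Nat.card_congr (Equiv.symm (Equiv.ofBijective (fun b : {b // t ∈ (B.bar b).toSet c ∧
    t' ∈ (B.bar b).toSet c} => ⟨Sum.inl ⟨b.1, b.2.1, Or.inl b.2.2⟩, ⟨_, rfl⟩, ?_⟩) ⟨?_, ?_⟩))
  · rintro b' hb'
    rw [← Sum.inl_injective hb']
    exact b.2.2
  · intro a b hab
    exact Subtype.ext (Subtype.mk.inj (Sum.inl.inj (Subtype.mk.inj hab)))
  · rintro ⟨_, ⟨b, rfl⟩, hb⟩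
    exact ⟨⟨b.1, b.2.1, hb b rfl⟩, rfl⟩

lemma lNum_eq_card (t : ℝ) : lNum κ r f t = Nat.card {b // t ∈ (B.bar b).toSet c} := by
  rw [lNum, Module.finrank_eq_nat_card_basis (B.basis t)]

lemma lPlusNum_eq_card {t t' : ℝ} (h : t ≤ t') : lPlusNum κ r f t t' =
    Nat.card {b // t ∈ (B.bar b).toSet c ∧ t' ∉ (B.bar b).toSet c ∧
      (B.bar b).rightClosed = false} := by
  rw [lPlusNum, B.lPlus_eq_span h, finrank_span_image (B.basis t).linearIndependent]
  exact Nat.card_congr (Equiv.subtypeSubtypeEquivSubtypeInter _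
    fun b => t' ∉ (B.bar b).toSet c ∧ (B.bar b).rightClosed = false)

lemma lMinusNum_eq_card {t'' t : ℝ} (h : t'' ≤ t) : lMinusNum κ r f t t'' =
    Nat.card {b // t ∈ (B.bar b).toSet c ∧ t'' ∉ (B.bar b).toSet c ∧
      (B.bar b).leftClosed = false} := by
  rw [lMinusNum, B.lMinus_eq_span h, finrank_span_image (B.basis t).linearIndependent]
  exact Nat.card_congr (Equiv.subtypeSubtypeEquivSubtypeInter _
    fun b => t'' ∉ (B.bar b).toSet c ∧ (B.bar b).leftClosed = false)

lemma eNum_eq_card {t'' t t' : ℝ} (h : t'' ≤ t) (h' : t ≤ t') : eNum κ r f t t' t'' =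
    Nat.card {b // t ∈ (B.bar b).toSet c ∧
      (t' ∉ (B.bar b).toSet c ∧ (B.bar b).rightClosed = false) ∧
      t'' ∉ (B.bar b).toSet c ∧ (B.bar b).leftClosed = false} := by
  rw [eNum, B.lPlus_eq_span h', B.lMinus_eq_span h,
    span_image_inf_span_image (B.basis t).linearIndependent,
    finrank_span_image (B.basis t).linearIndependent]
  exact Nat.card_congr (Equiv.subtypeSubtypeEquivSubtypeInter _
    fun b => (t' ∉ (B.bar b).toSet c ∧ (B.bar b).rightClosed = false) ∧
      t'' ∉ (B.bar b).toSet c ∧ (B.bar b).leftClosed = false)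

end LevelBarcode

end Counting

/-! ### Counting bars by inclusion and exclusion -/

section Indicator

open Classical in
/-- The indicator of a proposition, as an integer. -/
def ind (p : Prop) : ℤ := if p then 1 else 0

lemma ind_and (p q : Prop) : ind (p ∧ q) = ind p * ind q := by
  by_cases hp : p <;> by_cases hq : q <;> simp [ind, hp, hq]

lemma ind_congr {p q : Prop} (h : p ↔ q) : ind p = ind q := by rw [propext h]

/-- If `q` implies `p`, the difference of the indicators is the indicator of the difference. -/
lemma ind_sub {p q s : Prop} (hqp : q → p) (hs : s ↔ p ∧ ¬q) : ind p - ind q = ind s := by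
  by_cases hp : p <;> by_cases hq : q <;> simp_all [ind]

lemma ind_eq_add {p q s : Prop} (hd : ¬(q ∧ s)) (h : p ↔ q ∨ s) : ind p = ind q + ind s := by
  by_cases hq : q <;> by_cases hs : s <;> simp_all [ind]

lemma natCard_eq_sum_ind {τ : Type*} [Fintype τ] (p : τ → Prop) :
    (Nat.card {b // p b} : ℤ) = ∑ b, ind (p b) := by
  classical
  simp only [ind, Finset.sum_boole]
  rw [Nat.card_eq_fintype_card, Fintype.card_subtype]

lemma sum_ind_eq_sum {τ σ : Type*} [Fintype τ] (S : Finset σ) (p : τ → Prop) (k : τ → σ) :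
    ∑ s ∈ S, ∑ b, ind (p b ∧ k b = s) = ∑ b, ind (p b ∧ k b ∈ S) := by
  classical
  rw [Finset.sum_comm]
  refine Finset.sum_congr rfl fun b _ => ?_
  by_cases hp : p b <;> simp [ind, hp]

end Indicator

section Counting

variable {N : ℕ} {c : Fin (N + 1) → ℝ}

/-- The level `t` is not below the left end of the bar. -/
def Bar.Starts (c : Fin (N + 1) → ℝ) (b : Bar N) (t : ℝ) : Prop :=
  c b.left < t ∨ (b.leftClosed = true ∧ c b.left = t)

/-- The level `t` is not above the right end of the bar. -/
def Bar.Reaches (c : Fin (N + 1) → ℝ) (b : Bar N) (t : ℝ) : Prop :=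
  t < c b.right ∨ (b.rightClosed = true ∧ c b.right = t)

lemma Bar.mem_toSet {b : Bar N} {t : ℝ} : t ∈ b.toSet c ↔ b.Starts c t ∧ b.Reaches c t := Iff.rfl

lemma Bar.Starts.mono {b : Bar N} {t t' : ℝ} (h : t ≤ t') (hb : b.Starts c t) :
    b.Starts c t' := by
  rcases hb with hb | ⟨h1, h2⟩
  · exact Or.inl (hb.trans_le h)
  · rcases h.eq_or_lt with h3 | h3
    · exact Or.inr ⟨h1, h2.trans h3⟩
    · exact Or.inl (h2.trans_lt h3)

lemma Bar.Reaches.anti {b : Bar N} {t t' : ℝ} (h : t ≤ t') (hb : b.Reaches c t') :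
    b.Reaches c t := by
  rcases hb with hb | ⟨h1, h2⟩
  · exact Or.inl (h.trans_lt hb)
  · rcases h.eq_or_lt with h3 | h3
    · exact Or.inr ⟨h1, h2.trans h3.symm⟩
    · exact Or.inl (h3.trans_eq h2.symm)

lemma Bar.ind_starts_open (b : Bar N) {a s : ℝ} (h : a < s) (hs : ∀ m, a < c m → s < c m) :
    ind (b.Starts c s) - ind (b.Starts c a) = ind (b.leftClosed = false ∧ c b.left = a) := by
  refine ind_sub (Starts.mono h.le) ?_
  have := hs b.left
  unfold Starts
  rcases lt_trichotomy (c b.left) a with h1 | h1 | h1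
  · simp [h1, h1.ne]
  · simp [h1, h]
  · have h2 := this h1
    simp [h1.ne', h1.not_gt, h2.not_gt, h2.ne']

lemma Bar.ind_starts_closed (b : Bar N) {a s : ℝ} (h : s < a) (hs : ∀ m, c m < a → c m < s) :
    ind (b.Starts c a) - ind (b.Starts c s) = ind (b.leftClosed = true ∧ c b.left = a) := by
  refine ind_sub (Starts.mono h.le) ?_
  have := hs b.left
  unfold Starts
  rcases lt_trichotomy (c b.left) a with h1 | h1 | h1
  · have h2 := this h1
    simp [h1, h1.ne, h2]
  · simp [h1, h.not_gt, h.ne']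
  · simp [h1.ne', h1.not_gt]

lemma Bar.ind_reaches_open (b : Bar N) {a s : ℝ} (h : s < a) (hs : ∀ m, c m < a → c m < s) :
    ind (b.Reaches c s) - ind (b.Reaches c a) = ind (b.rightClosed = false ∧ c b.right = a) := by
  refine ind_sub (Reaches.anti h.le) ?_
  have := hs b.right
  unfold Reaches
  rcases lt_trichotomy (c b.right) a with h1 | h1 | h1
  · have h2 := this h1
    simp [h1.ne, h1.not_gt, h2.not_gt, h2.ne]
  · simp [h1, h]
  · simp [h1, h1.ne']

lemma Bar.ind_reaches_closed (b : Bar N) {a s : ℝ} (h : a < s) (hs : ∀ m, a < c m → s < c m) :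
    ind (b.Reaches c a) - ind (b.Reaches c s) = ind (b.rightClosed = true ∧ c b.right = a) := by
  refine ind_sub (Reaches.anti h.le) ?_
  have := hs b.right
  unfold Reaches
  rcases lt_trichotomy (c b.right) a with h1 | h1 | h1
  · simp [h1.ne, h1.not_gt, (h1.trans h).not_gt, (h1.trans h).ne]
  · simp [h1, h.not_gt, h.ne]
  · simp [h1, this h1, h1.ne']

variable {κ : Type v} [Field κ] {r : ℕ} {X : Type u} [TopologicalSpace X] {f : X → ℝ}

namespace LevelBarcode

variable (B : LevelBarcode κ r f c)

/-- A bar meets both levels if and only if it has started at the lower one and reaches the upper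
one, so its contribution to `i_r` is a product. -/
lemma iNum_eq_sum {t t' : ℝ} (h : t ≤ t') : (iNum κ r f t t' : ℤ) =
    ∑ b, ind ((B.bar b).Starts c t) * ind ((B.bar b).Reaches c t') := by
  rw [B.iNum_eq_card h, natCard_eq_sum_ind]
  refine Finset.sum_congr rfl fun b _ => ?_
  rw [← ind_and]
  refine ind_congr ?_
  rw [Bar.mem_toSet, Bar.mem_toSet]
  exact ⟨fun h1 => ⟨h1.1.1, h1.2.2⟩, fun h1 => ⟨⟨h1.1, h1.2.anti h⟩, h1.1.mono h, h1.2⟩⟩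

lemma count_eq_sum (hc : StrictMono c) (lc rc : Bool) (k j : Fin (N + 1)) :
    (B.count lc rc k j : ℤ) = ∑ b, ind ((B.bar b).leftClosed = lc ∧ c (B.bar b).left = c k) *
      ind ((B.bar b).rightClosed = rc ∧ c (B.bar b).right = c j) := by
  rw [count, natCard_eq_sum_ind]
  refine Finset.sum_congr rfl fun b _ => ?_
  rw [← ind_and, hc.injective.eq_iff, hc.injective.eq_iff]
  refine ind_congr ?_
  tauto

/-- The bars with prescribed kinds of ends, whose ends satisfy a condition. -/
lemma sum_count (lc rc : Bool) (p : Fin (N + 1) × Fin (N + 1) → Prop) [DecidablePred p] :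
    ((∑ q : Fin (N + 1) × Fin (N + 1) with p q, B.count lc rc q.1 q.2 : ℕ) : ℤ) =
      ∑ b, ind (((B.bar b).leftClosed = lc ∧ (B.bar b).rightClosed = rc) ∧
        p ((B.bar b).left, (B.bar b).right)) := by
  have h := sum_ind_eq_sum (Finset.univ.filter p)
    (fun b => (B.bar b).leftClosed = lc ∧ (B.bar b).rightClosed = rc)
    (fun b => ((B.bar b).left, (B.bar b).right))
  simp only [Finset.mem_filter, Finset.mem_univ, true_and] at h
  rw [← h, Nat.cast_sum]
  refine Finset.sum_congr rfl fun q _ => ?_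
  rw [count, natCard_eq_sum_ind]
  refine Finset.sum_congr rfl fun b _ => ind_congr ?_
  rw [Prod.ext_iff]
  tauto

lemma openOpen_eq (hc : StrictMono c) {k j : Fin (N + 1)} (hkj : k < j) {t'' t' : ℝ}
    (h : t'' ≤ t') (hk : JustAbove c k t'') (hj : JustBelow c j t') :
    (B.openOpen k j : ℤ) = iNum κ r f t'' t' - iNum κ r f (c k) t'
      - iNum κ r f t'' (c j) + iNum κ r f (c k) (c j) := by
  rw [openOpen, B.count_eq_sum hc, B.iNum_eq_sum h, B.iNum_eq_sum (hk.1.le.trans h),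
    B.iNum_eq_sum (h.trans hj.1.le), B.iNum_eq_sum (hc hkj).le, ← Finset.sum_sub_distrib,
    ← Finset.sum_sub_distrib, ← Finset.sum_add_distrib]
  refine Finset.sum_congr rfl fun b _ => ?_
  rw [← Bar.ind_starts_open _ hk.1 fun m hm => hk.2 m (hc.lt_iff_lt.1 hm),
    ← Bar.ind_reaches_open _ hj.1 fun m hm => hj.2 m (hc.lt_iff_lt.1 hm)]
  ring

lemma closedClosed_eq (hc : StrictMono c) {k j : Fin (N + 1)} (hkj : k ≤ j) {t'' t' : ℝ}
    (hk : JustBelow c k t'') (hj : JustAbove c j t') :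
    (B.closedClosed k j : ℤ) = iNum κ r f (c k) (c j) - iNum κ r f t'' (c j)
      - iNum κ r f (c k) t' + iNum κ r f t'' t' := by
  have h := hc.monotone hkj
  rw [closedClosed, B.count_eq_sum hc, B.iNum_eq_sum h, B.iNum_eq_sum (hk.1.le.trans h),
    B.iNum_eq_sum (h.trans hj.1.le), B.iNum_eq_sum (hk.1.le.trans (h.trans hj.1.le)),
    ← Finset.sum_sub_distrib, ← Finset.sum_sub_distrib, ← Finset.sum_add_distrib]
  refine Finset.sum_congr rfl fun b _ => ?_
  rw [← Bar.ind_starts_closed _ hk.1 fun m hm => hk.2 m (hc.lt_iff_lt.1 hm),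
    ← Bar.ind_reaches_closed _ hj.1 fun m hm => hj.2 m (hc.lt_iff_lt.1 hm)]
  ring

lemma openClosed_eq (hc : StrictMono c) {k j : Fin (N + 1)} (hkj : k < j) {t'' t' : ℝ}
    (hk : JustAbove c k t'') (hj : JustAbove c j t') :
    (B.openClosed k j : ℤ) = iNum κ r f t'' (c j) - iNum κ r f (c k) (c j)
      - iNum κ r f t'' t' + iNum κ r f (c k) t' := by
  have h := (hk.2 j hkj).le
  rw [openClosed, B.count_eq_sum hc, B.iNum_eq_sum h, B.iNum_eq_sum (hc hkj).le,
    B.iNum_eq_sum (h.trans hj.1.le), B.iNum_eq_sum ((hc hkj).le.trans hj.1.le),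
    ← Finset.sum_sub_distrib, ← Finset.sum_sub_distrib, ← Finset.sum_add_distrib]
  refine Finset.sum_congr rfl fun b _ => ?_
  rw [← Bar.ind_starts_open _ hk.1 fun m hm => hk.2 m (hc.lt_iff_lt.1 hm),
    ← Bar.ind_reaches_closed _ hj.1 fun m hm => hj.2 m (hc.lt_iff_lt.1 hm)]
  ring

lemma closedOpen_eq (hc : StrictMono c) {k j : Fin (N + 1)} (hkj : k < j) {t'' t' : ℝ}
    (hk : JustBelow c k t'') (hj : JustBelow c j t') :
    (B.closedOpen k j : ℤ) = iNum κ r f (c k) t' - iNum κ r f (c k) (c j)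
      - iNum κ r f t'' t' + iNum κ r f t'' (c j) := by
  have h := (hj.2 k hkj).le
  rw [closedOpen, B.count_eq_sum hc, B.iNum_eq_sum h, B.iNum_eq_sum (hc hkj).le,
    B.iNum_eq_sum (hk.1.le.trans h), B.iNum_eq_sum (hk.1.le.trans (hc hkj).le),
    ← Finset.sum_sub_distrib, ← Finset.sum_sub_distrib, ← Finset.sum_add_distrib]
  refine Finset.sum_congr rfl fun b _ => ?_
  rw [← Bar.ind_starts_closed _ hk.1 fun m hm => hk.2 m (hc.lt_iff_lt.1 hm),
    ← Bar.ind_reaches_open _ hj.1 fun m hm => hj.2 m (hc.lt_iff_lt.1 hm)]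
  ring

/-- A bar through `t` does not reach `t' ≥ t` because of an open right end. -/
lemma _root_.LevelPersistence.Bar.dies_up_iff {b : Bar N} {t t' : ℝ} (h : t ≤ t') :
    (t ∈ b.toSet c ∧ t' ∉ b.toSet c ∧ b.rightClosed = false) ↔
      b.Starts c t ∧ b.rightClosed = false ∧ t < c b.right ∧ c b.right ≤ t' := by
  rw [Bar.mem_toSet, Bar.mem_toSet]
  constructor
  · rintro ⟨⟨h1, h2⟩, h3, h4⟩
    refine ⟨h1, h4, h2.resolve_right fun h5 => by simp [h4] at h5, ?_⟩
    by_contra h5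
    exact h3 ⟨h1.mono h, Or.inl (not_le.1 h5)⟩
  · rintro ⟨h1, h2, h3, h4⟩
    refine ⟨⟨h1, Or.inl h3⟩, fun h5 => ?_, h2⟩
    rcases h5.2 with h6 | h6
    · exact h4.not_gt h6
    · simp [h2] at h6

/-- A bar through `t` does not start at `t'' ≤ t` because of an open left end. -/
lemma _root_.LevelPersistence.Bar.dies_down_iff {b : Bar N} {t'' t : ℝ} (h : t'' ≤ t) :
    (t ∈ b.toSet c ∧ t'' ∉ b.toSet c ∧ b.leftClosed = false) ↔
      b.Reaches c t ∧ b.leftClosed = false ∧ t'' ≤ c b.left ∧ c b.left < t := by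
  rw [Bar.mem_toSet, Bar.mem_toSet]
  constructor
  · rintro ⟨⟨h1, h2⟩, h3, h4⟩
    refine ⟨h2, h4, ?_, h1.resolve_right fun h5 => by simp [h4] at h5⟩
    by_contra h5
    exact h3 ⟨Or.inl (not_le.1 h5), h2.anti h⟩
  · rintro ⟨h1, h2, h3, h4⟩
    refine ⟨⟨Or.inl h4, h1⟩, fun h5 => ?_, h2⟩
    rcases h5.1 with h6 | h6
    · exact h3.not_gt h6
    · simp [h2] at h6

lemma lPlusNum_eq_sum_ind {t t' : ℝ} (h : t ≤ t') : (lPlusNum κ r f t t' : ℤ) =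
    ∑ b, ind ((B.bar b).Starts c t ∧ (B.bar b).rightClosed = false ∧ t < c (B.bar b).right ∧
      c (B.bar b).right ≤ t') := by
  rw [B.lPlusNum_eq_card h, natCard_eq_sum_ind]
  exact Finset.sum_congr rfl fun b _ => ind_congr (Bar.dies_up_iff h)

lemma lMinusNum_eq_sum_ind {t'' t : ℝ} (h : t'' ≤ t) : (lMinusNum κ r f t t'' : ℤ) =
    ∑ b, ind ((B.bar b).Reaches c t ∧ (B.bar b).leftClosed = false ∧ t'' ≤ c (B.bar b).left ∧
      c (B.bar b).left < t) := by
  rw [B.lMinusNum_eq_card h, natCard_eq_sum_ind]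
  exact Finset.sum_congr rfl fun b _ => ind_congr (Bar.dies_down_iff h)

lemma eNum_eq_sum_ind {t'' t t' : ℝ} (h : t'' ≤ t) (h' : t ≤ t') : (eNum κ r f t t' t'' : ℤ) =
    ∑ b, ind (((B.bar b).leftClosed = false ∧ t'' ≤ c (B.bar b).left ∧ c (B.bar b).left < t) ∧
      (B.bar b).rightClosed = false ∧ t < c (B.bar b).right ∧ c (B.bar b).right ≤ t') := by
  rw [B.eNum_eq_card h h', natCard_eq_sum_ind]
  refine Finset.sum_congr rfl fun b _ => ind_congr ?_
  have h1 := (B.bar b).dies_up_iff (c := c) h'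
  have h2 := (B.bar b).dies_down_iff (c := c) h
  constructor
  · rintro ⟨h3, h4, h5⟩
    exact ⟨(h2.1 ⟨h3, h5⟩).2, (h1.1 ⟨h3, h4⟩).2⟩
  · rintro ⟨h3, h4⟩
    have h5 := h1.2 ⟨Or.inl h3.2.2, h4⟩
    exact ⟨h5.1, h5.2, (h2.2 ⟨Or.inl h4.2.1, h3⟩).2⟩

lemma lPlusNum_eq {t t' : ℝ} (h : t ≤ t') : lPlusNum κ r f t t' =
    (∑ p : Fin (N + 1) × Fin (N + 1) with c p.1 ≤ t ∧ t < c p.2 ∧ c p.2 ≤ t',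
      B.closedOpen p.1 p.2) +
    ∑ p : Fin (N + 1) × Fin (N + 1) with c p.1 < t ∧ t < c p.2 ∧ c p.2 ≤ t',
      B.openOpen p.1 p.2 := by
  have h1 := B.sum_count true false fun p => c p.1 ≤ t ∧ t < c p.2 ∧ c p.2 ≤ t'
  have h2 := B.sum_count false false fun p => c p.1 < t ∧ t < c p.2 ∧ c p.2 ≤ t'
  unfold closedOpen openOpen
  zify
  push_cast at h1 h2
  rw [h1, h2, B.lPlusNum_eq_sum_ind h, ← Finset.sum_add_distrib]
  refine Finset.sum_congr rfl fun b _ => ind_eq_add (fun h3 => ?_) ?_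
  · simp [h3.1.1.1] at h3
  · unfold Bar.Starts
    rcases (B.bar b).leftClosed with _ | _
    · simp
      tauto
    · simp [le_iff_lt_or_eq]
      tauto

lemma lMinusNum_eq {t'' t : ℝ} (h : t'' ≤ t) : lMinusNum κ r f t t'' =
    (∑ p : Fin (N + 1) × Fin (N + 1) with t'' ≤ c p.1 ∧ c p.1 < t ∧ t ≤ c p.2,
      B.openClosed p.1 p.2) +
    ∑ p : Fin (N + 1) × Fin (N + 1) with t'' ≤ c p.1 ∧ c p.1 < t ∧ t < c p.2,
      B.openOpen p.1 p.2 := by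
  have h1 := B.sum_count false true fun p => t'' ≤ c p.1 ∧ c p.1 < t ∧ t ≤ c p.2
  have h2 := B.sum_count false false fun p => t'' ≤ c p.1 ∧ c p.1 < t ∧ t < c p.2
  unfold openClosed openOpen
  zify
  push_cast at h1 h2
  rw [h1, h2, B.lMinusNum_eq_sum_ind h, ← Finset.sum_add_distrib]
  refine Finset.sum_congr rfl fun b _ => ind_eq_add (fun h3 => ?_) ?_
  · simp [h3.1.1.2] at h3
  · unfold Bar.Reaches
    rcases (B.bar b).rightClosed with _ | _
    · simp
      tauto
    · simp [le_iff_lt_or_eq (a := t), eq_comm (a := t)]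
      tauto

lemma eNum_eq {t'' t t' : ℝ} (h : t'' ≤ t) (h' : t ≤ t') : eNum κ r f t t' t'' =
    ∑ p : Fin (N + 1) × Fin (N + 1) with
      t'' ≤ c p.1 ∧ c p.1 < t ∧ t < c p.2 ∧ c p.2 ≤ t', B.openOpen p.1 p.2 := by
  have h1 := B.sum_count false false fun p => t'' ≤ c p.1 ∧ c p.1 < t ∧ t < c p.2 ∧ c p.2 ≤ t'
  unfold openOpen
  zify
  push_cast at h1
  rw [h1, B.eNum_eq_sum_ind h h']
  refine Finset.sum_congr rfl fun b _ => ind_congr ?_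
  tauto

lemma lNum_eq (B : LevelBarcode κ r f c) (t : ℝ) : lNum κ r f t = iNum κ r f t t := by
  rw [B.lNum_eq_card, B.iNum_eq_card le_rfl]
  simp only [and_self]

/-! ### Recovering the other numbers from the numbers `i_r` -/

/-- The levels `s - δ` and `s + δ` are separated from `s` by no value of `c`, for all `s ∈ S`. -/
def _root_.LevelPersistence.IsSeparating (c : Fin (N + 1) → ℝ) (S : Finset ℝ) (δ : ℝ) : Prop :=
  0 < δ ∧ ∀ s ∈ S, ∀ m, (c m < s → c m < s - δ) ∧ (s < c m → s + δ < c m)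

/-- The number of bars with an open right end at `s` among those starting at or before `t` is the
drop of `i_r(t, ·)` at `s`. Summing over a set `S` which contains the critical values, but possibly
others, makes the formula uniform in the map. -/
lemma lPlusNum_eq_sum_iNum (B : LevelBarcode κ r f c) {S : Finset ℝ}
    (hS : ∀ m, c m ∈ S) {δ : ℝ} (hδ : IsSeparating c S δ) {t t' : ℝ} (h : t ≤ t')
    (ht : ∀ s ∈ S, t < s → t < s - δ) :
    (lPlusNum κ r f t t' : ℤ) =
      ∑ s ∈ S with t < s ∧ s ≤ t', ((iNum κ r f t (s - δ) : ℤ) - iNum κ r f t s) := by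
  have h1 : ∀ s ∈ S.filter fun s => t < s ∧ s ≤ t',
      ((iNum κ r f t (s - δ) : ℤ) - iNum κ r f t s) =
      ∑ b, ind (((B.bar b).Starts c t ∧ (B.bar b).rightClosed = false) ∧
        c (B.bar b).right = s) := by
    intro s hs
    obtain ⟨hsS, hts, -⟩ := Finset.mem_filter.1 hs
    rw [B.iNum_eq_sum (ht s hsS hts).le, B.iNum_eq_sum hts.le, ← Finset.sum_sub_distrib]
    refine Finset.sum_congr rfl fun b _ => ?_
    rw [← mul_sub, Bar.ind_reaches_open _ (sub_lt_self s hδ.1) fun m => (hδ.2 s hsS m).1,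
      ← ind_and, and_assoc]
  rw [Finset.sum_congr rfl h1, sum_ind_eq_sum, B.lPlusNum_eq_sum_ind h]
  refine Finset.sum_congr rfl fun b _ => ind_congr ?_
  rw [Finset.mem_filter]
  have := hS (B.bar b).right
  tauto

lemma lMinusNum_eq_sum_iNum (B : LevelBarcode κ r f c) {S : Finset ℝ}
    (hS : ∀ m, c m ∈ S) {δ : ℝ} (hδ : IsSeparating c S δ) {t'' t : ℝ} (h : t'' ≤ t)
    (ht : ∀ s ∈ S, s < t → s + δ < t) :
    (lMinusNum κ r f t t'' : ℤ) =
      ∑ s ∈ S with t'' ≤ s ∧ s < t, ((iNum κ r f (s + δ) t : ℤ) - iNum κ r f s t) := by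
  have h1 : ∀ s ∈ S.filter fun s => t'' ≤ s ∧ s < t,
      ((iNum κ r f (s + δ) t : ℤ) - iNum κ r f s t) =
      ∑ b, ind (((B.bar b).Reaches c t ∧ (B.bar b).leftClosed = false) ∧
        c (B.bar b).left = s) := by
    intro s hs
    obtain ⟨hsS, -, hts⟩ := Finset.mem_filter.1 hs
    rw [B.iNum_eq_sum (ht s hsS hts).le, B.iNum_eq_sum hts.le, ← Finset.sum_sub_distrib]
    refine Finset.sum_congr rfl fun b _ => ?_
    rw [← sub_mul, Bar.ind_starts_open _ (lt_add_of_pos_right s hδ.1) fun m => (hδ.2 s hsS m).2,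
      mul_comm, ← ind_and, and_assoc]
  rw [Finset.sum_congr rfl h1, sum_ind_eq_sum, B.lMinusNum_eq_sum_ind h]
  refine Finset.sum_congr rfl fun b _ => ind_congr ?_
  rw [Finset.mem_filter]
  have := hS (B.bar b).left
  tauto

/-- The bars with open ends at `a` and `s` are counted by the mixed second difference of `i_r` at
`(a, s)`. -/
lemma eNum_eq_sum_iNum (B : LevelBarcode κ r f c) {S : Finset ℝ}
    (hS : ∀ m, c m ∈ S) {δ : ℝ} (hδ : IsSeparating c S δ) {t'' t t' : ℝ} (h : t'' ≤ t) (h' : t ≤ t')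
    (ht : ∀ s ∈ S, (t < s → t < s - δ) ∧ (s < t → s + δ < t)) :
    (eNum κ r f t t' t'' : ℤ) = ∑ a ∈ S with t'' ≤ a ∧ a < t, ∑ s ∈ S with t < s ∧ s ≤ t',
      ((iNum κ r f (a + δ) (s - δ) : ℤ) - iNum κ r f a (s - δ) -
        iNum κ r f (a + δ) s + iNum κ r f a s) := by
  have h1 : ∀ a ∈ S.filter fun s => t'' ≤ s ∧ s < t, ∀ s ∈ S.filter fun s => t < s ∧ s ≤ t',
      ((iNum κ r f (a + δ) (s - δ) : ℤ) - iNum κ r f a (s - δ) -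
        iNum κ r f (a + δ) s + iNum κ r f a s) =
      ∑ b, ind ((((B.bar b).leftClosed = false ∧ c (B.bar b).left = a) ∧
        (B.bar b).rightClosed = false) ∧ c (B.bar b).right = s) := by
    intro a ha s hs
    obtain ⟨haS, -, hat⟩ := Finset.mem_filter.1 ha
    obtain ⟨hsS, hts, -⟩ := Finset.mem_filter.1 hs
    have h2 := (ht a haS).2 hat
    have h3 := (ht s hsS).1 hts
    rw [B.iNum_eq_sum (h2.trans h3).le, B.iNum_eq_sum (hat.trans h3).le,
      B.iNum_eq_sum (h2.trans hts).le, B.iNum_eq_sum (hat.trans hts).le,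
      ← Finset.sum_sub_distrib, ← Finset.sum_sub_distrib, ← Finset.sum_add_distrib]
    refine Finset.sum_congr rfl fun b _ => ?_
    rw [and_assoc, ind_and, ← Bar.ind_reaches_open _ (sub_lt_self s hδ.1) fun m => (hδ.2 s hsS m).1,
      ← Bar.ind_starts_open _ (lt_add_of_pos_right a hδ.1) fun m => (hδ.2 a haS m).2]
    ring
  rw [Finset.sum_congr rfl fun a ha => Finset.sum_congr rfl (h1 a ha)]
  simp only [sum_ind_eq_sum]
  have h2 : ∀ a b, ind ((((B.bar b).leftClosed = false ∧ c (B.bar b).left = a) ∧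
        (B.bar b).rightClosed = false) ∧
        c (B.bar b).right ∈ S.filter fun s => t < s ∧ s ≤ t') =
      ind (((B.bar b).leftClosed = false ∧ (B.bar b).rightClosed = false ∧
        c (B.bar b).right ∈ S.filter fun s => t < s ∧ s ≤ t') ∧ c (B.bar b).left = a) :=
    fun a b => ind_congr (by tauto)
  simp only [h2, sum_ind_eq_sum]
  rw [B.eNum_eq_sum_ind h h']
  refine Finset.sum_congr rfl fun b _ => ind_congr ?_
  rw [Finset.mem_filter, Finset.mem_filter]
  have h3 := hS (B.bar b).left
  have h4 := hS (B.bar b).right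
  tauto

end LevelBarcode

/-- One `δ` separates the values of two maps at once, which makes the two formulas comparable. -/
lemma exists_isSeparating {M : ℕ} (c : Fin (N + 1) → ℝ) (d : Fin (M + 1) → ℝ) (t : ℝ)
    (S : Finset ℝ) : ∃ δ, IsSeparating c S δ ∧ IsSeparating d S δ ∧
      ∀ s ∈ S, (t < s → t < s - δ) ∧ (s < t → s + δ < t) := by
  classical
  let T : Finset ℝ := insert t (Finset.univ.image c ∪ Finset.univ.image d)
  have hev : ∀ᶠ δ in nhdsWithin (0 : ℝ) (Set.Ioi 0), ∀ s ∈ S, ∀ a ∈ T,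
      (a < s → a < s - δ) ∧ (s < a → s + δ < a) := by
    refine (Filter.eventually_all_finset S).2 fun s _ =>
      (Filter.eventually_all_finset T).2 fun a _ => ?_
    rcases lt_trichotomy a s with h | h | h
    · filter_upwards [Ioo_mem_nhdsGT (sub_pos.2 h)] with δ hδ
      exact ⟨fun _ => by linarith [hδ.2], fun h' => absurd h h'.not_gt⟩
    · exact Filter.Eventually.of_forall fun δ => ⟨fun h' => absurd h h'.ne,
        fun h' => absurd h h'.ne'⟩
    · filter_upwards [Ioo_mem_nhdsGT (sub_pos.2 h)] with δ hδ
      exact ⟨fun h' => absurd h h'.not_gt, fun _ => by linarith [hδ.2]⟩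
  obtain ⟨δ, h1, h2⟩ := (hev.and self_mem_nhdsWithin).exists
  refine ⟨δ, ⟨h2, fun s hs m => h1 s hs (c m) (by simp [T])⟩,
    ⟨h2, fun s hs m => h1 s hs (d m) (by simp [T])⟩, fun s hs => h1 s hs t (by simp [T])⟩

/-- Two maps with level bar codes and with the same numbers `i_r` have the same remaining
numbers. -/
theorem LevelBarcode.eq_of_iNum_eq {Y : Type w} [TopologicalSpace Y] {g : Y → ℝ} {M : ℕ}
    {d : Fin (M + 1) → ℝ} (B : LevelBarcode κ r f c) (B' : LevelBarcode κ r g d)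
    (hi : ∀ t t', t ≤ t' → iNum κ r f t t' = iNum κ r g t t') :
    (∀ t, lNum κ r f t = lNum κ r g t) ∧
    (∀ t t', t ≤ t' → lPlusNum κ r f t t' = lPlusNum κ r g t t') ∧
    (∀ t'' t, t'' ≤ t → lMinusNum κ r f t t'' = lMinusNum κ r g t t'') ∧
    (∀ t'' t t', t'' ≤ t → t ≤ t' → eNum κ r f t t' t'' = eNum κ r g t t' t'') := by
  classical
  let S : Finset ℝ := Finset.univ.image c ∪ Finset.univ.image d
  have hSc : ∀ m, c m ∈ S := fun m => by simp [S]
  have hSd : ∀ m, d m ∈ S := fun m => by simp [S]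
  refine ⟨fun t => ?_, fun t t' h => ?_, fun t'' t h => ?_, fun t'' t t' h h' => ?_⟩
  · rw [B.lNum_eq, B'.lNum_eq, hi t t le_rfl]
  all_goals
    obtain ⟨δ, hδc, hδd, ht⟩ := exists_isSeparating c d t S
    zify
  · have hts := fun s hs => (ht s hs).1
    rw [B.lPlusNum_eq_sum_iNum hSc hδc h hts, B'.lPlusNum_eq_sum_iNum hSd hδd h hts]
    refine Finset.sum_congr rfl fun s hs => ?_
    obtain ⟨hsS, hs, -⟩ := Finset.mem_filter.1 hs
    rw [hi _ _ (hts s hsS hs).le, hi _ _ hs.le]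
  · have hts := fun s hs => (ht s hs).2
    rw [B.lMinusNum_eq_sum_iNum hSc hδc h hts, B'.lMinusNum_eq_sum_iNum hSd hδd h hts]
    refine Finset.sum_congr rfl fun s hs => ?_
    obtain ⟨hsS, -, hs⟩ := Finset.mem_filter.1 hs
    rw [hi _ _ (hts s hsS hs).le, hi _ _ hs.le]
  · rw [B.eNum_eq_sum_iNum hSc hδc h h' ht, B'.eNum_eq_sum_iNum hSd hδd h h' ht]
    refine Finset.sum_congr rfl fun a ha => Finset.sum_congr rfl fun s hs => ?_
    obtain ⟨haS, -, ha⟩ := Finset.mem_filter.1 ha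
    obtain ⟨hsS, hs, -⟩ := Finset.mem_filter.1 hs
    have h2 := (ht a haS).2 ha
    have h3 := (ht s hsS).1 hs
    rw [hi _ _ (h2.trans h3).le, hi _ _ (ha.trans h3).le, hi _ _ (h2.trans hs).le,
      hi _ _ (ha.trans hs).le]

end Counting

end

end LevelPersistence

theorem theorem4p2 (κ : Type v) [Field κ] (r : ℕ) {X : Type u} [TopologicalSpace X]
    (f : X → ℝ) {N : ℕ} (c : Fin (N + 1) → ℝ) (hf : IsTame f c) :
    -- all the dimensions involved are finite
    (∀ t, Module.Finite κ (levelHomology κ r f t)) ∧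
    -- the level bar code exists
    Nonempty (LevelBarcode κ r f c) ∧
    (∀ t, lNum κ r f t = iNum κ r f t t) ∧
    -- the bar code counts in terms of the numbers `i_r`
    (∀ B : LevelBarcode κ r f c,
      (∀ k j, k < j → ∀ t'' t', t'' ≤ t' → JustAbove c k t'' → JustBelow c j t' →
        (B.openOpen k j : ℤ) = iNum κ r f t'' t' - iNum κ r f (c k) t'
          - iNum κ r f t'' (c j) + iNum κ r f (c k) (c j)) ∧
      (∀ k j, k ≤ j → ∀ t'' t', JustBelow c k t'' → JustAbove c j t' →
        (B.closedClosed k j : ℤ) = iNum κ r f (c k) (c j) - iNum κ r f t'' (c j)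
          - iNum κ r f (c k) t' + iNum κ r f t'' t') ∧
      (∀ k j, k < j → ∀ t'' t', JustAbove c k t'' → JustAbove c j t' →
        (B.openClosed k j : ℤ) = iNum κ r f t'' (c j) - iNum κ r f (c k) (c j)
          - iNum κ r f t'' t' + iNum κ r f (c k) t') ∧
      (∀ k j, k < j → ∀ t'' t', JustBelow c k t'' → JustBelow c j t' →
        (B.closedOpen k j : ℤ) = iNum κ r f (c k) t' - iNum κ r f (c k) (c j)
          - iNum κ r f t'' t' + iNum κ r f t'' (c j)) ∧
      -- the other relevant persistence numbers in terms of the bar code counts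
      (∀ t t', t ≤ t' → lPlusNum κ r f t t' =
        (∑ p : Fin (N + 1) × Fin (N + 1) with c p.1 ≤ t ∧ t < c p.2 ∧ c p.2 ≤ t',
          B.closedOpen p.1 p.2) +
        ∑ p : Fin (N + 1) × Fin (N + 1) with c p.1 < t ∧ t < c p.2 ∧ c p.2 ≤ t',
          B.openOpen p.1 p.2) ∧
      (∀ t'' t, t'' ≤ t → lMinusNum κ r f t t'' =
        (∑ p : Fin (N + 1) × Fin (N + 1) with t'' ≤ c p.1 ∧ c p.1 < t ∧ t ≤ c p.2,
          B.openClosed p.1 p.2) +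
        ∑ p : Fin (N + 1) × Fin (N + 1) with t'' ≤ c p.1 ∧ c p.1 < t ∧ t < c p.2,
          B.openOpen p.1 p.2) ∧
      (∀ t'' t t', t'' ≤ t → t ≤ t' → eNum κ r f t t' t'' =
        ∑ p : Fin (N + 1) × Fin (N + 1) with
          t'' ≤ c p.1 ∧ c p.1 < t ∧ t < c p.2 ∧ c p.2 ≤ t', B.openOpen p.1 p.2)) ∧
    -- two tame maps with the same numbers `i_r` have the same numbers `l_r, l_r^+, l_r^-, e_r`
    (∀ {Y : Type w} [TopologicalSpace Y] (g : Y → ℝ) {M : ℕ} (d : Fin (M + 1) → ℝ),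
      IsTame g d → (∀ t t', t ≤ t' → iNum κ r f t t' = iNum κ r g t t') →
        (∀ t, lNum κ r f t = lNum κ r g t) ∧
        (∀ t t', t ≤ t' → lPlusNum κ r f t t' = lPlusNum κ r g t t') ∧
        (∀ t'' t, t'' ≤ t → lMinusNum κ r f t t'' = lMinusNum κ r g t t'') ∧
        (∀ t'' t t', t'' ≤ t → t ≤ t' → eNum κ r f t t' t'' = eNum κ r g t t' t'')) := by
  have hc := hf.strictMono
  obtain ⟨B₀⟩ := hf.exists_levelBarcode (κ := κ) (r := r)
  refine ⟨hf.locallyTame.finite_level κ r hf.compactANR, ⟨B₀⟩, B₀.lNum_eq, fun B => ?_, ?_⟩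
  · exact ⟨fun k j hkj t'' t' h hk hj => B.openOpen_eq hc hkj h hk hj,
      fun k j hkj t'' t' hk hj => B.closedClosed_eq hc hkj hk hj,
      fun k j hkj t'' t' hk hj => B.openClosed_eq hc hkj hk hj,
      fun k j hkj t'' t' hk hj => B.closedOpen_eq hc hkj hk hj,
      fun t t' h => B.lPlusNum_eq h, fun t'' t h => B.lMinusNum_eq h,
      fun t'' t t' h h' => B.eNum_eq h h'⟩
  · intro Y _ g M d hg hi
    obtain ⟨B₁⟩ := hg.exists_levelBarcode (κ := κ) (r := r)
    exact B₀.eq_of_iNum_eq B₁ hi
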